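/- Let $k,m\in\mathbb{N}$ with $k,m\ge 1$, let $M\in\mathbb N$ with $M\ge 2$, let $T>0$ and $\mathbb F\in\{\mathbb R,\mathbb C\}$. Let $\alpha_1,\dots,\alpha_k\in C(\mathbb R,\mathbb F^{m\times m})$ be $T$-periodic with $\alpha_k(x)$ invertible for all $x\in\mathbb R$, and put $Au=\sum_{i=1}^k\alpha_i\,\partial_x^iu$. Let $\mathcal N\colon\mathbb F^m\times\mathbb R\to\mathbb F^m$ be continuous, $T$-periodic in its second argument and twice continuously differentiable (over $\mathbb F$) in its first argument, with $\partial_u\mathcal N$ and $\partial_u^2\mathcal N$ jointly continuous on $\mathbb F^m\times\mathbb R$. Consider the stationary problem $$Au+\mathcal N(u,\cdot)=0\quad\text{on }\mathbb R,\tag{1}$$ where a solution is a function $u\in H^k_{\mathrm{loc}}(\mathbb R)$ that satisfies (1) almost everywhere. A function $z\in L^\infty(\mathbb R)$ is called nondegenerate if the operator $\mathcal L(z)u=Au+\partial_u\mathcal N(z,\cdot)u$ in $L^2(\mathbb R)$ with domain $H^k(\mathbb R)$ is invertible. Let $\chi_\pm\colon\mathbb R\to[0,1]$ be smooth functions with $\chi_-+\chi_+=1$,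 $\chi_+$ supported on $(-1,\infty)$ and $\chi_-$ supported on $(-\infty,1)$. Assume: (H1) $Z_1,\dots,Z_M\in L^\infty(\mathbb R)$ and $v_{1,\pm},\dots,v_{M,\pm}\in H^k_{\mathrm{per}}(0,T)$ (extended $T$-periodically to $\mathbb R$) satisfy $\chi_\pm(Z_j-v_{j,\pm})\in H^k(\mathbb R)$ for $j=1,\dots,M$. (H2) $v_{j,+}=v_{j+1,-}$ for $j=1,\dots,M-1$. (H3) For $j=1,\dots,M$, $Z_j$ is a solution of (1) and is nondegenerate. Let $K\in\mathbb R$. Then there exist $C>0$ and $N\in\mathbb N$ with the following property. For every $n\ge1$ let $\chi_{1,n},\dots,\chi_{M,n}\colon\mathbb R\to[0,1]$ be a smooth partition of unity on $\mathbb R$ such that $|\partial_x^i\chi_{j,n}|\le K$ on $\mathbb R$ for all $0\le i\le k$ and $1\le j\le M$, with $\chi_{1,n}$ supported on $(-\infty,\frac32nT+1)$, $\chi_{M,n}$ supported on $((M-\frac12)nT-1,\infty)$, and $\chi_{j,n}$ supported on $((j-\frac12)nT-1,(j+\frac12)nT+1)$ for $1<j<M$, and put $$w_n=\sum_{j=1}^M\chi_{j,n}\,Z_j(\cdot-jnT).$$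 Then there is a sequence $(a_n)_n$ of functions $\mathbb R\to\mathbb F^m$ such that for all $n\ge N$ we have $a_n\in H^k(\mathbb R)$, the function $u_n=w_n+a_n$ is a solution of (1) (an $M$-front), and, with $\Omega_n=\mathbb R\setminus[-\frac n2T+1,\frac n2T-1]$, $$\|a_n\|_{H^k(\mathbb R)}\le C\sum_{j=1}^M\Big(\|\chi_-(Z_j-v_{j,-})\|_{H^k(\Omega_n)}+\|\chi_+(Z_j-v_{j,+})\|_{H^k(\Omega_n)}\Big).$$ Moreover, $\|a_n\|_{H^k(\mathbb R)}\to0$ as $n\to\infty$. -/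

import Mathlib

open MeasureTheory Set Filter Topology
open scoped ContDiff

noncomputable section

/-! ### Sobolev spaces on open subsets of the real line -/

section Sobolev

variable {E : Type*} [NormedAddCommGroup E] [NormedSpace ℝ E]

/-- `g` is the `i`-th weak derivative of `f` on the open set `Ω ⊆ ℝ`. -/
structure IsWeakDeriv (i : ℕ) (Ω : Set ℝ) (f g : ℝ → E) : Prop where
  locInt_left : LocallyIntegrableOn f Ω volume
  locInt_right : LocallyIntegrableOn g Ω volume
  integral_eq : ∀ φ : ℝ → ℝ, ContDiff ℝ ∞ φ → HasCompactSupport φ → tsupport φ ⊆ Ω →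
    ∫ x in Ω, iteratedDeriv i φ x • f x = (-1 : ℝ) ^ i • ∫ x in Ω, φ x • g x

open Classical in
/-- The `i`-th weak derivative of `f` on `Ω` (unique up to null sets; `0` if there is none). -/
def weakDeriv (i : ℕ) (Ω : Set ℝ) (f : ℝ → E) : ℝ → E :=
  if h : ∃ g, IsWeakDeriv i Ω f g then h.choose else 0

/-- `f ∈ H^k(Ω)`: the weak derivatives of order `0, …, k` exist and lie in `L²(Ω)`. -/
def MemHk (k : ℕ) (Ω : Set ℝ) (f : ℝ → E) : Prop :=
  ∀ i ≤ k, ∃ g, IsWeakDeriv i Ω f g ∧ MemLp g 2 (volume.restrict Ω)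

/-- The norm of `H^k(Ω)`. -/
def HkNorm (k : ℕ) (Ω : Set ℝ) (f : ℝ → E) : ℝ :=
  Real.sqrt (∑ i ∈ Finset.range (k + 1),
    (eLpNorm (weakDeriv i Ω f) 2 (volume.restrict Ω)).toReal ^ 2)

/-- `f ∈ H^k_loc(ℝ)`. -/
def MemHkLoc (k : ℕ) (f : ℝ → E) : Prop :=
  ∀ i ≤ k, ∃ g, IsWeakDeriv i univ f g ∧
    ∀ R : ℝ, MemLp g 2 (volume.restrict (Icc (-R) R))

/-- `f ∈ H^k_per(0,T)`, where elements of this space are regarded as `T`-periodic functions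
on the real line. -/
def MemHkPer (k : ℕ) (T : ℝ) (f : ℝ → E) : Prop :=
  Function.Periodic f T ∧ MemHkLoc k f

end Sobolev

/-! ### The existence problem and its linearization -/

/-- The data of the stationary problem `A u + 𝒩(u, ·) = 0`, where
`A u = α_k ∂ₓ^k u + … + α_1 ∂ₓ u`, with `T`-periodic ingredients. -/
structure PeriodicSystem (𝔽 : Type) [RCLike 𝔽] (k m : ℕ) (T : ℝ) where
  /-- the coefficients; only the indices `1, …, k` are used -/
  α : ℕ → ℝ → Matrix (Fin m) (Fin m) 𝔽
  /-- the nonlinearity `𝒩(u, x)` -/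
  nl : EuclideanSpace 𝔽 (Fin m) → ℝ → EuclideanSpace 𝔽 (Fin m)
  α_continuous : ∀ i, 1 ≤ i → i ≤ k → Continuous (α i)
  α_periodic : ∀ i, 1 ≤ i → i ≤ k → Function.Periodic (α i) T
  α_isUnit : ∀ x, IsUnit (α k x)
  nl_continuous : Continuous fun p : EuclideanSpace 𝔽 (Fin m) × ℝ => nl p.1 p.2
  nl_periodic : ∀ u, Function.Periodic (nl u) T
  nl_contDiff : ∀ x, ContDiff 𝔽 2 fun u => nl u x
  nl_continuous_fderiv : Continuous fun p : EuclideanSpace 𝔽 (Fin m) × ℝ =>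
    fderiv 𝔽 (fun u => nl u p.2) p.1
  nl_continuous_fderiv_fderiv : Continuous fun p : EuclideanSpace 𝔽 (Fin m) × ℝ =>
    fderiv 𝔽 (fderiv 𝔽 (fun u => nl u p.2)) p.1

namespace PeriodicSystem

variable {𝔽 : Type} [RCLike 𝔽] {k m : ℕ} {T : ℝ}

/-- The differential expression `A u = α_k ∂ₓ^k u + … + α_1 ∂ₓ u` with weak derivatives. -/
def diffOp (S : PeriodicSystem 𝔽 k m T) (u : ℝ → EuclideanSpace 𝔽 (Fin m)) (x : ℝ) :
    EuclideanSpace 𝔽 (Fin m) :=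
  ∑ i ∈ Finset.Icc 1 k,
    Matrix.toEuclideanCLM (n := Fin m) (𝕜 := 𝔽) (S.α i x) (weakDeriv i univ u x)

/-- `u` solves `A u + 𝒩(u, ·) = 0`. -/
def IsSolution (S : PeriodicSystem 𝔽 k m T) (u : ℝ → EuclideanSpace 𝔽 (Fin m)) : Prop :=
  MemHkLoc k u ∧ ∀ᵐ x, S.diffOp u x + S.nl (u x) x = 0

/-- The linearization `ℒ(z) u = A u + ∂_u 𝒩(z, ·) u`. -/
def linearization (S : PeriodicSystem 𝔽 k m T) (z u : ℝ → EuclideanSpace 𝔽 (Fin m)) (x : ℝ) :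
    EuclideanSpace 𝔽 (Fin m) :=
  S.diffOp u x + fderiv 𝔽 (fun w => S.nl w x) (z x) (u x)

/-- `z` is nondegenerate: `ℒ(z)`, as an operator in `L²(ℝ)` with domain `H^k(ℝ)`, is
invertible. Since `ℒ(z)` is closed for `z ∈ L^∞(ℝ)`, its inverse is automatically bounded. -/
def IsNondegenerate (S : PeriodicSystem 𝔽 k m T) (z : ℝ → EuclideanSpace 𝔽 (Fin m)) : Prop :=
  ∀ g : ℝ → EuclideanSpace 𝔽 (Fin m), MemLp g 2 volume →
    (∃ u, MemHk k univ u ∧ S.linearization z u =ᵐ[volume] g) ∧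
    ∀ u₁ u₂, MemHk k univ u₁ → MemHk k univ u₂ →
      S.linearization z u₁ =ᵐ[volume] g → S.linearization z u₂ =ᵐ[volume] g →
      u₁ =ᵐ[volume] u₂

end PeriodicSystem

/-! ### Partitions of unity and formal concatenations -/

/-- The smooth partition of unity `χ_±`. -/
structure IsCutoffPair (χm χp : ℝ → ℝ) : Prop where
  smooth_m : ContDiff ℝ ∞ χm
  smooth_p : ContDiff ℝ ∞ χp
  mem_m : ∀ x, χm x ∈ Icc (0 : ℝ) 1
  mem_p : ∀ x, χp x ∈ Icc (0 : ℝ) 1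
  add_eq_one : ∀ x, χm x + χp x = 1
  support_m : Function.support χm ⊆ Iio 1
  support_p : Function.support χp ⊆ Ioi (-1)

/-- The smooth partition of unity `χ_{1,n}, …, χ_{M,n}` adapted to interfaces at
`nT, 2nT, …, MnT`, with `W^{k,∞}`-norms bounded by `K`. -/
structure IsInterfacePartition (k M : ℕ) (T K : ℝ) (n : ℕ) (χ : ℕ → ℝ → ℝ) : Prop where
  smooth : ∀ j ∈ Finset.Icc 1 M, ContDiff ℝ ∞ (χ j)
  mem_Icc : ∀ j ∈ Finset.Icc 1 M, ∀ x, χ j x ∈ Icc (0 : ℝ) 1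
  sum_eq_one : ∀ x, ∑ j ∈ Finset.Icc 1 M, χ j x = 1
  deriv_bound : ∀ j ∈ Finset.Icc 1 M, ∀ i ≤ k, ∀ x, |iteratedDeriv i (χ j) x| ≤ K
  support_first : Function.support (χ 1) ⊆ Iio (3 / 2 * (n * T) + 1)
  support_last : Function.support (χ M) ⊆ Ioi (((M : ℝ) - 1 / 2) * (n * T) - 1)
  support_mid : ∀ j, 1 < j → j < M → Function.support (χ j) ⊆
    Ioo (((j : ℝ) - 1 / 2) * (n * T) - 1) (((j : ℝ) + 1 / 2) * (n * T) + 1)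

/-- The formal concatenation `w_n = ∑_{j=1}^M χ_{j,n} Z_j(· - jnT)`. -/
def concatenation {E : Type*} [AddCommGroup E] [Module ℝ E] (M : ℕ) (T : ℝ) (n : ℕ)
    (χ : ℕ → ℝ → ℝ) (Z : ℕ → ℝ → E) (x : ℝ) : E :=
  ∑ j ∈ Finset.Icc 1 M, χ j x • Z j (x - j * n * T)

/-- The exterior domain `ℝ ∖ [-nT/2 + 1, nT/2 - 1]`. -/
def tailSet (T : ℝ) (n : ℕ) : Set ℝ := (Icc (-(n / 2 * T) + 1) (n / 2 * T - 1))ᶜ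

end

/-!
A multi-front is found near the formal concatenation `w_n` by a contraction argument, and only an
approximate right inverse of the linearization at `w_n` is needed for it.

*Right inverses.* By the open mapping theorem on `H^k(ℝ)`, realized as a closed subspace of
`L²(ℝ)^{k+1}` (`sobolevTuples`), nondegeneracy gives each `ℒ(Z_j)` a bounded inverse `R_j`
(`IsNondegenerate.exists_inverse`). Let `ψ_j` be a cutoff function that equals `1` on the support of
`χ_{j,n}` and varies on the length scale `nT`, and let `τ_j` be the translation by `jnT`, which
commutes with the coefficients. Then `P g = ∑ j, ψ_j τ_j R_j τ_j⁻¹ (χ_{j,n} g)` satisfies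
`ℒ(w_n) P g = g + O(η) ‖g‖`: the commutators of `A` with `ψ_j` are of order `1 / n`, and on the
support of `ψ_j` the concatenation is uniformly close to the `j`-th front, because `H^1`-functions
vanish at infinity and neighbouring fronts share their end state
(`exists_local_parametrix`, `exists_parametrix_concatenation`).

*Residual.* At each point at most two neighbouring fronts interact, and there `w_n` differs from
either of them, with its derivatives, only by the deviations of these fronts from their common end
state. Since translated fronts are solutions, `A w_n + 𝒩(w_n, ·)` is bounded in `L²(ℝ)` by the
`H^k`-norms of these deviations outside of a large interval (`residual_bound`).

*Contraction.* The correction is sought in the form `a = P g` with `g ∈ L²(ℝ)`. The map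
`g ↦ g - (A (w_n + P g) + 𝒩(w_n + P g, ·))` has the Lipschitz constant `1 / 2` on a ball that does
not depend on `n`: its linear part is the error of `P`, and the quadratic remainder of `𝒩` is
controlled by `H^1 ⊆ L^∞`. Its value at `0` is the residual, so a fixed point exists once the
residual is small, and its norm is at most twice that of the residual
(`exists_solution_of_parametrix`).

The Sobolev facts about weak derivatives (`exists_ae_norm_le_integral_Icc` and its consequences)
come from comparing mollifications at two scales.
-/

noncomputable section

/-! ### Calculus of weak derivatives -/

section WeakDerivatives

variable {E : Type*} [NormedAddCommGroup E] [NormedSpace ℝ E]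

lemma isWeakDeriv_univ_iff {i : ℕ} {f g : ℝ → E} :
    IsWeakDeriv i univ f g ↔ LocallyIntegrable f ∧ LocallyIntegrable g ∧
      ∀ φ : ℝ → ℝ, ContDiff ℝ ∞ φ → HasCompactSupport φ →
        ∫ x, iteratedDeriv i φ x • f x = (-1 : ℝ) ^ i • ∫ x, φ x • g x := by
  constructor
  · rintro ⟨h1, h2, h3⟩
    refine ⟨locallyIntegrableOn_univ.1 h1, locallyIntegrableOn_univ.1 h2, fun φ h h' => ?_⟩
    simpa using h3 φ h h' (subset_univ _)
  · rintro ⟨h1, h2, h3⟩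
    refine ⟨locallyIntegrableOn_univ.2 h1, locallyIntegrableOn_univ.2 h2, fun φ h h' _ => ?_⟩
    simpa using h3 φ h h'

lemma contDiff_iteratedDeriv {F : Type*} [NormedAddCommGroup F] [NormedSpace ℝ F] {φ : ℝ → F}
    (h : ContDiff ℝ ∞ φ) (i : ℕ) : ContDiff ℝ ∞ (iteratedDeriv i φ) := by
  rw [iteratedDeriv_eq_iterate]
  exact h.iterate_deriv i

lemma tsupport_iteratedDeriv_subset {F : Type*} [NormedAddCommGroup F] [NormedSpace ℝ F]
    (φ : ℝ → F) (i : ℕ) : tsupport (iteratedDeriv i φ) ⊆ tsupport φ := by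
  induction i with
  | zero => simp
  | succ i ih => rw [iteratedDeriv_succ]; exact tsupport_deriv_subset.trans ih

lemma hasCompactSupport_iteratedDeriv {φ : ℝ → ℝ} (h : HasCompactSupport φ) (i : ℕ) :
    HasCompactSupport (iteratedDeriv i φ) :=
  h.mono' ((subset_tsupport _).trans (tsupport_iteratedDeriv_subset φ i))

lemma integrable_smul_of_locallyIntegrableOn {Ω : Set ℝ} {f : ℝ → E} {φ : ℝ → ℝ}
    (hf : LocallyIntegrableOn f Ω) (hφ : Continuous φ) (hc : HasCompactSupport φ)
    (hs : tsupport φ ⊆ Ω) : Integrable (fun x => φ x • f x) := by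
  have h1 : IntegrableOn f (tsupport φ) := hf.integrableOn_compact_subset hs hc
  have h2 : IntegrableOn (fun x => φ x • f x) (tsupport φ) :=
    h1.continuousOn_smul hφ.continuousOn hc
  refine (integrableOn_iff_integrable_of_support_subset ?_).1 h2
  intro x hx
  apply subset_tsupport
  intro h0
  exact hx (by simp [h0])

lemma setIntegral_smul_of_tsupport_subset {Ω : Set ℝ} {f : ℝ → E} {φ : ℝ → ℝ}
    (hs : tsupport φ ⊆ Ω) : ∫ x in Ω, φ x • f x = ∫ x, φ x • f x := by
  apply setIntegral_eq_integral_of_forall_compl_eq_zero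
  intro x hx
  rw [image_eq_zero_of_notMem_tsupport fun h => hx (hs h), zero_smul]

lemma locallyIntegrableOn_congr_ae {F : Type*} [NormedAddCommGroup F] {Ω : Set ℝ} {f f' : ℝ → F}
    (hf : LocallyIntegrableOn f Ω) (h : f =ᵐ[volume.restrict Ω] f') :
    LocallyIntegrableOn f' Ω := by
  intro x hx
  obtain ⟨t, ht, hti⟩ := hf x hx
  refine ⟨t ∩ Ω, inter_mem ht self_mem_nhdsWithin, ?_⟩
  refine (hti.mono_set inter_subset_left).congr_fun_ae ?_
  exact ae_mono (Measure.restrict_mono inter_subset_right le_rfl) h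

namespace IsWeakDeriv

lemma congr {i : ℕ} {Ω : Set ℝ} {f f' g g' : ℝ → E}
    (h : IsWeakDeriv i Ω f g) (hf : f =ᵐ[volume.restrict Ω] f')
    (hg : g =ᵐ[volume.restrict Ω] g') : IsWeakDeriv i Ω f' g' := by
  refine ⟨locallyIntegrableOn_congr_ae h.1 hf, locallyIntegrableOn_congr_ae h.2 hg,
    fun φ h1 h2 h3 => ?_⟩
  have e1 : ∫ x in Ω, iteratedDeriv i φ x • f' x = ∫ x in Ω, iteratedDeriv i φ x • f x :=
    integral_congr_ae (hf.mono fun x hx => by simp only [hx])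
  have e2 : ∫ x in Ω, φ x • g' x = ∫ x in Ω, φ x • g x :=
    integral_congr_ae (hg.mono fun x hx => by simp only [hx])
  rw [e1, e2, h.integral_eq φ h1 h2 h3]

lemma congr_univ {i : ℕ} {f f' g g' : ℝ → E} (h : IsWeakDeriv i univ f g)
    (hf : f =ᵐ[volume] f') (hg : g =ᵐ[volume] g') : IsWeakDeriv i univ f' g' :=
  h.congr (by simpa using hf) (by simpa using hg)

lemma mono {i : ℕ} {Ω Ω' : Set ℝ} {f g : ℝ → E} (h : IsWeakDeriv i Ω f g) (hs : Ω' ⊆ Ω) :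
    IsWeakDeriv i Ω' f g := by
  refine ⟨h.1.mono_set hs, h.2.mono_set hs, fun φ h1 h2 h3 => ?_⟩
  have := h.integral_eq φ h1 h2 (h3.trans hs)
  have h4 := (tsupport_iteratedDeriv_subset φ i).trans h3
  rwa [setIntegral_smul_of_tsupport_subset (h4.trans hs),
    setIntegral_smul_of_tsupport_subset (h3.trans hs),
    ← setIntegral_smul_of_tsupport_subset h4,
    ← setIntegral_smul_of_tsupport_subset h3] at this

/-- Weak derivatives on an open set are unique up to null sets. -/
lemma ae_eq [CompleteSpace E] {i : ℕ} {Ω : Set ℝ} (hΩ : IsOpen Ω) {f f' g g' : ℝ → E}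
    (h : IsWeakDeriv i Ω f g) (h' : IsWeakDeriv i Ω f' g') (hf : f =ᵐ[volume.restrict Ω] f') :
    g =ᵐ[volume.restrict Ω] g' := by
  have key : ∀ᵐ x, x ∈ Ω → (g - g') x = 0 := by
    refine hΩ.ae_eq_zero_of_integral_contDiff_smul_eq_zero (h.2.sub h'.2) fun φ h1 h2 h3 => ?_
    have e1 := h.integral_eq φ h1 h2 h3
    have e2 := h'.integral_eq φ h1 h2 h3
    have e3 : ∫ x in Ω, iteratedDeriv i φ x • f' x = ∫ x in Ω, iteratedDeriv i φ x • f x :=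
      integral_congr_ae (hf.mono fun x hx => by simp only [hx])
    rw [e3, e1] at e2
    have e4 := smul_right_injective E (pow_ne_zero i (by norm_num : (-1 : ℝ) ≠ 0)) e2
    rw [setIntegral_smul_of_tsupport_subset h3, setIntegral_smul_of_tsupport_subset h3] at e4
    simp only [Pi.sub_apply, smul_sub]
    rw [integral_sub (integrable_smul_of_locallyIntegrableOn h.2 h1.continuous h2 h3)
      (integrable_smul_of_locallyIntegrableOn h'.2 h1.continuous h2 h3), e4, sub_self]
  filter_upwards [(ae_restrict_iff' hΩ.measurableSet).2 key] with x hx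
  exact sub_eq_zero.1 hx

lemma zero_order {Ω : Set ℝ} {f : ℝ → E} (hf : LocallyIntegrableOn f Ω) :
    IsWeakDeriv 0 Ω f f := ⟨hf, hf, fun φ _ _ _ => by simp⟩

lemma add {i : ℕ} {f g f' g' : ℝ → E} (h : IsWeakDeriv i univ f g)
    (h' : IsWeakDeriv i univ f' g') :
    IsWeakDeriv i univ (fun x => f x + f' x) (fun x => g x + g' x) := by
  rw [isWeakDeriv_univ_iff] at *
  obtain ⟨a1, a2, a3⟩ := h
  obtain ⟨b1, b2, b3⟩ := h'
  refine ⟨a1.add b1, a2.add b2, fun φ h1 h2 => ?_⟩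
  have c1 := (contDiff_iteratedDeriv h1 i).continuous
  have c2 := hasCompactSupport_iteratedDeriv h2 i
  simp only [smul_add]
  rw [integral_add (a1.integrable_smul_left_of_hasCompactSupport c1 c2)
      (b1.integrable_smul_left_of_hasCompactSupport c1 c2),
    integral_add (a2.integrable_smul_left_of_hasCompactSupport h1.continuous h2)
      (b2.integrable_smul_left_of_hasCompactSupport h1.continuous h2), a3 φ h1 h2, b3 φ h1 h2,
    smul_add]

lemma const_smul {i : ℕ} {f g : ℝ → E} (c : ℝ) (h : IsWeakDeriv i univ f g) :
    IsWeakDeriv i univ (fun x => c • f x) (fun x => c • g x) := by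
  rw [isWeakDeriv_univ_iff] at *
  obtain ⟨a1, a2, a3⟩ := h
  refine ⟨a1.smul c, a2.smul c, fun φ h1 h2 => ?_⟩
  simp only [smul_comm _ c, integral_smul]
  rw [a3 φ h1 h2, smul_comm]

lemma sub {i : ℕ} {f g f' g' : ℝ → E} (h : IsWeakDeriv i univ f g)
    (h' : IsWeakDeriv i univ f' g') :
    IsWeakDeriv i univ (fun x => f x - f' x) (fun x => g x - g' x) := by
  simpa [sub_eq_add_neg] using h.add (h'.const_smul (-1))

lemma zero (i : ℕ) (Ω : Set ℝ) : IsWeakDeriv i Ω (fun _ => (0 : E)) (fun _ => 0) :=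
  ⟨locallyIntegrableOn_zero, locallyIntegrableOn_zero, fun φ _ _ _ => by simp⟩

lemma sum {ι : Type*} (s : Finset ι) {i : ℕ} {f g : ι → ℝ → E}
    (h : ∀ j ∈ s, IsWeakDeriv i univ (f j) (g j)) :
    IsWeakDeriv i univ (fun x => ∑ j ∈ s, f j x) (fun x => ∑ j ∈ s, g j x) := by
  classical
  induction s using Finset.induction_on with
  | empty => simpa using zero i univ
  | insert a s ha ih =>
    simp only [Finset.sum_insert ha]
    exact (h a (Finset.mem_insert_self a s)).add
      (ih fun j hj => h j (Finset.mem_insert_of_mem hj))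

/-- A weak derivative of order one of a weak derivative of order `i` has order `i + 1`. -/
lemma succ {i : ℕ} {f g h : ℝ → E} (h1 : IsWeakDeriv i univ f g)
    (h2 : IsWeakDeriv 1 univ g h) : IsWeakDeriv (i + 1) univ f h := by
  rw [isWeakDeriv_univ_iff] at *
  refine ⟨h1.1, h2.2.1, fun φ c1 c2 => ?_⟩
  have c3 : ContDiff ℝ ∞ (deriv φ) := by simpa using contDiff_iteratedDeriv c1 1
  have e1 := h1.2.2 (deriv φ) c3 c2.deriv
  have e2 := h2.2.2 φ c1 c2
  rw [iteratedDeriv_one, pow_one] at e2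
  rw [iteratedDeriv_succ', e1, e2, smul_smul, pow_succ]

/-- Consecutive weak derivatives of a function are related by a weak derivative of order one. -/
lemma one_of_succ {i : ℕ} {f g h : ℝ → E} (h1 : IsWeakDeriv i univ f g)
    (h2 : IsWeakDeriv (i + 1) univ f h) : IsWeakDeriv 1 univ g h := by
  rw [isWeakDeriv_univ_iff] at *
  refine ⟨h1.2.1, h2.2.1, fun φ c1 c2 => ?_⟩
  have c3 : ContDiff ℝ ∞ (deriv φ) := by simpa using contDiff_iteratedDeriv c1 1
  have e1 := h1.2.2 (deriv φ) c3 c2.deriv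
  have e2 := h2.2.2 φ c1 c2
  rw [iteratedDeriv_succ', e1, pow_succ, mul_smul] at e2
  rw [iteratedDeriv_one, pow_one]
  exact smul_right_injective E (pow_ne_zero i (by norm_num : (-1 : ℝ) ≠ 0)) e2

/-- Weak derivatives commute with translations. -/
lemma comp_sub {i : ℕ} {f g : ℝ → E} (h : IsWeakDeriv i univ f g) (s : ℝ) :
    IsWeakDeriv i univ (fun x => f (x - s)) (fun x => g (x - s)) := by
  have hloc : ∀ {q : ℝ → E}, LocallyIntegrable q → LocallyIntegrable fun x => q (x - s) := by
    intro q hq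
    have hm : (volume : Measure ℝ).map (Homeomorph.subRight s) = volume :=
      (measurePreserving_sub_right volume s).map_eq
    have h0 : LocallyIntegrable q (volume.map (Homeomorph.subRight s)) := by rwa [hm]
    exact (locallyIntegrable_map_homeomorph (Homeomorph.subRight s)).1 h0
  rw [isWeakDeriv_univ_iff] at *
  obtain ⟨a1, a2, a3⟩ := h
  refine ⟨hloc a1, hloc a2, fun φ c1 c2 => ?_⟩
  have e := a3 (fun x => φ (x + s)) (c1.comp (contDiff_id.add contDiff_const))
    (c2.comp_homeomorph (Homeomorph.addRight s))
  rw [iteratedDeriv_comp_add_const] at e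
  rw [← integral_add_right_eq_self (fun x => iteratedDeriv i φ x • f (x - s)) s,
    ← integral_add_right_eq_self (fun x => φ x • g (x - s)) s]
  simpa using e

lemma smul_one {f g : ℝ → E} {ψ : ℝ → ℝ} (hψ : ContDiff ℝ ∞ ψ) (h : IsWeakDeriv 1 univ f g) :
    IsWeakDeriv 1 univ (fun x => ψ x • f x) (fun x => deriv ψ x • f x + ψ x • g x) := by
  rw [isWeakDeriv_univ_iff] at *
  obtain ⟨a1, a2, a3⟩ := h
  have hd : ContDiff ℝ ∞ (deriv ψ) := by simpa using contDiff_iteratedDeriv hψ 1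
  have hloc : ∀ {q : ℝ → E} {θ : ℝ → ℝ}, Continuous θ → LocallyIntegrable q →
      LocallyIntegrable fun x => θ x • q x := by
    intro q θ hθ hq
    rw [← locallyIntegrableOn_univ] at *
    exact hq.continuousOn_smul isOpen_univ.isLocallyClosed hθ.continuousOn
  have l1 := hloc hψ.continuous a1
  have l2 := hloc hd.continuous a1
  have l3 := hloc hψ.continuous a2
  refine ⟨l1, l2.add l3, fun φ c1 c2 => ?_⟩
  have e := a3 (fun x => φ x * ψ x) (c1.mul hψ) c2.mul_right
  have c3 : ContDiff ℝ ∞ (deriv φ) := by simpa using contDiff_iteratedDeriv c1 1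
  have ed : deriv (fun x => φ x * ψ x) = fun x => deriv φ x * ψ x + φ x * deriv ψ x := by
    ext x
    exact deriv_fun_mul (c1.differentiable (by simp) x) (hψ.differentiable (by simp) x)
  rw [iteratedDeriv_one, ed] at e
  simp only [add_smul, mul_smul] at e
  rw [integral_add (l1.integrable_smul_left_of_hasCompactSupport c3.continuous c2.deriv)
    (l2.integrable_smul_left_of_hasCompactSupport c1.continuous c2)] at e
  simp only [smul_add, iteratedDeriv_one]
  rw [integral_add (l2.integrable_smul_left_of_hasCompactSupport c1.continuous c2)
    (l3.integrable_smul_left_of_hasCompactSupport c1.continuous c2), eq_sub_of_add_eq e, pow_one]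
  simp only [smul_add, neg_smul, one_smul]
  abel

/-- The Leibniz rule for the product of a smooth function and a weakly differentiable one. -/
lemma leibniz {k : ℕ} {F : ℕ → ℝ → E} (hF : ∀ i ≤ k, IsWeakDeriv i univ (F 0) (F i))
    {ψ : ℝ → ℝ} (hψ : ContDiff ℝ ∞ ψ) {i : ℕ} (hi : i ≤ k) :
    IsWeakDeriv i univ (fun x => ψ x • F 0 x)
      (fun x => ∑ l ∈ Finset.range (i + 1), i.choose l • iteratedDeriv (i - l) ψ x • F l x) := by
  induction i with
  | zero =>
    have h0 : IsWeakDeriv 0 univ (F 0) (F 0) := zero_order (hF 0 hi).1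
    have hl : LocallyIntegrableOn (fun x => ψ x • F 0 x) univ :=
      (h0.1).continuousOn_smul isOpen_univ.isLocallyClosed hψ.continuous.continuousOn
    simpa using zero_order hl
  | succ i ih =>
    refine (ih (by omega)).succ ?_
    have key : ∀ l ∈ Finset.range (i + 1), IsWeakDeriv 1 univ
        (fun x => i.choose l • iteratedDeriv (i - l) ψ x • F l x)
        (fun x => i.choose l • (iteratedDeriv (i + 1 - l) ψ x • F l x
          + iteratedDeriv (i - l) ψ x • F (l + 1) x)) := by
      intro l hl
      have hl' : l ≤ i := by simpa [Nat.lt_succ_iff] using hl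
      have h1 : IsWeakDeriv 1 univ (F l) (F (l + 1)) :=
        (hF l (by omega)).one_of_succ (hF (l + 1) (by omega))
      have h2 := (h1.smul_one (contDiff_iteratedDeriv hψ (i - l))).const_smul (i.choose l : ℝ)
      have e : i + 1 - l = (i - l) + 1 := by omega
      rw [e, iteratedDeriv_succ]
      simpa only [Nat.cast_smul_eq_nsmul] using h2
    have hs := IsWeakDeriv.sum _ key
    refine hs.congr_univ (Filter.EventuallyEq.rfl) (Filter.Eventually.of_forall fun x => ?_)
    have := Finset.sum_choose_succ_nsmul (fun l p => iteratedDeriv p ψ x • F l x) i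
    simp only [smul_add, Finset.sum_add_distrib]
    rw [this]

end IsWeakDeriv

/-- Any weak derivative is almost everywhere equal to the chosen one. -/
lemma weakDeriv_ae_eq [CompleteSpace E] {i : ℕ} {Ω : Set ℝ} (hΩ : IsOpen Ω) {f g : ℝ → E}
    (h : IsWeakDeriv i Ω f g) : weakDeriv i Ω f =ᵐ[volume.restrict Ω] g := by
  have hex : ∃ g, IsWeakDeriv i Ω f g := ⟨g, h⟩
  rw [weakDeriv, dif_pos hex]
  exact hex.choose_spec.ae_eq hΩ h EventuallyEq.rfl

lemma weakDeriv_univ_ae_eq [CompleteSpace E] {i : ℕ} {f g : ℝ → E}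
    (h : IsWeakDeriv i univ f g) : weakDeriv i univ f =ᵐ[volume] g := by
  simpa using weakDeriv_ae_eq isOpen_univ h

lemma isWeakDeriv_weakDeriv {i : ℕ} {Ω : Set ℝ} {f : ℝ → E}
    (h : ∃ g, IsWeakDeriv i Ω f g) : IsWeakDeriv i Ω f (weakDeriv i Ω f) := by
  rw [weakDeriv, dif_pos h]
  exact h.choose_spec

lemma weakDeriv_zero_ae_eq [CompleteSpace E] {f : ℝ → E} (h : LocallyIntegrable f) :
    weakDeriv 0 univ f =ᵐ[volume] f :=
  weakDeriv_univ_ae_eq (IsWeakDeriv.zero_order (locallyIntegrableOn_univ.2 h))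

end WeakDerivatives

/-! ### The Sobolev embedding -/

section SobolevEmbedding

variable {E : Type*} [NormedAddCommGroup E] [NormedSpace ℝ E]

/-- Any two normalized bumps differ by the derivative of a smooth function which is bounded by `1`
and supported in the unit interval. -/
lemma exists_primitive_normed_sub (ρ η : ContDiffBump (0 : ℝ)) (hρ : ρ.rOut ≤ 1)
    (hη : η.rOut ≤ 1) :
    ∃ κ : ℝ → ℝ, ContDiff ℝ ∞ κ ∧ (∀ t, |κ t| ≤ 1) ∧ (∀ t, t ∉ Icc (-1 : ℝ) 1 → κ t = 0) ∧
      ∀ t, deriv κ t = ρ.normed volume t - η.normed volume t := by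
  have hcρ : Continuous (ρ.normed volume) := ρ.continuous_normed
  have hcη : Continuous (η.normed volume) := η.continuous_normed
  have hz : ∀ b : ContDiffBump (0 : ℝ), b.rOut ≤ 1 → ∀ t, t ∉ Ioo (-1 : ℝ) 1 →
      b.normed volume t = 0 := by
    intro b hb t ht
    by_contra h
    have : t ∈ Function.support (b.normed volume) := h
    rw [b.support_normed_eq] at this
    have h2 := abs_lt.1 (by simpa using this : |t| < b.rOut)
    exact ht ⟨by linarith [h2.1], by linarith [h2.2]⟩
  -- the partial integrals of a normalized bump lie between `0` and `1`
  have hb : ∀ b : ContDiffBump (0 : ℝ), b.rOut ≤ 1 → ∀ t,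
      (t ≤ -1 → ∫ s in (-1 : ℝ)..t, b.normed volume s = 0) ∧
      (1 ≤ t → ∫ s in (-1 : ℝ)..t, b.normed volume s = 1) ∧
      0 ≤ ∫ s in (-1 : ℝ)..t, b.normed volume s ∧ ∫ s in (-1 : ℝ)..t, b.normed volume s ≤ 1 := by
    intro b hb t
    have hneg : t ≤ -1 → ∫ s in (-1 : ℝ)..t, b.normed volume s = 0 := by
      intro ht
      rw [intervalIntegral.integral_congr (g := fun _ => 0), intervalIntegral.integral_zero]
      intro s hs
      rw [uIcc_of_ge ht] at hs
      exact hz b hb s fun h => by linarith [h.1, hs.2]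
    refine ⟨hneg, fun ht => ?_, ?_, ?_⟩
    · rw [intervalIntegral.integral_eq_integral_of_support_subset, b.integral_normed]
      intro s hs
      have : s ∈ Ioo (-1 : ℝ) 1 := by
        by_contra h
        exact hs (hz b hb s h)
      exact ⟨this.1, this.2.le.trans ht⟩
    · rcases le_total t (-1) with h | h
      · rw [hneg h]
      · exact intervalIntegral.integral_nonneg h fun s _ => b.nonneg_normed s
    · rcases le_total t (-1) with h | h
      · rw [hneg h]; exact zero_le_one
      · rw [intervalIntegral.integral_of_le h, ← b.integral_normed (μ := volume)]
        exact setIntegral_le_integral b.integrable_normed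
          (Eventually.of_forall fun s => b.nonneg_normed s)
  have hd : ∀ t, HasDerivAt
      (fun t => (∫ s in (-1 : ℝ)..t, ρ.normed volume s) - ∫ s in (-1 : ℝ)..t, η.normed volume s)
      (ρ.normed volume t - η.normed volume t) t := fun t =>
    (hcρ.integral_hasStrictDerivAt _ t).hasDerivAt.sub
      (hcη.integral_hasStrictDerivAt _ t).hasDerivAt
  refine ⟨_, ?_, fun t => ?_, fun t ht => ?_, fun t => (hd t).deriv⟩
  · rw [contDiff_infty_iff_deriv]
    refine ⟨fun t => (hd t).differentiableAt, ?_⟩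
    rw [show deriv _ = _ from funext fun t => (hd t).deriv]
    exact ρ.contDiff_normed.sub η.contDiff_normed
  · obtain ⟨-, -, h1, h2⟩ := hb ρ hρ t
    obtain ⟨-, -, h3, h4⟩ := hb η hη t
    exact abs_le.2 ⟨by linarith, by linarith⟩
  · obtain ⟨h1, h2, -, -⟩ := hb ρ hρ t
    obtain ⟨h3, h4, -, -⟩ := hb η hη t
    rcases le_total t (-1) with h | h
    · simp only [h1 h, h3 h, sub_zero]
    · have : 1 ≤ t := by
        by_contra h'
        exact ht ⟨h, (not_le.1 h').le⟩
      simp only [h2 this, h4 this, sub_self]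

lemma norm_integral_kernel_smul_le {κ : ℝ → ℝ} {c : ℝ} (hb : ∀ t, |κ t| ≤ c)
    (hz : ∀ t, t ∉ Icc (-1 : ℝ) 1 → κ t = 0) {f : ℝ → E} (hf : LocallyIntegrable f) (x : ℝ) :
    ‖∫ y, κ (x - y) • f y‖ ≤ c * ∫ y in Icc (x - 1) (x + 1), ‖f y‖ := by
  rw [← setIntegral_eq_integral_of_forall_compl_eq_zero (s := Icc (x - 1) (x + 1)),
    ← integral_const_mul]
  · refine norm_integral_le_of_norm_le ?_ (Eventually.of_forall fun y => ?_)
    · exact (hf.integrableOn_isCompact isCompact_Icc).norm.const_mul c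
    · rw [norm_smul]
      exact mul_le_mul_of_nonneg_right (hb _) (norm_nonneg _)
  · intro y hy
    rw [hz, zero_smul]
    intro h
    exact hy ⟨by linarith [h.2], by linarith [h.1]⟩

/-- A local form of the Sobolev inequality. The mollification of `f` at scale `ε` differs from its
mollification at scale `1` by the convolution of `f'` with a kernel bounded by `1`. -/
lemma exists_ae_norm_le_integral_Icc (E : Type*) [NormedAddCommGroup E] [NormedSpace ℝ E]
    [CompleteSpace E] : ∃ c : ℝ, 0 ≤ c ∧ ∀ f g : ℝ → E, IsWeakDeriv 1 univ f g →
      ∀ᵐ x, ‖f x‖ ≤ c * ∫ y in Icc (x - 1) (x + 1), (‖f y‖ + ‖g y‖) := by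
  let η : ContDiffBump (0 : ℝ) := ⟨1 / 2, 1, by norm_num, by norm_num⟩
  obtain ⟨c, hc⟩ := η.hasCompactSupport_normed (μ := volume) |>.exists_bound_of_continuous
    η.continuous_normed
  have hc0 : 0 ≤ c := (norm_nonneg _).trans (hc 0)
  refine ⟨c + 1, by positivity, fun f g hfg => ?_⟩
  obtain ⟨hf, hg, hint⟩ := isWeakDeriv_univ_iff.1 hfg
  let ρ : ℕ → ContDiffBump (0 : ℝ) := fun n =>
    ⟨1 / (2 * (n + 1)), 1 / (n + 1), by positivity, by
      apply one_div_lt_one_div_of_lt <;> [positivity; linarith [n.cast_nonneg (α := ℝ)]]⟩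
  have hρ1 : ∀ n, (ρ n).rOut ≤ 1 := fun n => by
    change (1 : ℝ) / (n + 1) ≤ 1
    rw [div_le_one (by positivity)]
    linarith [n.cast_nonneg (α := ℝ)]
  have hlim := ContDiffBump.ae_convolution_tendsto_right_of_locallyIntegrable (μ := volume)
    (φ := ρ) (l := atTop) (K := 2) (g := f) tendsto_one_div_add_atTop_nhds_zero_nat
    (Eventually.of_forall fun n => by
      change (1 : ℝ) / (n + 1) ≤ 2 * (1 / (2 * (n + 1)))
      have : (0 : ℝ) < n + 1 := by positivity
      field_simp; exact le_rfl) hf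
  filter_upwards [hlim] with x hx
  refine le_of_tendsto hx.norm (Eventually.of_forall fun n => ?_)
  rw [convolution_eq_swap]
  simp only [ContinuousLinearMap.lsmul_apply]
  obtain ⟨κ, k1, k2, k3, k4⟩ := exists_primitive_normed_sub (ρ n) η (hρ1 n) le_rfl
  have ksupp : HasCompactSupport κ := HasCompactSupport.intro isCompact_Icc k3
  have kd : deriv (fun y => κ (x - y)) = fun y =>
      -((ρ n).normed volume (x - y) - η.normed volume (x - y)) := by
    ext y
    rw [deriv_comp_const_sub, k4]
  have e := hint (fun y => κ (x - y)) (k1.comp (contDiff_const.sub contDiff_id))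
    (ksupp.comp_homeomorph (Homeomorph.subLeft x))
  have i1 : ∀ b : ContDiffBump (0 : ℝ), Integrable fun y => b.normed volume (x - y) • f y :=
    fun b => hf.integrable_smul_left_of_hasCompactSupport
      (b.continuous_normed.comp (continuous_const.sub continuous_id))
      (b.hasCompactSupport_normed.comp_homeomorph (Homeomorph.subLeft x))
  rw [iteratedDeriv_one, kd] at e
  simp only [neg_smul, integral_neg, sub_smul, pow_one, one_smul, neg_inj] at e
  rw [integral_sub (i1 _) (i1 _)] at e
  rw [sub_eq_iff_eq_add.1 e]
  have b1 := norm_integral_kernel_smul_le k2 k3 hg x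
  have b2 := norm_integral_kernel_smul_le (κ := η.normed volume) (c := c) hc (fun t ht => by
    by_contra h
    have : t ∈ Function.support (η.normed volume) := h
    rw [η.support_normed_eq] at this
    have h2 := abs_lt.1 (by simpa using this : |t| < η.rOut)
    exact ht ⟨h2.1.le, h2.2.le⟩) hf x
  have j1 := (hf.integrableOn_isCompact (isCompact_Icc (a := x - 1) (b := x + 1))).norm
  have j2 := (hg.integrableOn_isCompact (isCompact_Icc (a := x - 1) (b := x + 1))).norm
  rw [integral_add j1 j2]
  have p1 : 0 ≤ ∫ y in Icc (x - 1) (x + 1), ‖f y‖ := integral_nonneg fun _ => norm_nonneg _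
  have p2 : 0 ≤ ∫ y in Icc (x - 1) (x + 1), ‖g y‖ := integral_nonneg fun _ => norm_nonneg _
  refine (norm_add_le _ _).trans ((add_le_add b1 b2).trans ?_)
  nlinarith

/-- The norm of `L²(Ω)` as a real number. -/
def L2Norm (Ω : Set ℝ) (f : ℝ → E) : ℝ := (eLpNorm f 2 (volume.restrict Ω)).toReal

omit [NormedSpace ℝ E] in
lemma L2Norm_nonneg (Ω : Set ℝ) (f : ℝ → E) : 0 ≤ L2Norm Ω f := ENNReal.toReal_nonneg

omit [NormedSpace ℝ E] in
lemma L2Norm_congr {Ω : Set ℝ} {f g : ℝ → E} (h : f =ᵐ[volume.restrict Ω] g) :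
    L2Norm Ω f = L2Norm Ω g := by
  rw [L2Norm, L2Norm, eLpNorm_congr_ae h]

omit [NormedSpace ℝ E] in
lemma L2Norm_mono_set {Ω Ω' : Set ℝ} (hs : Ω' ⊆ Ω) {f : ℝ → E}
    (hf : MemLp f 2 (volume.restrict Ω)) : L2Norm Ω' f ≤ L2Norm Ω f :=
  ENNReal.toReal_mono hf.eLpNorm_ne_top (eLpNorm_mono_measure f (Measure.restrict_mono hs le_rfl))

omit [NormedSpace ℝ E] in
lemma integral_norm_Icc_le_L2Norm {Ω : Set ℝ} {f : ℝ → E} (hf : MemLp f 2 (volume.restrict Ω))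
    {x : ℝ} (hx : Icc (x - 1) (x + 1) ⊆ Ω) :
    ∫ y in Icc (x - 1) (x + 1), ‖f y‖ ≤ 2 * L2Norm Ω f := by
  have h2 : MemLp f 2 (volume.restrict (Icc (x - 1) (x + 1))) :=
    hf.mono_measure (Measure.restrict_mono hx le_rfl)
  have h1 : MemLp f 1 (volume.restrict (Icc (x - 1) (x + 1))) := h2.mono_exponent (by norm_num)
  rw [integral_norm_eq_lintegral_enorm h1.1, ← eLpNorm_one_eq_lintegral_enorm]
  refine le_trans ?_ (mul_le_mul_of_nonneg_left (L2Norm_mono_set hx hf) zero_le_two)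
  have h := eLpNorm_le_eLpNorm_mul_rpow_measure_univ (p := 1) (q := 2) (by norm_num) h2.1
  have hv : volume.restrict (Icc (x - 1) (x + 1)) univ = ENNReal.ofReal 2 := by
    rw [Measure.restrict_apply_univ, Real.volume_Icc]; congr 1; ring
  have h3 := ENNReal.toReal_mono
    (ENNReal.mul_ne_top h2.eLpNorm_ne_top (by rw [hv]; norm_num)) h
  rw [ENNReal.toReal_mul, hv] at h3
  rw [mul_comm]
  refine h3.trans (mul_le_mul_of_nonneg_left ?_ ENNReal.toReal_nonneg)
  rw [ENNReal.ofReal_rpow_of_pos (by norm_num),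
    ENNReal.toReal_ofReal (by positivity)]
  calc (2 : ℝ) ^ ((1 : ℝ) / (1 : ENNReal).toReal - 1 / (2 : ENNReal).toReal) ≤ 2 ^ (1 : ℝ) :=
        Real.rpow_le_rpow_of_exponent_le (by norm_num) (by norm_num)
    _ = 2 := by norm_num

lemma isOpen_tailSet (T : ℝ) (n : ℕ) : IsOpen (tailSet T n) := isClosed_Icc.isOpen_compl

omit [NormedSpace ℝ E] in
lemma tendsto_L2Norm_tailSet {T : ℝ} (hT : 0 < T) {f : ℝ → E} (hf : MemLp f 2 volume) :
    Tendsto (fun n => L2Norm (tailSet T n) f) atTop (𝓝 0) := by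
  have hint : Integrable (fun x => ‖f x‖ ^ (2 : ℝ)) := by
    simpa using hf.integrable_norm_rpow (by norm_num) (by norm_num)
  have hanti : Antitone (tailSet T) := by
    intro a b hab
    refine compl_subset_compl.2 (Icc_subset_Icc ?_ ?_) <;>
    · have : (a : ℝ) / 2 * T ≤ b / 2 * T := by gcongr
      linarith
  have hempty : ⋂ n, tailSet T n = ∅ := by
    rw [eq_empty_iff_forall_notMem]
    intro x hx
    obtain ⟨n, hn⟩ := exists_nat_gt ((|x| + 1) * 2 / T)
    refine mem_iInter.1 hx n ?_
    rw [div_lt_iff₀ hT] at hn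
    have := abs_le.1 (le_refl |x|)
    constructor <;> linarith
  have h := tendsto_setIntegral_of_antitone (fun n => (isOpen_tailSet T n).measurableSet) hanti
    ⟨0, hint.integrableOn⟩
  rw [hempty, setIntegral_empty] at h
  have h2 := h.rpow_const (p := (2 : ℝ)⁻¹) (Or.inr (by norm_num))
  rw [Real.zero_rpow (by norm_num)] at h2
  refine h2.congr fun n => ?_
  rw [L2Norm, (hf.restrict _).eLpNorm_eq_integral_rpow_norm (by norm_num) (by norm_num),
    ENNReal.toReal_ofReal (by positivity)]
  simp

lemma exists_ae_norm_le_L2Norm (E : Type*) [NormedAddCommGroup E] [NormedSpace ℝ E]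
    [CompleteSpace E] : ∃ c : ℝ, 0 ≤ c ∧ ∀ f g : ℝ → E, IsWeakDeriv 1 univ f g →
      MemLp f 2 volume → MemLp g 2 volume → ∀ (Ω : Set ℝ),
      ∀ᵐ x, Icc (x - 1) (x + 1) ⊆ Ω → ‖f x‖ ≤ c * (L2Norm Ω f + L2Norm Ω g) := by
  obtain ⟨c, hc, h⟩ := exists_ae_norm_le_integral_Icc E
  refine ⟨c * 2, by positivity, fun f g hfg hf hg Ω => ?_⟩
  filter_upwards [h f g hfg] with x hx hΩ
  obtain ⟨hf', hg', -⟩ := isWeakDeriv_univ_iff.1 hfg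
  rw [integral_add (hf'.integrableOn_isCompact isCompact_Icc).norm
    (hg'.integrableOn_isCompact isCompact_Icc).norm] at hx
  have h1 := integral_norm_Icc_le_L2Norm (hf.restrict _) hΩ
  have h2 := integral_norm_Icc_le_L2Norm (hg.restrict _) hΩ
  refine hx.trans ?_
  rw [mul_assoc]
  exact mul_le_mul_of_nonneg_left (by linarith) hc

/-- Functions in `H¹(ℝ)` vanish at infinity. -/
lemma exists_forall_ae_norm_le_of_le_abs [CompleteSpace E] {f g : ℝ → E}
    (hfg : IsWeakDeriv 1 univ f g) (hf : MemLp f 2 volume) (hg : MemLp g 2 volume) {δ : ℝ}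
    (hδ : 0 < δ) : ∃ R : ℝ, ∀ᵐ x, R ≤ |x| → ‖f x‖ ≤ δ := by
  obtain ⟨c, hc, h⟩ := exists_ae_norm_le_L2Norm E
  have hlim := ((tendsto_L2Norm_tailSet one_pos hf).add
    (tendsto_L2Norm_tailSet one_pos hg)).const_mul c
  rw [add_zero, mul_zero] at hlim
  obtain ⟨n, hn⟩ := (hlim.eventually (gt_mem_nhds hδ)).exists
  refine ⟨n / 2 + 1, ?_⟩
  filter_upwards [h f g hfg hf hg (tailSet 1 n)] with x hx hR
  refine (hx fun y hy => ?_).trans hn.le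
  rintro ⟨h1, h2⟩
  rcases le_abs.1 hR with h | h
  · linarith [hy.1]
  · linarith [hy.2]

end SobolevEmbedding

/-! ### The space `H^k(ℝ)` and bounded inverses of differential operators -/

section SobolevSpace

variable {E : Type*} [NormedAddCommGroup E] [NormedSpace ℝ E]

namespace MemHk

variable {k : ℕ} {f : ℝ → E}

lemma isWeakDeriv {Ω : Set ℝ} (h : MemHk k Ω f) {i : ℕ} (hi : i ≤ k) :
    IsWeakDeriv i Ω f (weakDeriv i Ω f) :=
  isWeakDeriv_weakDeriv ((h i hi).imp fun _ h => h.1)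

lemma memLp_weakDeriv [CompleteSpace E] (h : MemHk k univ f) {i : ℕ} (hi : i ≤ k) :
    MemLp (weakDeriv i univ f) 2 volume := by
  obtain ⟨g, hg, hg2⟩ := h i hi
  rw [Measure.restrict_univ] at hg2
  exact hg2.ae_eq (weakDeriv_univ_ae_eq hg).symm

lemma locallyIntegrable (h : MemHk k univ f) : LocallyIntegrable f := by
  obtain ⟨g, hg, -⟩ := h 0 (Nat.zero_le k)
  exact locallyIntegrableOn_univ.1 hg.1

lemma weakDeriv_zero_ae_eq [CompleteSpace E] (h : MemHk k univ f) :
    weakDeriv 0 univ f =ᵐ[volume] f :=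
  _root_.weakDeriv_zero_ae_eq h.locallyIntegrable

lemma memLp [CompleteSpace E] (h : MemHk k univ f) : MemLp f 2 volume :=
  (h.memLp_weakDeriv (Nat.zero_le k)).ae_eq h.weakDeriv_zero_ae_eq

lemma isWeakDeriv_one [CompleteSpace E] (h : MemHk k univ f) (hk : 1 ≤ k) :
    IsWeakDeriv 1 univ f (weakDeriv 1 univ f) := h.isWeakDeriv hk

end MemHk

lemma memHk_univ_of_isWeakDeriv {k : ℕ} {f : ℝ → E} {G : ℕ → ℝ → E}
    (h : ∀ i ≤ k, IsWeakDeriv i univ f (G i)) (h2 : ∀ i ≤ k, MemLp (G i) 2 volume) :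
    MemHk k univ f := fun i hi => ⟨G i, h i hi, by simpa using h2 i hi⟩

variable [CompleteSpace E]

/-- Integration against a fixed test function is continuous on `L²`. -/
lemma exists_clm_integral_smul {φ : ℝ → ℝ} (h1 : Continuous φ) (h2 : HasCompactSupport φ) :
    ∃ A : Lp E 2 (volume : Measure ℝ) →L[ℝ] E, ∀ f, A f = ∫ x, φ x • f x := by
  have hm : MemLp φ 2 volume := h1.memLp_of_hasCompactSupport h2
  refine ⟨(ContinuousLinearMap.lsmul ℝ ℝ).lpPairing volume 2 2 hm.toLp, fun f => ?_⟩
  rw [ContinuousLinearMap.lpPairing_eq_integral]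
  refine integral_congr_ae ?_
  filter_upwards [hm.coeFn_toLp] with x hx
  simp [hx]

variable (E) in
/-- The space `H^k(ℝ)`, encoded as the closed subspace of those tuples in `L²(ℝ)^{k+1}` whose
entries are the weak derivatives of the first one. -/
def sobolevTuples (k : ℕ) : Submodule ℝ (Fin (k + 1) → Lp E 2 (volume : Measure ℝ)) where
  carrier := {U | ∀ i : Fin (k + 1), IsWeakDeriv i univ (U 0) (U i)}
  zero_mem' i := (IsWeakDeriv.zero i univ).congr_univ (Lp.coeFn_zero E 2 volume).symm
    (Lp.coeFn_zero E 2 volume).symm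
  add_mem' {U V} hU hV i := ((hU i).add (hV i)).congr_univ (Lp.coeFn_add (U 0) (V 0)).symm
    (Lp.coeFn_add (U i) (V i)).symm
  smul_mem' c U hU i := ((hU i).const_smul c).congr_univ (Lp.coeFn_smul c (U 0)).symm
    (Lp.coeFn_smul c (U i)).symm

lemma isClosed_sobolevTuples (k : ℕ) : 
    IsClosed (sobolevTuples E k : Set (Fin (k + 1) → Lp E 2 (volume : Measure ℝ))) := by
  have hloc : ∀ f : Lp E 2 (volume : Measure ℝ), LocallyIntegrable f := fun f =>
    (Lp.memLp f).locallyIntegrable (by norm_num)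
  have : (sobolevTuples E k : Set (Fin (k + 1) → Lp E 2 (volume : Measure ℝ))) =
      ⋂ (i : Fin (k + 1)) (φ : ℝ → ℝ) (_ : ContDiff ℝ ∞ φ) (_ : HasCompactSupport φ),
        {U | ∫ x, iteratedDeriv i φ x • U 0 x = (-1 : ℝ) ^ (i : ℕ) • ∫ x, φ x • U i x} := by
    ext U
    simp only [mem_iInter, mem_ofPred_eq]
    change (∀ i : Fin (k + 1), IsWeakDeriv i univ (U 0) (U i)) ↔ _
    refine forall_congr' fun i => ?_
    rw [isWeakDeriv_univ_iff]
    exact ⟨fun h => h.2.2, fun h => ⟨hloc _, hloc _, h⟩⟩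
  rw [this]
  refine isClosed_iInter fun i => isClosed_iInter fun φ => isClosed_iInter fun h1 =>
    isClosed_iInter fun h2 => ?_
  obtain ⟨A, hA⟩ := exists_clm_integral_smul (E := E) (contDiff_iteratedDeriv h1 i).continuous
    (hasCompactSupport_iteratedDeriv h2 i)
  obtain ⟨B, hB⟩ := exists_clm_integral_smul (E := E) h1.continuous h2
  simp only [← hA, ← hB]
  exact isClosed_eq (A.continuous.comp (continuous_apply 0))
    ((B.continuous.comp (continuous_apply i)).const_smul _)

omit [CompleteSpace E] in
/-- Multiplication by an essentially bounded operator-valued function, as an operator in `L²`. -/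
lemma exists_clm_apply {b : ℝ → E →L[ℝ] E} (hb : MemLp b ⊤ volume) :
    ∃ A : Lp E 2 (volume : Measure ℝ) →L[ℝ] Lp E 2 (volume : Measure ℝ),
      ∀ f, A f =ᵐ[volume] fun x => b x (f x) := by
  refine ⟨(ContinuousLinearMap.id ℝ (E →L[ℝ] E)).holderL volume ⊤ 2 2 hb.toLp, fun f => ?_⟩
  have h := ContinuousLinearMap.coeFn_holder (r := 2) (ContinuousLinearMap.id ℝ (E →L[ℝ] E))
    hb.toLp f
  filter_upwards [h, hb.coeFn_toLp] with x hx hx2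
  rw [hx2] at hx
  exact hx

/-- By the open mapping theorem, a differential operator with bounded coefficients that is
bijective from `H^k(ℝ)` onto `L²(ℝ)` has a bounded inverse. -/
lemma exists_bounded_inverse {k : ℕ} {b : ℕ → ℝ → E →L[ℝ] E}
    (hb : ∀ i ≤ k, MemLp (b i) ⊤ volume)
    (hbij : ∀ g : ℝ → E, MemLp g 2 volume →
      (∃ u, MemHk k univ u ∧
        (fun x => ∑ i ∈ Finset.range (k + 1), b i x (weakDeriv i univ u x)) =ᵐ[volume] g) ∧
      ∀ u₁ u₂, MemHk k univ u₁ → MemHk k univ u₂ →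
        (fun x => ∑ i ∈ Finset.range (k + 1), b i x (weakDeriv i univ u₁ x)) =ᵐ[volume] g →
        (fun x => ∑ i ∈ Finset.range (k + 1), b i x (weakDeriv i univ u₂ x)) =ᵐ[volume] g →
        u₁ =ᵐ[volume] u₂) :
    ∃ (R : Lp E 2 (volume : Measure ℝ) →ₗ[ℝ] Lp E 2 (volume : Measure ℝ)) (C : ℝ), 0 ≤ C ∧
      ∀ g, MemHk k univ (R g) ∧
        (fun x => ∑ i ∈ Finset.range (k + 1), b i x (weakDeriv i univ (R g) x)) =ᵐ[volume] g ∧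
        ∀ i ≤ k, L2Norm univ (weakDeriv i univ (R g)) ≤ C * ‖g‖ := by
  have hA : ∀ i : Fin (k + 1), ∃ A : Lp E 2 (volume : Measure ℝ) →L[ℝ] Lp E 2 volume,
      ∀ f, A f =ᵐ[volume] fun x => b i x (f x) := fun i => exists_clm_apply (hb i (by omega))
  choose A hA using hA
  let L : sobolevTuples E k →L[ℝ] Lp E 2 (volume : Measure ℝ) :=
    (∑ i, (A i).comp (ContinuousLinearMap.proj i)).comp (sobolevTuples E k).subtypeL
  have hw : ∀ (U : sobolevTuples E k) (i : Fin (k + 1)),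
      weakDeriv i univ (U.1 0) =ᵐ[volume] U.1 i := fun U i => weakDeriv_univ_ae_eq (U.2 i)
  have hH : ∀ U : sobolevTuples E k, MemHk k univ (U.1 0) := by
    intro U i hi
    exact ⟨U.1 ⟨i, by omega⟩, U.2 ⟨i, by omega⟩, (Lp.memLp _).restrict _⟩
  have hL : ∀ U : sobolevTuples E k, (fun x => ∑ i ∈ Finset.range (k + 1),
      b i x (weakDeriv i univ (U.1 0) x)) =ᵐ[volume] L U := by
    intro U
    have e : L U = ∑ i, A i (U.1 i) := by simp [L]
    rw [e]
    have h1 : ∀ᵐ x, ∀ i, weakDeriv (i : Fin (k + 1)) univ (U.1 0) x = U.1 i x :=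
      ae_all_iff.2 fun i => hw U i
    have h2 : ∀ᵐ x, ∀ i, A i (U.1 i) x = b i x (U.1 i x) := ae_all_iff.2 fun i => hA i (U.1 i)
    filter_upwards [h1, h2, Lp.coeFn_finsetSum Finset.univ fun i => A i (U.1 i)] with x h1 h2 h3
    rw [h3, Finset.sum_range]
    simp only [h1, Finset.sum_apply, h2]
  have hinj : L.ker = ⊥ := by
    refine LinearMap.ker_eq_bot'.2 fun U hU => ?_
    have h0 : ∀ V : sobolevTuples E k, L V = 0 → (fun x => ∑ i ∈ Finset.range (k + 1),
        b i x (weakDeriv i univ (V.1 0) x)) =ᵐ[volume] (0 : ℝ → E) := fun V hV => by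
      refine (hL V).trans ?_
      rw [hV]
      exact Lp.coeFn_zero _ _ _
    have h1 := (hbij 0 MemLp.zero).2 (U.1 0) ((0 : sobolevTuples E k).1 0) (hH U) (hH 0)
      (h0 U hU) (h0 0 (map_zero L))
    ext1
    ext1 i
    refine Lp.ext ?_
    have h2 := (U.2 i).ae_eq isOpen_univ ((0 : sobolevTuples E k).2 i) (by simpa using h1)
    simpa using h2
  have hsurj : L.range = ⊤ := by
    refine LinearMap.range_eq_top.2 fun g => ?_
    obtain ⟨u, hu, hug⟩ := (hbij g (Lp.memLp g)).1
    have hm : ∀ i : Fin (k + 1), MemLp (weakDeriv i univ u) 2 volume := fun i =>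
      hu.memLp_weakDeriv (by omega)
    let U : sobolevTuples E k := ⟨fun i => (hm i).toLp, fun i : Fin (k + 1) =>
      (hu.isWeakDeriv (by omega : (i : ℕ) ≤ k)).congr_univ
        (hu.weakDeriv_zero_ae_eq.symm.trans (hm 0).coeFn_toLp.symm) (hm i).coeFn_toLp.symm⟩
    refine ⟨U, Lp.ext ?_⟩
    refine (hL U).symm.trans (EventuallyEq.trans ?_ hug)
    have h1 : ∀ᵐ x, ∀ i, weakDeriv (i : Fin (k + 1)) univ (U.1 0) x = U.1 i x :=
      ae_all_iff.2 fun i => hw U i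
    have h2 : ∀ᵐ x, ∀ i : Fin (k + 1), (hm i).toLp (weakDeriv i univ u) x = weakDeriv i univ u x :=
      ae_all_iff.2 fun i => (hm i).coeFn_toLp
    filter_upwards [h1, h2] with x h1 h2
    rw [Finset.sum_range, Finset.sum_range]
    refine Finset.sum_congr rfl fun i _ => ?_
    rw [h1 i, ← h2 i]
  have : CompleteSpace (sobolevTuples E k) :=
    (isClosed_sobolevTuples (E := E) k).completeSpace_coe
  let e := ContinuousLinearEquiv.ofBijective L hinj hsurj
  refine ⟨(LinearMap.proj 0).comp ((sobolevTuples E k).subtype.comp e.symm.toLinearMap),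
    ‖e.symm.toContinuousLinearMap‖, norm_nonneg _, fun g => ?_⟩
  change MemHk k univ ((e.symm g).1 0) ∧ (fun x => ∑ i ∈ Finset.range (k + 1),
    b i x (weakDeriv i univ ((e.symm g).1 0) x)) =ᵐ[volume] g ∧
    ∀ i ≤ k, L2Norm univ (weakDeriv i univ ((e.symm g).1 0)) ≤ _
  have hLe : L (e.symm g) = g := e.apply_symm_apply g
  refine ⟨hH _, ?_, fun i hi => ?_⟩
  · have := hL (e.symm g)
    rwa [hLe] at this
  · rw [L2Norm_congr (ae_restrict_of_ae (hw (e.symm g) ⟨i, by omega⟩)), L2Norm,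
      Measure.restrict_univ, ← Lp.norm_def]
    refine (norm_le_pi_norm (e.symm g).1 _).trans ?_
    exact e.symm.toContinuousLinearMap.le_opNorm g

end SobolevSpace

/-! ### Uniform bounds for periodic systems -/

lemma exists_bound_of_periodic {E G : Type*} [NormedAddCommGroup E] [ProperSpace E]
    [NormedAddCommGroup G] {T : ℝ} (hT : 0 < T) {F : E × ℝ → G} (hF : Continuous F)
    (hper : ∀ u, Function.Periodic (fun x => F (u, x)) T) (ρ : ℝ) :
    ∃ C, ∀ u x, ‖u‖ ≤ ρ → ‖F (u, x)‖ ≤ C := by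
  obtain ⟨C, hC⟩ := ((isCompact_closedBall (0 : E) ρ).prod
    (isCompact_Icc (a := (0 : ℝ)) (b := T))).exists_bound_of_continuousOn hF.continuousOn
  refine ⟨C, fun u x hu => ?_⟩
  obtain ⟨y, hy, hxy⟩ := (hper u).exists_mem_Ico₀ hT x
  refine le_of_eq_of_le (congrArg _ hxy) (hC (u, y) ⟨by simpa using hu, hy.1, hy.2.le⟩)

namespace PeriodicSystem

variable {𝔽 : Type} [RCLike 𝔽] {k m : ℕ} {T : ℝ}

/-- The `i`-th coefficient of the differential expression, as an operator on `𝔽^m`. -/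
def coeffCLM (S : PeriodicSystem 𝔽 k m T) (i : ℕ) (x : ℝ) :
    EuclideanSpace 𝔽 (Fin m) →L[𝔽] EuclideanSpace 𝔽 (Fin m) :=
  Matrix.toEuclideanCLM (n := Fin m) (𝕜 := 𝔽) (S.α i x)

/-- The partial derivative `∂_u 𝒩(u, x)`. -/
def nlDeriv (S : PeriodicSystem 𝔽 k m T) (u : EuclideanSpace 𝔽 (Fin m)) (x : ℝ) :
    EuclideanSpace 𝔽 (Fin m) →L[𝔽] EuclideanSpace 𝔽 (Fin m) :=
  fderiv 𝔽 (fun w => S.nl w x) u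

lemma continuous_coeffCLM (S : PeriodicSystem 𝔽 k m T) {i : ℕ} (h1 : 1 ≤ i) (h2 : i ≤ k) :
    Continuous (S.coeffCLM i) := by
  let ℓ : Matrix (Fin m) (Fin m) 𝔽 →ₗ[𝔽]
      EuclideanSpace 𝔽 (Fin m) →L[𝔽] EuclideanSpace 𝔽 (Fin m) :=
    { toFun := Matrix.toEuclideanCLM (n := Fin m) (𝕜 := 𝔽)
      map_add' := map_add _
      map_smul' := map_smul _ }
  exact ℓ.continuous_of_finiteDimensional.comp (S.α_continuous i h1 h2)

/-- `Λ` bounds the coefficients of `A`, the derivative `∂_u 𝒩` on the ball of radius `ρ`, and the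
Lipschitz constants of `𝒩` and `∂_u 𝒩` there. -/
structure HasBound (S : PeriodicSystem 𝔽 k m T) (ρ Λ : ℝ) : Prop where
  nonneg : 0 ≤ Λ
  coeff : ∀ i, 1 ≤ i → i ≤ k → ∀ x, ‖S.coeffCLM i x‖ ≤ Λ
  deriv : ∀ u x, ‖u‖ ≤ ρ → ‖S.nlDeriv u x‖ ≤ Λ
  lip : ∀ u v x, ‖u‖ ≤ ρ → ‖v‖ ≤ ρ → ‖S.nl u x - S.nl v x‖ ≤ Λ * ‖u - v‖
  deriv_lip : ∀ u v x, ‖u‖ ≤ ρ → ‖v‖ ≤ ρ → ‖S.nlDeriv u x - S.nlDeriv v x‖ ≤ Λ * ‖u - v‖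

lemma exists_hasBound (S : PeriodicSystem 𝔽 k m T) (hT : 0 < T) (ρ : ℝ) :
    ∃ Λ, S.HasBound ρ Λ := by
  have hper : ∀ x, (fun u => S.nl u (x + T)) = fun u => S.nl u x := fun x =>
    funext fun u => S.nl_periodic u x
  have hdiff : ∀ x, Differentiable 𝔽 fun u => S.nl u x := fun x =>
    (S.nl_contDiff x).differentiable (by norm_num)
  have hdiff2 : ∀ x, Differentiable 𝔽 (fderiv 𝔽 fun u => S.nl u x) := fun x =>
    ((S.nl_contDiff x).fderiv_right (m := 1) (by norm_num)).differentiable (by norm_num)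
  obtain ⟨C1, h1⟩ := exists_bound_of_periodic hT S.nl_continuous_fderiv
    (fun u x => by simp only [hper x]) ρ
  obtain ⟨C2, h2⟩ := exists_bound_of_periodic (E := EuclideanSpace 𝔽 (Fin m))
    (G := EuclideanSpace 𝔽 (Fin m) →L[𝔽]
      EuclideanSpace 𝔽 (Fin m) →L[𝔽] EuclideanSpace 𝔽 (Fin m))
    (F := fun p => fderiv 𝔽 (fderiv 𝔽 fun u => S.nl u p.2) p.1) hT S.nl_continuous_fderiv_fderiv
    (fun u x => by simp only [hper x]) ρ
  have h3 : ∀ i ∈ Finset.Icc 1 k, ∃ C, ∀ x, ‖S.coeffCLM i x‖ ≤ C := by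
    intro i hi
    obtain ⟨hi1, hi2⟩ := Finset.mem_Icc.1 hi
    obtain ⟨C, hC⟩ := exists_bound_of_periodic (E := ℝ) hT
      ((S.continuous_coeffCLM hi1 hi2).comp continuous_snd)
      (fun u x => by simp [coeffCLM, S.α_periodic i hi1 hi2 x]) 0
    exact ⟨C, fun x => hC 0 x (by simp)⟩
  choose! C3 h3 using h3
  have hpos : 0 ≤ ∑ i ∈ Finset.Icc 1 k, |C3 i| := Finset.sum_nonneg fun _ _ => abs_nonneg _
  have le1 : C1 ≤ |C1| + |C2| + ∑ i ∈ Finset.Icc 1 k, |C3 i| := by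
    linarith [le_abs_self C1, abs_nonneg C2]
  have le2 : C2 ≤ |C1| + |C2| + ∑ i ∈ Finset.Icc 1 k, |C3 i| := by
    linarith [le_abs_self C2, abs_nonneg C1]
  refine ⟨|C1| + |C2| + ∑ i ∈ Finset.Icc 1 k, |C3 i|, by positivity, ?_, ?_, ?_, ?_⟩
  · intro i hi1 hi2 x
    have hi := Finset.mem_Icc.2 ⟨hi1, hi2⟩
    have := Finset.single_le_sum (f := fun i => |C3 i|) (fun j _ => abs_nonneg (C3 j)) hi
    refine (h3 i hi x).trans ((le_abs_self _).trans (this.trans ?_))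
    linarith [abs_nonneg C1, abs_nonneg C2]
  · exact fun u x hu => (h1 u x hu).trans le1
  · intro u v x hu hv
    refine (convex_closedBall (0 : EuclideanSpace 𝔽 (Fin m)) ρ).norm_image_sub_le_of_norm_fderiv_le
      (𝕜 := 𝔽) (f := fun u => S.nl u x) (fun y _ => hdiff x y)
      (fun y hy => (h1 y x (by simpa using hy)).trans le1) (by simpa using hv) (by simpa using hu)
  · intro u v x hu hv
    refine (convex_closedBall (0 : EuclideanSpace 𝔽 (Fin m)) ρ).norm_image_sub_le_of_norm_fderiv_le
      (𝕜 := 𝔽) (f := fderiv 𝔽 fun u => S.nl u x) (fun y _ => hdiff2 x y)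
      (fun y hy => (h2 y x (by simpa using hy)).trans le2) (by simpa using hv) (by simpa using hu)

/-- The remainder in the linearization of `𝒩` has a small Lipschitz constant near `0`. -/
lemma HasBound.remainder {S : PeriodicSystem 𝔽 k m T} {ρ Λ : ℝ} (h : S.HasBound ρ Λ) {σ : ℝ}
    {w u v : EuclideanSpace 𝔽 (Fin m)} (x : ℝ) (hw : ‖w‖ + σ ≤ ρ) (hu : ‖u‖ ≤ σ) (hv : ‖v‖ ≤ σ) :
    ‖S.nl (w + u) x - S.nl (w + v) x - S.nlDeriv w x (u - v)‖ ≤ Λ * σ * ‖u - v‖ := by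
  have hσ : 0 ≤ σ := (norm_nonneg u).trans hu
  have hd : ∀ y, HasFDerivAt (fun y => S.nl (w + y) x - S.nlDeriv w x y)
      (S.nlDeriv (w + y) x - S.nlDeriv w x) y := by
    intro y
    have h1 : HasFDerivAt (fun u => S.nl u x) (S.nlDeriv (w + y) x) (w + y) :=
      ((S.nl_contDiff x).differentiable (by norm_num) (w + y)).hasFDerivAt
    exact ((hasFDerivAt_comp_add_left w).2 h1).sub (S.nlDeriv w x).hasFDerivAt
  have := Convex.norm_image_sub_le_of_norm_hasFDerivWithin_le
    (s := Metric.closedBall (0 : EuclideanSpace 𝔽 (Fin m)) σ) (𝕜 := 𝔽) (C := Λ * σ) (fun y _ => (hd y).hasFDerivWithinAt) (fun y hy => ?_)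
    (convex_closedBall _ _) (by simpa using hv) (by simpa using hu)
  · refine le_of_eq_of_le (congrArg _ ?_) this
    rw [map_sub]; abel
  · have hy' : ‖y‖ ≤ σ := by simpa using hy
    refine (h.deriv_lip (w + y) w x ?_ (by linarith)).trans ?_
    · linarith [norm_add_le w y]
    · rw [add_sub_cancel_left]
      exact mul_le_mul_of_nonneg_left hy' h.nonneg

/-- The coefficients of the linearization `ℒ(z)`, as real-linear operators; the index `0` stands
for the potential `∂_u 𝒩(z, ·)`. -/
def linCoeff (S : PeriodicSystem 𝔽 k m T) (z : ℝ → EuclideanSpace 𝔽 (Fin m)) (i : ℕ) (x : ℝ) :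
    EuclideanSpace 𝔽 (Fin m) →L[ℝ] EuclideanSpace 𝔽 (Fin m) :=
  if i = 0 then (S.nlDeriv (z x) x).restrictScalars ℝ else (S.coeffCLM i x).restrictScalars ℝ

lemma linCoeff_zero (S : PeriodicSystem 𝔽 k m T) (z : ℝ → EuclideanSpace 𝔽 (Fin m)) :
    S.linCoeff z 0 = fun x => (S.nlDeriv (z x) x).restrictScalars ℝ := by
  ext1 x; exact if_pos rfl

lemma linCoeff_of_pos (S : PeriodicSystem 𝔽 k m T) (z : ℝ → EuclideanSpace 𝔽 (Fin m)) {i : ℕ}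
    (hi : 1 ≤ i) : S.linCoeff z i = fun x => (S.coeffCLM i x).restrictScalars ℝ := by
  ext1 x; exact if_neg (by omega)

lemma range_succ_eq_insert_Icc (k : ℕ) : Finset.range (k + 1) = insert 0 (Finset.Icc 1 k) := by
  ext i; simp; omega

lemma linearization_ae_eq (S : PeriodicSystem 𝔽 k m T) (z : ℝ → EuclideanSpace 𝔽 (Fin m))
    {u : ℝ → EuclideanSpace 𝔽 (Fin m)} (hu : MemHk k univ u) :
    S.linearization z u =ᵐ[volume] fun x =>
      ∑ i ∈ Finset.range (k + 1), S.linCoeff z i x (weakDeriv i univ u x) := by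
  filter_upwards [hu.weakDeriv_zero_ae_eq] with x hx
  rw [range_succ_eq_insert_Icc, Finset.sum_insert (by simp), hx, add_comm]
  have e : ∑ i ∈ Finset.Icc 1 k, S.linCoeff z i x (weakDeriv i univ u x) = S.diffOp u x :=
    Finset.sum_congr rfl fun i hi => by
      rw [S.linCoeff_of_pos z (Finset.mem_Icc.1 hi).1]; rfl
  rw [e, linCoeff_zero]
  rfl

lemma ae_norm_le_of_memLp_top {E : Type*} [NormedAddCommGroup E] {z : ℝ → E}
    (hz : MemLp z ⊤ volume) : ∃ ρ : ℝ, 0 ≤ ρ ∧ ∀ᵐ x, ‖z x‖ ≤ ρ := by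
  refine ⟨(eLpNormEssSup z volume).toReal, ENNReal.toReal_nonneg, ?_⟩
  have hfin : eLpNormEssSup z volume ≠ ⊤ := by
    have := hz.eLpNorm_ne_top
    rwa [eLpNorm_exponent_top] at this
  filter_upwards [ae_le_eLpNormEssSup (f := z) (μ := volume)] with x hx
  have := ENNReal.toReal_mono hfin hx
  simpa using this

lemma aestronglyMeasurable_nlDeriv (S : PeriodicSystem 𝔽 k m T)
    {z : ℝ → EuclideanSpace 𝔽 (Fin m)} (hz : AEStronglyMeasurable z volume) :
    AEStronglyMeasurable (fun x => S.nlDeriv (z x) x) volume :=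
  S.nl_continuous_fderiv.comp_aestronglyMeasurable
    (hz.prodMk aestronglyMeasurable_id)

lemma aestronglyMeasurable_nl (S : PeriodicSystem 𝔽 k m T)
    {z : ℝ → EuclideanSpace 𝔽 (Fin m)} (hz : AEStronglyMeasurable z volume) :
    AEStronglyMeasurable (fun x => S.nl (z x) x) volume :=
  S.nl_continuous.comp_aestronglyMeasurable (hz.prodMk aestronglyMeasurable_id)

lemma memLp_linCoeff (S : PeriodicSystem 𝔽 k m T) (hT : 0 < T)
    {z : ℝ → EuclideanSpace 𝔽 (Fin m)} (hz : MemLp z ⊤ volume) {i : ℕ} (hi : i ≤ k) :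
    MemLp (S.linCoeff z i) ⊤ volume := by
  obtain ⟨ρ, -, hρ⟩ := ae_norm_le_of_memLp_top hz
  obtain ⟨Λ, hΛ⟩ := S.exists_hasBound hT ρ
  have hc : Continuous fun B : EuclideanSpace 𝔽 (Fin m) →L[𝔽] EuclideanSpace 𝔽 (Fin m) =>
      B.restrictScalars ℝ :=
    (ContinuousLinearMap.restrictScalarsL 𝔽 (EuclideanSpace 𝔽 (Fin m))
      (EuclideanSpace 𝔽 (Fin m)) ℝ ℝ).continuous
  rcases Nat.eq_zero_or_pos i with rfl | h0
  · have hm := hc.comp_aestronglyMeasurable (S.aestronglyMeasurable_nlDeriv hz.1)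
    rw [linCoeff_zero]
    refine memLp_top_of_bound (E := EuclideanSpace 𝔽 (Fin m) →L[ℝ] EuclideanSpace 𝔽 (Fin m)) hm Λ ?_
    filter_upwards [hρ] with x hx
    exact (ContinuousLinearMap.norm_restrictScalars _).trans_le (hΛ.deriv _ x hx)
  · have hm := hc.comp_aestronglyMeasurable ((S.continuous_coeffCLM h0 hi).aestronglyMeasurable (μ := volume))
    rw [S.linCoeff_of_pos z h0]
    refine memLp_top_of_bound (E := EuclideanSpace 𝔽 (Fin m) →L[ℝ] EuclideanSpace 𝔽 (Fin m)) hm Λ ?_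
    exact Eventually.of_forall fun x =>
      (ContinuousLinearMap.norm_restrictScalars _).trans_le (hΛ.coeff i h0 hi x)

lemma IsNondegenerate.exists_inverse {S : PeriodicSystem 𝔽 k m T} (hT : 0 < T)
    {z : ℝ → EuclideanSpace 𝔽 (Fin m)} (hz : MemLp z ⊤ volume) (h : S.IsNondegenerate z) :
    ∃ (R : Lp (EuclideanSpace 𝔽 (Fin m)) 2 (volume : Measure ℝ) →ₗ[ℝ]
        Lp (EuclideanSpace 𝔽 (Fin m)) 2 (volume : Measure ℝ)) (C : ℝ), 0 ≤ C ∧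
      ∀ g, MemHk k univ (R g) ∧ S.linearization z (R g) =ᵐ[volume] g ∧
        ∀ i ≤ k, L2Norm univ (weakDeriv i univ (R g)) ≤ C * ‖g‖ := by
  obtain ⟨R, C, hC, hR⟩ := exists_bounded_inverse (k := k) (b := S.linCoeff z)
    (fun i hi => S.memLp_linCoeff hT hz hi) (fun g hg => by
      obtain ⟨⟨u, hu, hug⟩, huniq⟩ := h g hg
      refine ⟨⟨u, hu, (S.linearization_ae_eq z hu).symm.trans hug⟩, fun u₁ u₂ h1 h2 e1 e2 => ?_⟩
      exact huniq u₁ u₂ h1 h2 ((S.linearization_ae_eq z h1).trans e1)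
        ((S.linearization_ae_eq z h2).trans e2))
  exact ⟨R, C, hC, fun g => ⟨(hR g).1, (S.linearization_ae_eq z (hR g).1).trans (hR g).2.1,
    (hR g).2.2⟩⟩

end PeriodicSystem

/-! ### Estimates in `L²` and the Leibniz rule -/

section Estimates

variable {E F : Type*} [NormedAddCommGroup E] [NormedAddCommGroup F]

lemma L2Norm_univ (f : ℝ → E) : L2Norm univ f = (eLpNorm f 2 volume).toReal := by
  rw [L2Norm, Measure.restrict_univ]

lemma L2Norm_univ_congr {f g : ℝ → E} (h : f =ᵐ[volume] g) : L2Norm univ f = L2Norm univ g :=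
  L2Norm_congr (by simpa using h)

lemma L2Norm_univ_Lp (f : Lp E 2 (volume : Measure ℝ)) : L2Norm univ f = ‖f‖ := by
  rw [L2Norm_univ, Lp.norm_def]

lemma L2Norm_indicator {Ω : Set ℝ} (hΩ : MeasurableSet Ω) (f : ℝ → E) :
    L2Norm univ (Ω.indicator f) = L2Norm Ω f := by
  rw [L2Norm_univ, L2Norm, eLpNorm_indicator_eq_eLpNorm_restrict hΩ]

lemma memLp_comp_sub {f : ℝ → E} (hf : MemLp f 2 volume) (s : ℝ) :
    MemLp (fun x => f (x - s)) 2 volume :=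
  hf.comp_measurePreserving (measurePreserving_sub_right volume s)

lemma L2Norm_comp_sub {f : ℝ → E} (hf : MemLp f 2 volume) (s : ℝ) :
    L2Norm univ (fun x => f (x - s)) = L2Norm univ f := by
  rw [L2Norm_univ, L2Norm_univ]
  exact congrArg _ (eLpNorm_comp_measurePreserving hf.1 (measurePreserving_sub_right volume s))

lemma ae_comp_sub {p : ℝ → Prop} (h : ∀ᵐ x, p x) (s : ℝ) : ∀ᵐ x : ℝ, p (x - s) :=
  (measurePreserving_sub_right volume s).quasiMeasurePreserving.ae h

lemma memLp_and_L2Norm_le_of_ae_le_sum {ι : Type*} (s : Finset ι) {f : ℝ → E} {G : ι → ℝ → F}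
    {c : ℝ} (hc : 0 ≤ c) (hf : AEStronglyMeasurable f volume)
    (hG : ∀ j ∈ s, MemLp (G j) 2 volume) (h : ∀ᵐ x, ‖f x‖ ≤ c * ∑ j ∈ s, ‖G j x‖) :
    MemLp f 2 volume ∧ L2Norm univ f ≤ c * ∑ j ∈ s, L2Norm univ (G j) := by
  have hS : MemLp (fun x => ∑ j ∈ s, ‖G j x‖) 2 volume :=
    memLp_finsetSum s fun j hj => (hG j hj).norm
  have hpos : ∀ x, 0 ≤ ∑ j ∈ s, ‖G j x‖ := fun x => Finset.sum_nonneg fun _ _ => norm_nonneg _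
  have h' : ∀ᵐ x, ‖f x‖ ≤ c * ‖∑ j ∈ s, ‖G j x‖‖ := by
    filter_upwards [h] with x hx
    rwa [Real.norm_of_nonneg (hpos x)]
  refine ⟨hS.of_le_mul hf h', ?_⟩
  have h1 := eLpNorm_le_mul_eLpNorm_of_ae_le_mul h' 2
  have h2 : eLpNorm (fun x => ∑ j ∈ s, ‖G j x‖) 2 volume ≤ ∑ j ∈ s, eLpNorm (G j) 2 volume := by
    have := eLpNorm_sum_le (p := 2) (f := fun j x => ‖G j x‖) (s := s)
      (fun j hj => (hG j hj).norm.1) (by norm_num)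
    simp only [eLpNorm_norm] at this
    refine le_of_eq_of_le (congrArg (fun q => eLpNorm q 2 volume) ?_) this
    ext x; simp
  have h3 : ∑ j ∈ s, eLpNorm (G j) 2 volume ≠ ⊤ :=
    ENNReal.sum_ne_top.2 fun j hj => (hG j hj).eLpNorm_ne_top
  have h4 := ENNReal.toReal_mono (ENNReal.mul_ne_top ENNReal.ofReal_ne_top h3)
    (h1.trans (mul_le_mul_right h2 _))
  rw [ENNReal.toReal_mul, ENNReal.toReal_ofReal hc,
    ENNReal.toReal_sum fun j hj => (hG j hj).eLpNorm_ne_top] at h4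
  simpa only [L2Norm_univ] using h4

variable [NormedSpace ℝ E]

lemma norm_choose_smul_le {k i l : ℕ} (hi : i ≤ k) {c B : ℝ} (hc : |c| ≤ B) (v : E) :
    ‖i.choose l • c • v‖ ≤ 2 ^ k * B * ‖v‖ := by
  have hB : 0 ≤ B := (abs_nonneg _).trans hc
  have h1 : (i.choose l : ℝ) ≤ 2 ^ k := by
    have : i.choose l ≤ 2 ^ k := (Nat.choose_le_two_pow i l).trans
      (Nat.pow_le_pow_right (by norm_num) hi)
    exact_mod_cast this
  rw [← Nat.cast_smul_eq_nsmul ℝ, norm_smul, norm_smul, ← mul_assoc]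
  refine mul_le_mul_of_nonneg_right ?_ (norm_nonneg _)
  rw [Real.norm_of_nonneg (by positivity), Real.norm_eq_abs]
  exact mul_le_mul h1 hc (abs_nonneg _) (by positivity)

lemma norm_leibniz_le {k i : ℕ} (hi : i ≤ k) {c : ℕ → ℝ} {B : ℝ} (hc : ∀ p ≤ k, |c p| ≤ B)
    (v : ℕ → E) : ‖∑ l ∈ Finset.range (i + 1), i.choose l • c (i - l) • v l‖ ≤
      2 ^ k * B * ∑ l ∈ Finset.range (k + 1), ‖v l‖ := by
  have hB : 0 ≤ B := (abs_nonneg _).trans (hc 0 (Nat.zero_le k))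
  rw [Finset.mul_sum]
  refine (norm_sum_le _ _).trans ((Finset.sum_le_sum fun l _ =>
    norm_choose_smul_le hi (hc (i - l) (by omega)) (v l)).trans ?_)
  exact Finset.sum_le_sum_of_subset_of_nonneg (Finset.range_mono (by omega))
    fun _ _ _ => by positivity

/-- The commutator of a derivative with multiplication by a slowly varying function is small. -/
lemma norm_leibniz_sub_le {k i : ℕ} (hi : i ≤ k) {c : ℕ → ℝ} {ε : ℝ} (hε : 0 ≤ ε)
    (hc : ∀ p, 1 ≤ p → p ≤ k → |c p| ≤ ε) (v : ℕ → E) :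
    ‖∑ l ∈ Finset.range (i + 1), i.choose l • c (i - l) • v l - c 0 • v i‖ ≤
      2 ^ k * ε * ∑ l ∈ Finset.range (k + 1), ‖v l‖ := by
  rw [Finset.sum_range_succ, Nat.choose_self, one_smul, Nat.sub_self, add_sub_cancel_right,
    Finset.mul_sum]
  refine (norm_sum_le _ _).trans ((Finset.sum_le_sum fun l hl => norm_choose_smul_le hi
    (hc (i - l) (by have := Finset.mem_range.1 hl; omega) (by omega)) (v l)).trans ?_)
  exact Finset.sum_le_sum_of_subset_of_nonneg (Finset.range_mono (by omega))
    fun _ _ _ => by positivity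

/-- Multiplication by a bounded scalar function, as an operator in `L²`. -/
lemma exists_clm_smul (E : Type*) [NormedAddCommGroup E] [NormedSpace ℝ E] {ψ : ℝ → ℝ}
    (hψ : Continuous ψ) {B : ℝ} (hb : ∀ x, |ψ x| ≤ B) :
    ∃ A : Lp E 2 (volume : Measure ℝ) →L[ℝ] Lp E 2 (volume : Measure ℝ),
      ∀ f, A f =ᵐ[volume] fun x => ψ x • f x := by
  have hm : MemLp (fun x => ψ x • ContinuousLinearMap.id ℝ E) ⊤ volume := by
    refine memLp_top_of_bound (hψ.aestronglyMeasurable.smul_const _) B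
      (Eventually.of_forall fun x => ?_)
    rw [norm_smul]
    have h1 : ‖ContinuousLinearMap.id ℝ E‖ ≤ 1 := ContinuousLinearMap.norm_id_le
    calc ‖ψ x‖ * ‖ContinuousLinearMap.id ℝ E‖ ≤ ‖ψ x‖ * 1 :=
          mul_le_mul_of_nonneg_left h1 (norm_nonneg _)
      _ ≤ B := by rw [mul_one]; exact hb x
  exact exists_clm_apply hm

end Estimates

/-! ### Slowly varying cutoff functions -/

lemma exists_cutoff_profile (k : ℕ) (left right : Prop) : ∃ Ψ : ℝ → ℝ, ∃ B : ℝ, 0 ≤ B ∧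
    ContDiff ℝ ∞ Ψ ∧ (∀ t, |Ψ t| ≤ 1) ∧ (∀ p, 1 ≤ p → p ≤ k → ∀ t, |iteratedDeriv p Ψ t| ≤ B) ∧
    (∀ t, (left ∨ -(5 / 8) ≤ t) → (right ∨ t ≤ 5 / 8) → Ψ t = 1) ∧
    (∀ t, Ψ t ≠ 0 → (left ∨ -(3 / 4) ≤ t) ∧ (right ∨ t ≤ 3 / 4)) := by
  classical
  let Ψl : ℝ → ℝ := if left then fun _ => 1 else fun t => Real.smoothTransition (6 + 8 * t)
  let Ψr : ℝ → ℝ := if right then fun _ => 1 else fun t => Real.smoothTransition (6 - 8 * t)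
  have hl : ContDiff ℝ ∞ Ψl := by
    by_cases h : left
    · simp only [Ψl, if_pos h]; exact contDiff_const
    · simp only [Ψl, if_neg h]
      exact Real.smoothTransition.contDiff.comp (contDiff_const.add (contDiff_const.mul contDiff_id))
  have hr : ContDiff ℝ ∞ Ψr := by
    by_cases h : right
    · simp only [Ψr, if_pos h]; exact contDiff_const
    · simp only [Ψr, if_neg h]
      exact Real.smoothTransition.contDiff.comp (contDiff_const.sub (contDiff_const.mul contDiff_id))
  have hl1 : ∀ t, (left ∨ -(5 / 8) ≤ t) → Ψl t = 1 := by
    intro t ht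
    by_cases h : left
    · simp only [Ψl, if_pos h]
    · simp only [Ψl, if_neg h]
      exact Real.smoothTransition.one_of_one_le (by linarith [ht.resolve_left h])
  have hr1 : ∀ t, (right ∨ t ≤ 5 / 8) → Ψr t = 1 := by
    intro t ht
    by_cases h : right
    · simp only [Ψr, if_pos h]
    · simp only [Ψr, if_neg h]
      exact Real.smoothTransition.one_of_one_le (by linarith [ht.resolve_left h])
  have hl0 : ∀ t, ¬ left → t ≤ -(3 / 4) → Ψl t = 0 := by
    intro t h ht
    simp only [Ψl, if_neg h]
    exact Real.smoothTransition.zero_of_nonpos (by linarith)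
  have hr0 : ∀ t, ¬ right → 3 / 4 ≤ t → Ψr t = 0 := by
    intro t h ht
    simp only [Ψr, if_neg h]
    exact Real.smoothTransition.zero_of_nonpos (by linarith)
  have hlb : ∀ t, 0 ≤ Ψl t ∧ Ψl t ≤ 1 := by
    intro t
    by_cases h : left
    · simp [Ψl, if_pos h]
    · simp only [Ψl, if_neg h]
      exact ⟨Real.smoothTransition.nonneg _, Real.smoothTransition.le_one _⟩
  have hrb : ∀ t, 0 ≤ Ψr t ∧ Ψr t ≤ 1 := by
    intro t
    by_cases h : right
    · simp [Ψr, if_pos h]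
    · simp only [Ψr, if_neg h]
      exact ⟨Real.smoothTransition.nonneg _, Real.smoothTransition.le_one _⟩
  have hsm : ContDiff ℝ ∞ fun t => Ψl t * Ψr t := hl.mul hr
  -- the profile is locally constant outside a compact interval
  have hd : HasCompactSupport (deriv fun t => Ψl t * Ψr t) := by
    refine HasCompactSupport.intro (isCompact_Icc (a := (-1 : ℝ)) (b := 1)) fun t ht => ?_
    have key : ∃ c, (fun t => Ψl t * Ψr t) =ᶠ[𝓝 t] fun _ => c := by
      rcases lt_or_ge t (-1) with h | h
      · by_cases hL : left
        · refine ⟨1, ?_⟩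
          filter_upwards [Iio_mem_nhds h] with s hs
          rw [hl1 s (Or.inl hL), hr1 s (Or.inr (by linarith [mem_Iio.1 hs])), one_mul]
        · refine ⟨0, ?_⟩
          filter_upwards [Iio_mem_nhds h] with s hs
          rw [hl0 s hL (by linarith [mem_Iio.1 hs]), zero_mul]
      · have h' : 1 < t := by
          by_contra h'
          exact ht ⟨h, not_lt.1 h'⟩
        by_cases hR : right
        · refine ⟨1, ?_⟩
          filter_upwards [Ioi_mem_nhds h'] with s hs
          rw [hl1 s (Or.inr (by linarith [mem_Ioi.1 hs])), hr1 s (Or.inl hR), one_mul]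
        · refine ⟨0, ?_⟩
          filter_upwards [Ioi_mem_nhds h'] with s hs
          rw [hr0 s hR (by linarith [mem_Ioi.1 hs]), mul_zero]
    obtain ⟨c, hc⟩ := key
    rw [hc.deriv_eq, deriv_const]
  have hbd : ∀ p : ℕ, ∃ B : ℝ, ∀ t, |iteratedDeriv (p + 1) (fun t => Ψl t * Ψr t) t| ≤ B := by
    intro p
    have hc1 : ContDiff ℝ ∞ (deriv fun t => Ψl t * Ψr t) := by
      simpa using contDiff_iteratedDeriv hsm 1
    rw [iteratedDeriv_succ']
    exact (hasCompactSupport_iteratedDeriv hd p).exists_bound_of_continuous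
      (contDiff_iteratedDeriv hc1 p).continuous
  choose B hB using hbd
  refine ⟨fun t => Ψl t * Ψr t, ∑ p ∈ Finset.range k, |B p|,
    Finset.sum_nonneg fun _ _ => abs_nonneg _, hsm, fun t => ?_, fun p h1 hp t => ?_,
    fun t h1 h2 => by simp only [hl1 t h1, hr1 t h2, one_mul], fun t ht => ⟨?_, ?_⟩⟩
  · rw [abs_of_nonneg (mul_nonneg (hlb t).1 (hrb t).1)]
    exact mul_le_one₀ (hlb t).2 (hrb t).1 (hrb t).2
  · obtain ⟨q, rfl⟩ : ∃ q, p = q + 1 := ⟨p - 1, by omega⟩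
    refine (hB q t).trans ((le_abs_self _).trans ?_)
    exact Finset.single_le_sum (f := fun p => |B p|) (fun _ _ => abs_nonneg _)
      (Finset.mem_range.2 (by omega))
  · by_contra h
    push Not at h
    exact ht (by simp only [hl0 t h.1 h.2.le, zero_mul])
  · by_contra h
    push Not at h
    exact ht (by simp only [hr0 t h.1 h.2.le, mul_zero])

/-- The closed `r`-neighbourhood of `jh`, extended to `-∞` if `j = 1` and to `+∞` if `j = M`. -/
def InCell (M : ℕ) (h r : ℝ) (j : ℕ) (x : ℝ) : Prop :=
  (j = 1 ∨ j * h - r ≤ x) ∧ (j = M ∨ x ≤ j * h + r)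

/-- Cutoff functions adapted to the `j`-th cell whose derivatives are of the order of the inverse
length `h` of the cell. -/
lemma exists_slow_cutoffs (k M : ℕ) : ∃ B : ℝ, 0 ≤ B ∧ ∀ h : ℝ, 1 ≤ h → ∀ j ∈ Finset.Icc 1 M,
    ∃ ψ : ℝ → ℝ, ContDiff ℝ ∞ ψ ∧ (∀ x, |ψ x| ≤ 1) ∧
      (∀ p, 1 ≤ p → p ≤ k → ∀ x, |iteratedDeriv p ψ x| ≤ B / h) ∧
      (∀ x, InCell M h (5 / 8 * h) j x → ψ x = 1) ∧
      (∀ x, ψ x ≠ 0 → InCell M h (3 / 4 * h) j x) := by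
  choose Ψ B hB hsm hb1 hbd h1 h0 using fun j : ℕ => exists_cutoff_profile k (j = 1) (j = M)
  refine ⟨∑ j ∈ Finset.Icc 1 M, B j, Finset.sum_nonneg fun j _ => hB j, fun h hh j hj => ?_⟩
  have hpos : 0 < h := by linarith
  have hBj : B j ≤ ∑ j ∈ Finset.Icc 1 M, B j :=
    Finset.single_le_sum (f := B) (fun j _ => hB j) hj
  have hsm' : ContDiff ℝ ∞ fun t => Ψ j (t - j) := (hsm j).comp (contDiff_id.sub contDiff_const)
  refine ⟨fun x => Ψ j (h⁻¹ * x - j), hsm'.comp (contDiff_const.mul contDiff_id),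
    fun x => hb1 j _, fun p hp1 hp x => ?_, fun x hx => h1 j _ ?_ ?_, fun x hx => ?_⟩
  · have e := iteratedDeriv_comp_const_mul (n := p) (hsm'.of_le (by exact_mod_cast le_top)) h⁻¹
    rw [e, iteratedDeriv_comp_sub_const, abs_mul, abs_of_pos (by positivity), div_eq_inv_mul]
    refine mul_le_mul ?_ ((hbd j p hp1 hp _).trans hBj) (abs_nonneg _) (by positivity)
    exact pow_le_of_le_one (by positivity) (inv_le_one_of_one_le₀ hh) (by omega)
  · refine hx.1.imp id fun hx => ?_
    rw [le_sub_iff_add_le, inv_mul_eq_div, le_div_iff₀ hpos]; linarith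
  · refine hx.2.imp id fun hx => ?_
    rw [sub_le_iff_le_add, inv_mul_eq_div, div_le_iff₀ hpos]; linarith
  · obtain ⟨a, b⟩ := h0 j _ hx
    refine ⟨a.imp id fun hx => ?_, b.imp id fun hx => ?_⟩
    · rw [le_sub_iff_add_le, inv_mul_eq_div, le_div_iff₀ hpos] at hx; linarith
    · rw [sub_le_iff_le_add, inv_mul_eq_div, div_le_iff₀ hpos] at hx; linarith

/-! ### Approximate right inverses of linearizations -/

section

variable {E : Type*} [NormedAddCommGroup E] [NormedSpace ℝ E] [CompleteSpace E]

lemma memHk_of_ae_eq_sum {ι : Type*} {k : ℕ} {s : Finset ι} {u : ι → ℝ → E} {v : ℝ → E}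
    (hu : ∀ j ∈ s, MemHk k univ (u j)) (hv : v =ᵐ[volume] fun x => ∑ j ∈ s, u j x) :
    MemHk k univ v ∧ ∀ i ≤ k,
      weakDeriv i univ v =ᵐ[volume] fun x => ∑ j ∈ s, weakDeriv i univ (u j) x := by
  have h : ∀ i ≤ k, IsWeakDeriv i univ v fun x => ∑ j ∈ s, weakDeriv i univ (u j) x :=
    fun i hi => (IsWeakDeriv.sum s fun j hj => (hu j hj).isWeakDeriv hi).congr_univ hv.symm
      EventuallyEq.rfl
  exact ⟨memHk_univ_of_isWeakDeriv h fun i hi =>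
    memLp_finsetSum s fun j hj => (hu j hj).memLp_weakDeriv hi,
    fun i hi => weakDeriv_univ_ae_eq (h i hi)⟩

lemma ae_all_le {k : ℕ} {p : ℕ → ℝ → Prop} (h : ∀ i ≤ k, ∀ᵐ x, p i x) :
    ∀ᵐ x, ∀ i ≤ k, p i x :=
  ae_all_iff.2 fun i => by
    by_cases hi : i ≤ k
    · filter_upwards [h i hi] with x hx _ using hx
    · exact Eventually.of_forall fun x hx => absurd hx hi

/-- Translation, as an isometric operator in `L²`. -/
lemma exists_linear_comp_sub (E : Type*) [NormedAddCommGroup E] [NormedSpace ℝ E] (s : ℝ) :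
    ∃ A : Lp E 2 (volume : Measure ℝ) →ₗ[ℝ] Lp E 2 (volume : Measure ℝ),
      ∀ f, (A f =ᵐ[volume] fun x => f (x - s)) ∧ ‖A f‖ = ‖f‖ := by
  have hm := measurePreserving_sub_right (volume : Measure ℝ) s
  exact ⟨(Lp.compMeasurePreservingₗᵢ ℝ _ hm).toLinearMap, fun f =>
    ⟨Lp.coeFn_compMeasurePreserving f hm, (Lp.compMeasurePreservingₗᵢ ℝ _ hm).norm_map f⟩⟩

end

namespace PeriodicSystem

variable {𝔽 : Type} [RCLike 𝔽] {k m : ℕ} {T : ℝ}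

lemma linearization_congr_sum (S : PeriodicSystem 𝔽 k m T) (z : ℝ → EuclideanSpace 𝔽 (Fin m))
    {ι : Type*} {s : Finset ι} {u : ι → ℝ → EuclideanSpace 𝔽 (Fin m)}
    {v : ℝ → EuclideanSpace 𝔽 (Fin m)} (hu : ∀ j ∈ s, MemHk k univ (u j))
    (hv : v =ᵐ[volume] fun x => ∑ j ∈ s, u j x) :
    S.linearization z v =ᵐ[volume] fun x => ∑ j ∈ s, S.linearization z (u j) x := by
  obtain ⟨-, hD⟩ := memHk_of_ae_eq_sum hu hv
  filter_upwards [hv, ae_all_le hD] with x hx hDx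
  simp only [linearization, diffOp]
  rw [hx, map_sum, Finset.sum_add_distrib, Finset.sum_comm]
  congr 1
  refine Finset.sum_congr rfl fun i hi => ?_
  rw [hDx i (Finset.mem_Icc.1 hi).2, map_sum]

lemma memLp_linearization (S : PeriodicSystem 𝔽 k m T) (hT : 0 < T)
    {z u : ℝ → EuclideanSpace 𝔽 (Fin m)} (hz : MemLp z ⊤ volume) (hu : MemHk k univ u) :
    MemLp (S.linearization z u) 2 volume := by
  refine (memLp_finsetSum (Finset.range (k + 1)) (f := fun i x =>
    S.linCoeff z i x (weakDeriv i univ u x)) fun i hi => ?_).ae_eq (S.linearization_ae_eq z hu).symm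
  have hi' : i ≤ k := Nat.lt_succ_iff.1 (Finset.mem_range.1 hi)
  obtain ⟨A, hA⟩ := exists_clm_apply (S.memLp_linCoeff hT hz hi')
  have hm := hu.memLp_weakDeriv hi'
  refine (Lp.memLp (A hm.toLp)).ae_eq ((hA _).trans ?_)
  filter_upwards [hm.coeFn_toLp] with x hx
  rw [hx]

lemma coeffCLM_sub_nat_mul (S : PeriodicSystem 𝔽 k m T) {i : ℕ} (h1 : 1 ≤ i) (h2 : i ≤ k) (p : ℕ)
    (x : ℝ) : S.coeffCLM i (x - p * T) = S.coeffCLM i x := by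
  rw [coeffCLM, coeffCLM, (S.α_periodic i h1 h2).sub_nat_mul_eq p]

lemma nl_sub_nat_mul (S : PeriodicSystem 𝔽 k m T) (u : EuclideanSpace 𝔽 (Fin m)) (p : ℕ) (x : ℝ) :
    S.nl u (x - p * T) = S.nl u x := (S.nl_periodic u).sub_nat_mul_eq p

lemma nlDeriv_sub_nat_mul (S : PeriodicSystem 𝔽 k m T) (u : EuclideanSpace 𝔽 (Fin m)) (p : ℕ)
    (x : ℝ) : S.nlDeriv u (x - p * T) = S.nlDeriv u x := by
  simp only [nlDeriv, nl_sub_nat_mul]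

/-- `P` is a right inverse of `ℒ(w)` up to an error: `ℒ(w) P g` and `χ g` differ in `L²` by at most
`κ ‖g‖`, and the derivatives of `P g` of order up to `k` are bounded by `A ‖g‖`. -/
def IsParametrix (S : PeriodicSystem 𝔽 k m T) (w : ℝ → EuclideanSpace 𝔽 (Fin m)) (χ : ℝ → ℝ)
    (P : Lp (EuclideanSpace 𝔽 (Fin m)) 2 (volume : Measure ℝ) →ₗ[ℝ]
      Lp (EuclideanSpace 𝔽 (Fin m)) 2 (volume : Measure ℝ)) (A κ : ℝ) : Prop :=
  ∀ g, MemHk k univ (P g) ∧ (∀ i ≤ k, L2Norm univ (weakDeriv i univ (P g)) ≤ A * ‖g‖) ∧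
    MemLp (fun x => S.linearization w (P g) x - χ x • g x) 2 volume ∧
    L2Norm univ (fun x => S.linearization w (P g) x - χ x • g x) ≤ κ * ‖g‖

/-- Suppose that `w` is close to a translate of `Z` on the support of a slowly varying cutoff
function `ψ`. Then multiplying the translated inverse of `ℒ(Z)` by `ψ` gives an approximate right
inverse of `ℒ(w)` on functions that live where `ψ = 1`. -/
lemma exists_local_parametrix (S : PeriodicSystem 𝔽 k m T) (hT : 0 < T) {ρ Λ : ℝ}
    (hΛ : S.HasBound ρ Λ) {w Z : ℝ → EuclideanSpace 𝔽 (Fin m)} (hw : MemLp w ⊤ volume)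
    (hwρ : ∀ᵐ x, ‖w x‖ ≤ ρ) (hZρ : ∀ᵐ x, ‖Z x‖ ≤ ρ)
    {R : Lp (EuclideanSpace 𝔽 (Fin m)) 2 (volume : Measure ℝ) →ₗ[ℝ]
        Lp (EuclideanSpace 𝔽 (Fin m)) 2 (volume : Measure ℝ)} {C : ℝ} (hC : 0 ≤ C)
    (hR : ∀ g, MemHk k univ (R g) ∧ S.linearization Z (R g) =ᵐ[volume] g ∧
        ∀ i ≤ k, L2Norm univ (weakDeriv i univ (R g)) ≤ C * ‖g‖)
    (p : ℕ) {ψ χ : ℝ → ℝ} (hψ : ContDiff ℝ ∞ ψ) (hψ1 : ∀ x, |ψ x| ≤ 1) {ε δ : ℝ} (hε : 0 ≤ ε)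
    (hε1 : ε ≤ 1) (hδ : 0 ≤ δ) (hψε : ∀ q, 1 ≤ q → q ≤ k → ∀ x, |iteratedDeriv q ψ x| ≤ ε)
    (hχ : Continuous χ) (hχ1 : ∀ x, |χ x| ≤ 1) (hψχ : ∀ x, ψ x * χ x = χ x)
    (hclose : ∀ᵐ x, ψ x ≠ 0 → ‖w x - Z (x - p * T)‖ ≤ δ) :
    ∃ P : Lp (EuclideanSpace 𝔽 (Fin m)) 2 (volume : Measure ℝ) →ₗ[ℝ]
        Lp (EuclideanSpace 𝔽 (Fin m)) 2 (volume : Measure ℝ),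
      S.IsParametrix w χ P (2 ^ k * ((k + 1) * C)) (Λ * (k * 2 ^ k * ε + δ) * ((k + 1) * C)) := by
  set s : ℝ := p * T with hs
  obtain ⟨Aψ, hAψ⟩ := exists_clm_smul (EuclideanSpace 𝔽 (Fin m)) hψ.continuous hψ1
  obtain ⟨Aχ, hAχ⟩ := exists_clm_smul (EuclideanSpace 𝔽 (Fin m)) hχ hχ1
  obtain ⟨τ, hτ⟩ := exists_linear_comp_sub (EuclideanSpace 𝔽 (Fin m)) s
  obtain ⟨τ', hτ'⟩ := exists_linear_comp_sub (EuclideanSpace 𝔽 (Fin m)) (-s)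
  refine ⟨Aψ.toLinearMap ∘ₗ τ ∘ₗ R ∘ₗ τ' ∘ₗ Aχ.toLinearMap, fun g => ?_⟩
  simp only [LinearMap.comp_apply, ContinuousLinearMap.coe_coe]
  set h := τ' (Aχ g) with hh
  set v := Aψ (τ (R h)) with hv
  obtain ⟨hu, hlin, hbd⟩ := hR h
  have hnorm : ‖h‖ ≤ ‖g‖ := by
    rw [hh, (hτ' _).2]
    refine Lp.norm_le_norm_of_ae_le ?_
    filter_upwards [hAχ g] with x hx
    rw [hx, norm_smul]
    exact mul_le_of_le_one_left (norm_nonneg _) (hχ1 x)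
  let F : ℕ → ℝ → EuclideanSpace 𝔽 (Fin m) := fun l x => weakDeriv l univ (R h) (x - s)
  have hF : ∀ l ≤ k, IsWeakDeriv l univ (F 0) (F l) := fun l hl =>
    ((hu.isWeakDeriv hl).congr_univ hu.weakDeriv_zero_ae_eq.symm EventuallyEq.rfl).comp_sub s
  have hF2 : ∀ l ≤ k, MemLp (F l) 2 volume := fun l hl => memLp_comp_sub (hu.memLp_weakDeriv hl) s
  have hFn : ∑ l ∈ Finset.range (k + 1), L2Norm univ (F l) ≤ (k + 1) * C * ‖g‖ := by
    have : ∀ l ∈ Finset.range (k + 1), L2Norm univ (F l) ≤ C * ‖g‖ := by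
      intro l hl
      have hl' : l ≤ k := Nat.lt_succ_iff.1 (Finset.mem_range.1 hl)
      rw [L2Norm_comp_sub (hu.memLp_weakDeriv hl')]
      exact (hbd l hl').trans (mul_le_mul_of_nonneg_left hnorm hC)
    refine (Finset.sum_le_sum this).trans_eq ?_
    simp [mul_assoc]
  have hFm : ∀ l ∈ Finset.range (k + 1), MemLp (F l) 2 volume := fun l hl =>
    hF2 l (Nat.lt_succ_iff.1 (Finset.mem_range.1 hl))
  have hF0 : (fun x => R h (x - s)) =ᵐ[volume] F 0 := by
    filter_upwards [ae_comp_sub hu.weakDeriv_zero_ae_eq s] with x hx using hx.symm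
  have hvF : v =ᵐ[volume] fun x => ψ x • F 0 x := by
    filter_upwards [hAψ (τ (R h)), (hτ (R h)).1, hF0] with x h1 h2 h3
    rw [h1, h2, h3]
  have hleib : ∀ i ≤ k, IsWeakDeriv i univ v fun x =>
      ∑ l ∈ Finset.range (i + 1), i.choose l • iteratedDeriv (i - l) ψ x • F l x := fun i hi =>
    (IsWeakDeriv.leibniz hF hψ hi).congr_univ hvF.symm EventuallyEq.rfl
  have hD := fun i hi => weakDeriv_univ_ae_eq (hleib i hi)
  have hψB : ∀ x, ∀ q ≤ k, |iteratedDeriv q ψ x| ≤ 1 := by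
    intro x q hq
    rcases Nat.eq_zero_or_pos q with rfl | hq0
    · simpa using hψ1 x
    · exact (hψε q hq0 hq x).trans hε1
  have hest : ∀ i ≤ k, MemLp (weakDeriv i univ v) 2 volume ∧
      L2Norm univ (weakDeriv i univ v) ≤ 2 ^ k * ∑ l ∈ Finset.range (k + 1), L2Norm univ (F l) := by
    intro i hi
    have hm : AEStronglyMeasurable (weakDeriv i univ v) volume :=
      (isWeakDeriv_univ_iff.1 (isWeakDeriv_weakDeriv ⟨_, hleib i hi⟩)).2.1.aestronglyMeasurable
    refine memLp_and_L2Norm_le_of_ae_le_sum _ (by positivity) hm hFm ?_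
    filter_upwards [hD i hi] with x hx
    rw [hx]
    have := norm_leibniz_le hi (c := fun q => iteratedDeriv q ψ x) (hψB x) (fun l => F l x)
    rwa [mul_one] at this
  have hvH : MemHk k univ v := fun i hi =>
    ⟨_, isWeakDeriv_weakDeriv ⟨_, hleib i hi⟩, by simpa using (hest i hi).1⟩
  refine ⟨hvH, fun i hi => ?_, ?_⟩
  · refine (hest i hi).2.trans ?_
    rw [mul_assoc]
    exact mul_le_mul_of_nonneg_left hFn (by positivity)
  -- the equation for the translated inverse
  have heq : ∀ᵐ x, S.linearization Z (R h) (x - s) = χ x • g x := by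
    have h1 : ∀ᵐ x, h (x - s) = Aχ g x := by
      filter_upwards [ae_comp_sub (hτ' (Aχ g)).1 s] with x hx
      rw [hx, sub_neg_eq_add, sub_add_cancel]
    filter_upwards [ae_comp_sub hlin s, h1, hAχ g] with x h1 h2 h3
    rw [h1, h2, h3]
  have hmeas : AEStronglyMeasurable (fun x => S.linearization w v x - χ x • g x) volume :=
    (S.memLp_linearization hT hw hvH).1.sub (hχ.aestronglyMeasurable.smul (Lp.memLp g).1)
  have hΛ0 := hΛ.nonneg
  have hfin := memLp_and_L2Norm_le_of_ae_le_sum (Finset.range (k + 1)) (G := F)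
    (c := Λ * (k * 2 ^ k * ε + δ)) (by positivity) hmeas hFm ?_
  · refine ⟨hfin.1, hfin.2.trans ?_⟩
    rw [mul_assoc (Λ * _)]
    exact mul_le_mul_of_nonneg_left hFn (by positivity)
  filter_upwards [heq, hvF, ae_all_le hD, hF0, hwρ, ae_comp_sub hZρ s, hclose] with
    x heq hvx hDx hF0x hwx hZx hclx
  set σ := ∑ l ∈ Finset.range (k + 1), ‖F l x‖
  have hF0le : ‖F 0 x‖ ≤ σ :=
    Finset.single_le_sum (f := fun l => ‖F l x‖) (fun _ _ => norm_nonneg _) (by simp)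
  have hsplit : S.linearization w v x - χ x • g x =
      (∑ i ∈ Finset.Icc 1 k, S.coeffCLM i x (∑ l ∈ Finset.range (i + 1),
        i.choose l • iteratedDeriv (i - l) ψ x • F l x - iteratedDeriv 0 ψ x • F i x)) +
      (S.nlDeriv (w x) x - S.nlDeriv (Z (x - s)) x) (ψ x • F 0 x) := by
    have e1 : χ x • g x = ψ x • S.linearization Z (R h) (x - s) := by
      rw [heq, smul_smul, hψχ]
    have e2 : S.linearization Z (R h) (x - s) = (∑ i ∈ Finset.Icc 1 k, S.coeffCLM i x (F i x)) +
        S.nlDeriv (Z (x - s)) x (F 0 x) := by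
      have e3 : S.linearization Z (R h) (x - s) =
          (∑ i ∈ Finset.Icc 1 k, S.coeffCLM i (x - s) (F i x)) +
          S.nlDeriv (Z (x - s)) (x - s) (R h (x - s)) := rfl
      rw [e3, hF0x, hs, S.nlDeriv_sub_nat_mul]
      congr 1
      refine Finset.sum_congr rfl fun i hi => ?_
      rw [S.coeffCLM_sub_nat_mul (Finset.mem_Icc.1 hi).1 (Finset.mem_Icc.1 hi).2]
    have e4 : S.linearization w v x =
        (∑ i ∈ Finset.Icc 1 k, S.coeffCLM i x (weakDeriv i univ v x)) +
        S.nlDeriv (w x) x (v x) := rfl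
    rw [e1, e2, e4, hvx, smul_add, Finset.smul_sum, sub_apply,
      (S.nlDeriv (Z (x - s)) x).map_smul_of_tower, add_sub_add_comm, ← Finset.sum_sub_distrib]
    congr 1
    refine Finset.sum_congr rfl fun i hi => ?_
    rw [hDx i (Finset.mem_Icc.1 hi).2, map_sub, iteratedDeriv_zero,
      (S.coeffCLM i x).map_smul_of_tower]
  rw [hsplit]
  have b1 : ‖∑ i ∈ Finset.Icc 1 k, S.coeffCLM i x (∑ l ∈ Finset.range (i + 1),
      i.choose l • iteratedDeriv (i - l) ψ x • F l x - iteratedDeriv 0 ψ x • F i x)‖ ≤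
      ∑ i ∈ Finset.Icc 1 k, Λ * (2 ^ k * ε * σ) := by
    refine (norm_sum_le _ _).trans (Finset.sum_le_sum fun i hi => ?_)
    obtain ⟨h1, h2⟩ := Finset.mem_Icc.1 hi
    refine ((S.coeffCLM i x).le_opNorm _).trans (mul_le_mul (hΛ.coeff i h1 h2 x) ?_
      (norm_nonneg _) hΛ0)
    exact norm_leibniz_sub_le h2 (c := fun q => iteratedDeriv q ψ x) hε
      (fun q hq1 hq => hψε q hq1 hq x) (fun l => F l x)
  have b2 : ‖(S.nlDeriv (w x) x - S.nlDeriv (Z (x - s)) x) (ψ x • F 0 x)‖ ≤ Λ * δ * σ := by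
    by_cases hψ0 : ψ x = 0
    · rw [hψ0, zero_smul, map_zero, norm_zero]; positivity
    · refine (ContinuousLinearMap.le_opNorm _ _).trans (mul_le_mul ?_ ?_ (norm_nonneg _)
        (by positivity))
      · exact (hΛ.deriv_lip _ _ x hwx hZx).trans (mul_le_mul_of_nonneg_left (hclx hψ0) hΛ0)
      · rw [norm_smul]
        exact (mul_le_of_le_one_left (norm_nonneg _) (hψ1 x)).trans hF0le
  refine (norm_add_le _ _).trans ((add_le_add b1 b2).trans_eq ?_)
  rw [Finset.sum_const, Nat.card_Icc, Nat.add_sub_cancel, nsmul_eq_mul]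
  ring

/-- Parametrices that are adapted to the members of a partition of unity add up to a global one. -/
lemma exists_parametrix_of_sum_eq_one (S : PeriodicSystem 𝔽 k m T)
    {w : ℝ → EuclideanSpace 𝔽 (Fin m)} (s : Finset ℕ) {χ : ℕ → ℝ → ℝ}
    (hχ : ∀ x, ∑ j ∈ s, χ j x = 1) {A κ : ℝ}
    (h : ∀ j ∈ s, ∃ P, S.IsParametrix w (χ j) P A κ) :
    ∃ P, S.IsParametrix w (fun _ => 1) P (s.card * A) (s.card * κ) := by
  choose! P hP using h
  refine ⟨∑ j ∈ s, P j, fun g => ?_⟩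
  have hsum : (∑ j ∈ s, P j) g =ᵐ[volume] fun x => ∑ j ∈ s, P j g x := by
    rw [LinearMap.sum_apply]
    filter_upwards [Lp.coeFn_finsetSum s fun j => P j g] with x hx
    rw [hx, Finset.sum_apply]
  have hH : ∀ j ∈ s, MemHk k univ (P j g) := fun j hj => (hP j hj g).1
  obtain ⟨h1, h2⟩ := memHk_of_ae_eq_sum hH hsum
  have h3 := S.linearization_congr_sum w hH hsum
  refine ⟨h1, fun i hi => ?_, ?_⟩
  · have hm : ∀ j ∈ s, MemLp (weakDeriv i univ (P j g)) 2 volume := fun j hj =>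
      (hH j hj).memLp_weakDeriv hi
    have h4 := memLp_and_L2Norm_le_of_ae_le_sum s zero_le_one (h1.memLp_weakDeriv hi).1 hm (by
      filter_upwards [h2 i hi] with x hx
      rw [hx, one_mul]
      exact norm_sum_le _ _)
    refine h4.2.trans ?_
    rw [one_mul, mul_assoc, ← nsmul_eq_mul]
    exact Finset.sum_le_card_nsmul _ _ _ fun j hj => (hP j hj g).2.1 i hi
  · have hm : ∀ j ∈ s, MemLp (fun x => S.linearization w (P j g) x - χ j x • g x) 2 volume :=
      fun j hj => (hP j hj g).2.2.1
    have he : (fun x => S.linearization w ((∑ j ∈ s, P j) g) x - (1 : ℝ) • g x) =ᵐ[volume]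
        fun x => ∑ j ∈ s, (S.linearization w (P j g) x - χ j x • g x) := by
      filter_upwards [h3] with x hx
      rw [hx, Finset.sum_sub_distrib, ← Finset.sum_smul, hχ]
    have h4 := memLp_and_L2Norm_le_of_ae_le_sum s zero_le_one
      ((memLp_finsetSum s hm).ae_eq he.symm).1 hm (by
      filter_upwards [he] with x hx
      rw [hx, one_mul]
      exact norm_sum_le _ _)
    refine ⟨h4.1, h4.2.trans ?_⟩
    rw [one_mul, mul_assoc, ← nsmul_eq_mul]
    exact Finset.sum_le_card_nsmul _ _ _ fun j hj => (hP j hj g).2.2.2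

end PeriodicSystem

/-! ### Solving the nonlinear equation -/

section

lemma exists_fixedPoint_of_contraction {X : Type*} [NormedAddCommGroup X] [CompleteSpace X]
    {Φ : X → X} {r : ℝ} (hΦ : ∀ a b, ‖a‖ ≤ r → ‖b‖ ≤ r → ‖Φ a - Φ b‖ ≤ 1 / 2 * ‖a - b‖)
    (h0 : 2 * ‖Φ 0‖ ≤ r) : ∃ a, ‖a‖ ≤ 2 * ‖Φ 0‖ ∧ Φ a = a := by
  have hr : 0 ≤ r := (by positivity : 0 ≤ 2 * ‖Φ 0‖).trans h0
  have hmaps : MapsTo Φ (Metric.closedBall 0 r) (Metric.closedBall 0 r) := by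
    intro a ha
    rw [mem_closedBall_zero_iff] at *
    have h1 := hΦ a 0 ha (by simpa using hr)
    have h2 : ‖Φ a‖ ≤ ‖Φ a - Φ 0‖ + ‖Φ 0‖ := by
      simpa using norm_add_le (Φ a - Φ 0) (Φ 0)
    rw [sub_zero] at h1
    linarith
  have hcontr : ContractingWith (1 / 2) (hmaps.restrict Φ _ _) := by
    refine ⟨by rw [← NNReal.coe_lt_coe]; norm_num, LipschitzWith.of_dist_le_mul fun a b => ?_⟩
    have := hΦ a b (mem_closedBall_zero_iff.1 a.2) (mem_closedBall_zero_iff.1 b.2)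
    rw [Subtype.dist_eq, Subtype.dist_eq, dist_eq_norm, dist_eq_norm]
    simpa using this
  obtain ⟨a, ha, hfix, -⟩ := hcontr.exists_fixedPoint' Metric.isClosed_closedBall.isComplete hmaps
    (x := 0) (by simpa using hr) (edist_ne_top _ _)
  refine ⟨a, ?_, hfix⟩
  have h1 := hΦ a 0 (by simpa using ha) (by simpa using hr)
  have h2 : ‖a‖ ≤ ‖Φ a - Φ 0‖ + ‖Φ 0‖ := by
    have := norm_add_le (Φ a - Φ 0) (Φ 0)
    rw [sub_add_cancel, hfix.eq] at this
    rwa [hfix.eq]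
  rw [sub_zero] at h1
  linarith

variable {E : Type*} [NormedAddCommGroup E] [NormedSpace ℝ E]

lemma L2Norm_weakDeriv_le_HkNorm {k i : ℕ} (hi : i ≤ k) (Ω : Set ℝ) (f : ℝ → E) :
    L2Norm Ω (weakDeriv i Ω f) ≤ HkNorm k Ω f := by
  refine Real.le_sqrt_of_sq_le ?_
  exact Finset.single_le_sum (f := fun i => L2Norm Ω (weakDeriv i Ω f) ^ 2)
    (fun _ _ => sq_nonneg _) (Finset.mem_range.2 (by omega))

lemma HkNorm_le_of_forall_le {k : ℕ} {Ω : Set ℝ} {f : ℝ → E} {B : ℝ}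
    (h : ∀ i ≤ k, L2Norm Ω (weakDeriv i Ω f) ≤ B) : HkNorm k Ω f ≤ (k + 1) * B := by
  have hB : 0 ≤ B := (L2Norm_nonneg _ _).trans (h 0 (Nat.zero_le k))
  refine Real.sqrt_le_iff.2 ⟨by positivity, ?_⟩
  have : ∑ i ∈ Finset.range (k + 1), L2Norm Ω (weakDeriv i Ω f) ^ 2 ≤ (k + 1) * B ^ 2 := by
    refine (Finset.sum_le_card_nsmul _ _ (B ^ 2) fun i hi => ?_).trans_eq (by simp)
    exact pow_le_pow_left₀ (L2Norm_nonneg _ _)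
      (h i (Nat.lt_succ_iff.1 (Finset.mem_range.1 hi))) 2
  refine this.trans ?_
  rw [mul_pow]
  refine mul_le_mul_of_nonneg_right ?_ (sq_nonneg B)
  nlinarith [k.cast_nonneg (α := ℝ)]

lemma HkNorm_nonneg (k : ℕ) (Ω : Set ℝ) (f : ℝ → E) : 0 ≤ HkNorm k Ω f := Real.sqrt_nonneg _

variable [CompleteSpace E]

lemma MemHk.add_memHkLoc {k : ℕ} {f g : ℝ → E} (hf : MemHk k univ f) (hg : MemHkLoc k g) :
    MemHkLoc k (fun x => g x + f x) := by
  intro i hi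
  obtain ⟨g', h1, h2⟩ := hg i hi
  exact ⟨_, h1.add (hf.isWeakDeriv hi), fun R => (h2 R).add ((hf.memLp_weakDeriv hi).restrict _)⟩

omit [CompleteSpace E] in
lemma MemHkLoc.isWeakDeriv {k : ℕ} {f : ℝ → E} (hf : MemHkLoc k f) {i : ℕ} (hi : i ≤ k) :
    IsWeakDeriv i univ f (weakDeriv i univ f) :=
  isWeakDeriv_weakDeriv ((hf i hi).imp fun _ h => h.1)

lemma MemHk.L2Norm_eq {k : ℕ} {f : ℝ → E} (hf : MemHk k univ f) :
    L2Norm univ f = L2Norm univ (weakDeriv 0 univ f) :=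
  L2Norm_univ_congr hf.weakDeriv_zero_ae_eq.symm

end

namespace PeriodicSystem

variable {𝔽 : Type} [RCLike 𝔽] {k m : ℕ} {T : ℝ}

lemma diffOp_add_ae_eq (S : PeriodicSystem 𝔽 k m T) {w a : ℝ → EuclideanSpace 𝔽 (Fin m)}
    (hw : MemHkLoc k w) (ha : MemHk k univ a) :
    S.diffOp (fun x => w x + a x) =ᵐ[volume] fun x => S.diffOp w x + S.diffOp a x := by
  have h : ∀ i ≤ k, ∀ᵐ x, weakDeriv i univ (fun x => w x + a x) x =
      weakDeriv i univ w x + weakDeriv i univ a x := fun i hi =>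
    weakDeriv_univ_ae_eq ((hw.isWeakDeriv hi).add (ha.isWeakDeriv hi))
  filter_upwards [ae_all_le h] with x hx
  simp only [diffOp]
  rw [← Finset.sum_add_distrib]
  refine Finset.sum_congr rfl fun i hi => ?_
  rw [hx i (Finset.mem_Icc.1 hi).2, map_add]

/-- A quantitative existence result: if `ℒ(w)` has an approximate right inverse `P` and the
residual of `w` is small, then there is a solution near `w`. The correction has the form `P g`
where `g ∈ L²(ℝ)` is a fixed point of `g ↦ g - (A (w + P g) + 𝒩(w + P g, ·))`. -/
lemma exists_solution_of_parametrix (S : PeriodicSystem 𝔽 k m T) (hk : 1 ≤ k)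
    {ρ Λ : ℝ} (hΛ : S.HasBound (ρ + 1) Λ) {w : ℝ → EuclideanSpace 𝔽 (Fin m)}
    (hw : MemHkLoc k w) (hwm : AEStronglyMeasurable w volume) (hwρ : ∀ᵐ x, ‖w x‖ ≤ ρ)
    {P : Lp (EuclideanSpace 𝔽 (Fin m)) 2 (volume : Measure ℝ) →ₗ[ℝ]
      Lp (EuclideanSpace 𝔽 (Fin m)) 2 (volume : Measure ℝ)} {A : ℝ} (hA : 0 ≤ A)
    (hP : S.IsParametrix w (fun _ => 1) P A (1 / 4)) {c : ℝ} (hc : 0 ≤ c)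
    (hsob : ∀ f g : ℝ → EuclideanSpace 𝔽 (Fin m), IsWeakDeriv 1 univ f g →
      MemLp f 2 volume → MemLp g 2 volume → ∀ (Ω : Set ℝ),
      ∀ᵐ x, Icc (x - 1) (x + 1) ⊆ Ω → ‖f x‖ ≤ c * (L2Norm Ω f + L2Norm Ω g))
    {r : ℝ} (hr : 0 ≤ r) (hr1 : c * (2 * A * r) ≤ 1) (hr2 : Λ * (c * (2 * A * r)) * A ≤ 1 / 4)
    (hres : MemLp (fun x => S.diffOp w x + S.nl (w x) x) 2 volume)
    (hres2 : 2 * L2Norm univ (fun x => S.diffOp w x + S.nl (w x) x) ≤ r) :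
    ∃ a, MemHk k univ a ∧ S.IsSolution (fun x => w x + a x) ∧ ∀ i ≤ k,
      L2Norm univ (weakDeriv i univ a) ≤
        2 * A * L2Norm univ (fun x => S.diffOp w x + S.nl (w x) x) := by
  set σ := c * (2 * A * r) with hσ
  have hσ0 : 0 ≤ σ := by positivity
  have hΛ0 := hΛ.nonneg
  have hPn : ∀ g, ‖P g‖ ≤ A * ‖g‖ := fun g => by
    rw [← L2Norm_univ_Lp, (hP g).1.L2Norm_eq]
    exact (hP g).2.1 0 (Nat.zero_le k)
  have hPσ : ∀ g, ‖g‖ ≤ r → ∀ᵐ x, ‖P g x‖ ≤ σ := by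
    intro g hg
    have h1 := (hP g).1
    filter_upwards [hsob (P g) _ (h1.isWeakDeriv_one hk) h1.memLp (h1.memLp_weakDeriv hk) univ]
      with x hx
    refine (hx (subset_univ _)).trans (mul_le_mul_of_nonneg_left ?_ hc)
    have h2 : L2Norm univ (P g) ≤ A * r := by
      rw [L2Norm_univ_Lp]
      exact (hPn g).trans (mul_le_mul_of_nonneg_left hg hA)
    have h3 := ((hP g).2.1 1 hk).trans (mul_le_mul_of_nonneg_left hg hA)
    linarith
  -- the quadratic remainder
  have hQ : ∀ g, ∃ q : Lp (EuclideanSpace 𝔽 (Fin m)) 2 (volume : Measure ℝ), ‖g‖ ≤ r →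
      q =ᵐ[volume] fun x => S.nl (w x + P g x) x - S.nl (w x) x - S.nlDeriv (w x) x (P g x) := by
    intro g
    by_cases hg : ‖g‖ ≤ r
    · have hPm : AEStronglyMeasurable (P g) volume := (Lp.memLp (P g)).1
      have hm : AEStronglyMeasurable (fun x => S.nl (w x + P g x) x - S.nl (w x) x -
          S.nlDeriv (w x) x (P g x)) volume :=
        ((S.aestronglyMeasurable_nl (hwm.add hPm)).sub (S.aestronglyMeasurable_nl hwm)).sub
          ((ContinuousLinearMap.id 𝔽 (EuclideanSpace 𝔽 (Fin m) →L[𝔽] _)).aestronglyMeasurable_comp₂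
            (S.aestronglyMeasurable_nlDeriv hwm) hPm)
      have hmem : MemLp (fun x => S.nl (w x + P g x) x - S.nl (w x) x -
          S.nlDeriv (w x) x (P g x)) 2 volume := by
        refine (Lp.memLp (P g)).of_le_mul (c := Λ * σ) hm ?_
        filter_upwards [hwρ, hPσ g hg] with x h1 h2
        simpa using hΛ.remainder (σ := σ) x (by linarith : ‖w x‖ + σ ≤ ρ + 1) h2
          (by simpa using hσ0 : ‖(0 : EuclideanSpace 𝔽 (Fin m))‖ ≤ σ)
      exact ⟨hmem.toLp, fun _ => hmem.coeFn_toLp⟩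
    · exact ⟨0, fun h => absurd h hg⟩
  choose Q hQ using hQ
  have hQlip : ∀ g₁ g₂, ‖g₁‖ ≤ r → ‖g₂‖ ≤ r → ‖Q g₁ - Q g₂‖ ≤ 1 / 4 * ‖g₁ - g₂‖ := by
    intro g₁ g₂ h1 h2
    have h3 : ‖Q g₁ - Q g₂‖ ≤ Λ * σ * ‖P g₁ - P g₂‖ := by
      refine Lp.norm_le_mul_norm_of_ae_le_mul ?_
      filter_upwards [hwρ, hPσ g₁ h1, hPσ g₂ h2, hQ g₁ h1, hQ g₂ h2, Lp.coeFn_sub (Q g₁) (Q g₂),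
        Lp.coeFn_sub (P g₁) (P g₂)] with x a1 a2 a3 a4 a5 a6 a7
      rw [a6, a7, Pi.sub_apply, Pi.sub_apply, a4, a5]
      refine le_of_eq_of_le (congrArg _ ?_)
        (hΛ.remainder (σ := σ) x (by linarith : ‖w x‖ + σ ≤ ρ + 1) a2 a3)
      rw [map_sub]; abel
    rw [← map_sub] at h3
    calc ‖Q g₁ - Q g₂‖ ≤ Λ * σ * (A * ‖g₁ - g₂‖) :=
          h3.trans (mul_le_mul_of_nonneg_left (hPn _) (by positivity))
      _ = Λ * σ * A * ‖g₁ - g₂‖ := by ring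
      _ ≤ _ := mul_le_mul_of_nonneg_right hr2 (norm_nonneg _)
  have hQ0 : Q 0 = 0 := by
    have h1 : ‖(0 : Lp (EuclideanSpace 𝔽 (Fin m)) 2 (volume : Measure ℝ))‖ ≤ r := by simpa using hr
    refine Lp.ext ?_
    filter_upwards [hQ 0 h1, Lp.coeFn_zero (EuclideanSpace 𝔽 (Fin m)) 2 (volume : Measure ℝ)]
      with x a1 a2
    have a2' : (P 0 : Lp (EuclideanSpace 𝔽 (Fin m)) 2 (volume : Measure ℝ)) x = 0 := by
      rw [map_zero, a2]; rfl
    rw [a1, a2', a2]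
    simp
  -- the error of the parametrix
  let D : Lp (EuclideanSpace 𝔽 (Fin m)) 2 (volume : Measure ℝ) →
      Lp (EuclideanSpace 𝔽 (Fin m)) 2 (volume : Measure ℝ) := fun g => (hP g).2.2.1.toLp
  have hDcoe : ∀ g, D g =ᵐ[volume] fun x => S.linearization w (P g) x - g x := fun g => by
    filter_upwards [(hP g).2.2.1.coeFn_toLp] with x hx
    rw [show D g x = _ from hx, one_smul]
  have hDn : ∀ g, ‖D g‖ ≤ 1 / 4 * ‖g‖ := fun g => by
    rw [Lp.norm_toLp, ← L2Norm_univ]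
    exact (hP g).2.2.2
  have hDsub : ∀ g₁ g₂, D g₁ - D g₂ = D (g₁ - g₂) := by
    intro g₁ g₂
    refine Lp.ext ?_
    have hadd : P g₁ =ᵐ[volume] fun x => ∑ j ∈ (Finset.univ : Finset (Fin 2)),
        ![(P g₂ : ℝ → _), P (g₁ - g₂)] j x := by
      filter_upwards [Lp.coeFn_sub (P g₁) (P g₂)] with x hx
      rw [Fin.sum_univ_two]
      simp only [Matrix.cons_val_zero, Matrix.cons_val_one, map_sub]
      rw [hx, Pi.sub_apply]; abel
    have hlin := S.linearization_congr_sum w (fun j _ => by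
      fin_cases j
      · exact (hP g₂).1
      · exact (hP (g₁ - g₂)).1) hadd
    filter_upwards [hlin, hDcoe g₁, hDcoe g₂, hDcoe (g₁ - g₂), Lp.coeFn_sub (D g₁) (D g₂),
      Lp.coeFn_sub g₁ g₂] with x a1 a2 a3 a4 a5 a6
    rw [Fin.sum_univ_two] at a1
    simp only [Matrix.cons_val_zero, Matrix.cons_val_one] at a1
    rw [a5, Pi.sub_apply, a2, a3, a4, a6, Pi.sub_apply, a1]
    abel
  have hD0 : D 0 = 0 := by
    have := hDn 0
    rw [norm_zero, mul_zero] at this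
    exact norm_le_zero_iff.1 this
  let Φ : Lp (EuclideanSpace 𝔽 (Fin m)) 2 (volume : Measure ℝ) →
      Lp (EuclideanSpace 𝔽 (Fin m)) 2 (volume : Measure ℝ) := fun g => -(hres.toLp + D g + Q g)
  have hΦ0 : ‖Φ 0‖ = L2Norm univ (fun x => S.diffOp w x + S.nl (w x) x) := by
    simp only [Φ, hD0, hQ0, add_zero, norm_neg]
    rw [Lp.norm_toLp, L2Norm_univ]
  obtain ⟨g, hg, hfix⟩ := exists_fixedPoint_of_contraction (Φ := Φ) (r := r) (fun a b ha hb => by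
    have e : Φ a - Φ b = -(D (a - b) + (Q a - Q b)) := by
      rw [← hDsub]; simp only [Φ]; abel
    rw [e, norm_neg]
    have h1 := hDn (a - b)
    have h2 := hQlip a b ha hb
    linarith [norm_add_le (D (a - b)) (Q a - Q b)]) (by rw [hΦ0]; exact hres2)
  rw [hΦ0] at hg
  have hgr : ‖g‖ ≤ r := hg.trans hres2
  refine ⟨P g, (hP g).1, ⟨(hP g).1.add_memHkLoc hw, ?_⟩, fun i hi => ?_⟩
  · filter_upwards [S.diffOp_add_ae_eq hw (hP g).1, hDcoe g, hQ g hgr, hres.coeFn_toLp,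
      Lp.coeFn_add (hres.toLp + D g) (Q g), Lp.coeFn_add hres.toLp (D g),
      Lp.coeFn_neg (hres.toLp + D g + Q g)] with x a1 a2 a3 a4 a5 a6 a7
    have e : g x = -((S.diffOp w x + S.nl (w x) x) + (S.linearization w (P g) x - g x) +
        (S.nl (w x + P g x) x - S.nl (w x) x - S.nlDeriv (w x) x (P g x))) := by
      conv_lhs => rw [← hfix]
      simp only [Φ]
      rw [a7, Pi.neg_apply, a5, Pi.add_apply, a6, Pi.add_apply, a4, a2, a3]
    have e2 : S.linearization w (P g) x = S.diffOp (P g) x + S.nlDeriv (w x) x (P g x) := rfl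
    rw [e2] at e
    rw [a1]
    have e3 : ∀ a b c d n g : EuclideanSpace 𝔽 (Fin m),
        g = -((a + b) + (c + d - g) + (n - b - d)) → a + c + n = 0 := by
      intro a b c d n g h
      refine sub_eq_self.1 (Eq.trans ?_ h.symm)
      abel
    exact e3 _ _ _ _ _ _ e
  · refine ((hP g).2.1 i hi).trans ?_
    calc A * ‖g‖ ≤ A * (2 * L2Norm univ (fun x => S.diffOp w x + S.nl (w x) x)) :=
          mul_le_mul_of_nonneg_left hg hA
      _ = _ := by ring

end PeriodicSystem

/-! ### Concatenations of fronts -/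

section Fronts

variable {E : Type*} [NormedAddCommGroup E] [NormedSpace ℝ E]

/-- A family of functions `Z₁, …, Z_M` that approach periodic end states, such that the right end
state of `Z_j` is the left end state of `Z_{j+1}`. -/
structure IsFrontFamily (k M : ℕ) (T : ℝ) (χm χp : ℝ → ℝ) (Z vm vp : ℕ → ℝ → E) : Prop where
  cutoff : IsCutoffPair χm χp
  loc : ∀ j ∈ Finset.Icc 1 M, MemHkLoc k (Z j)
  per_m : ∀ j ∈ Finset.Icc 1 M, MemHkPer k T (vm j)
  per_p : ∀ j ∈ Finset.Icc 1 M, MemHkPer k T (vp j)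
  tail_m : ∀ j ∈ Finset.Icc 1 M, MemHk k univ fun x => χm x • (Z j x - vm j x)
  tail_p : ∀ j ∈ Finset.Icc 1 M, MemHk k univ fun x => χp x • (Z j x - vp j x)
  matching : ∀ j, 1 ≤ j → j < M → vp j =ᵐ[volume] vm (j + 1)

lemma L2Norm_weakDeriv_univ_le_HkNorm [CompleteSpace E] {k l : ℕ} (hl : l ≤ k) {Ω : Set ℝ}
    (hΩ : IsOpen Ω) {f : ℝ → E} (hf : MemHk k univ f) :
    L2Norm Ω (weakDeriv l univ f) ≤ HkNorm k Ω f := by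
  rw [← L2Norm_congr (weakDeriv_ae_eq hΩ ((hf.isWeakDeriv hl).mono (subset_univ Ω)))]
  exact L2Norm_weakDeriv_le_HkNorm hl Ω f

lemma weakDeriv_sub_ae_eq_of_eq_one [CompleteSpace E] {k l : ℕ} (hl : l ≤ k) {θ : ℝ → ℝ}
    {Ω : Set ℝ} (hΩ : IsOpen Ω) (hθ : ∀ y ∈ Ω, θ y = 1) {Z v : ℝ → E} (hZ : MemHkLoc k Z)
    (hv : MemHkLoc k v) (h : MemHk k univ fun x => θ x • (Z x - v x)) :
    ∀ᵐ y, y ∈ Ω → weakDeriv l univ Z y - weakDeriv l univ v y =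
      weakDeriv l univ (fun x => θ x • (Z x - v x)) y := by
  rw [← ae_restrict_iff' hΩ.measurableSet]
  refine (((hZ.isWeakDeriv hl).sub (hv.isWeakDeriv hl)).mono (subset_univ Ω)).ae_eq hΩ
    ((h.isWeakDeriv hl).mono (subset_univ Ω)) ?_
  filter_upwards [ae_restrict_mem hΩ.measurableSet] with y hy
  rw [hθ y hy, one_smul]

lemma MemHkPer.weakDeriv_sub_nat_mul [CompleteSpace E] {k l p : ℕ} (hl : l ≤ k) {T : ℝ}
    {v : ℝ → E} (hv : MemHkPer k T v) :
    ∀ᵐ x, weakDeriv l univ v (x - p * T) = weakDeriv l univ v x := by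
  have h := (hv.2.isWeakDeriv hl).comp_sub (p * T)
  have e : (fun x => v (x - p * T)) = v := funext fun x => hv.1.sub_nat_mul_eq p
  rw [e] at h
  filter_upwards [weakDeriv_univ_ae_eq h] with x hx using hx.symm

namespace IsFrontFamily

variable {k M : ℕ} {T : ℝ} {χm χp : ℝ → ℝ} {Z vm vp : ℕ → ℝ → E}

/-- Between two neighbouring interfaces, the difference of the two translated fronts is the
difference of their deviations from the common end state. -/
lemma interface [CompleteSpace E] (h : IsFrontFamily k M T χm χp Z vm vp) (n : ℕ) {j : ℕ}
    (hj : 1 ≤ j) (hjM : j < M) {l : ℕ} (hl : l ≤ k) :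
    ∀ᵐ x, 1 < x - j * n * T → x - (j + 1 : ℕ) * n * T < -1 →
      weakDeriv l univ (Z j) (x - j * n * T) -
        weakDeriv l univ (Z (j + 1)) (x - (j + 1 : ℕ) * n * T) =
      weakDeriv l univ (fun y => χp y • (Z j y - vp j y)) (x - j * n * T) -
        weakDeriv l univ (fun y => χm y • (Z (j + 1) y - vm (j + 1) y))
          (x - (j + 1 : ℕ) * n * T) := by
  have m1 : j ∈ Finset.Icc 1 M := Finset.mem_Icc.2 ⟨hj, hjM.le⟩
  have m2 : j + 1 ∈ Finset.Icc 1 M := Finset.mem_Icc.2 ⟨by omega, hjM⟩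
  have hp1 : ∀ y ∈ Ioi (1 : ℝ), χp y = 1 := fun y hy => by
    have h0 : χm y = 0 := by
      by_contra h0
      exact lt_asymm (mem_Iio.1 (h.cutoff.support_m h0)) (mem_Ioi.1 hy)
    have := h.cutoff.add_eq_one y
    rwa [h0, zero_add] at this
  have hm1 : ∀ y ∈ Iio (-1 : ℝ), χm y = 1 := fun y hy => by
    have h0 : χp y = 0 := by
      by_contra h0
      exact lt_asymm (mem_Ioi.1 (h.cutoff.support_p h0)) (mem_Iio.1 hy)
    have := h.cutoff.add_eq_one y
    rwa [h0, add_zero] at this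
  have a1 := ae_comp_sub (weakDeriv_sub_ae_eq_of_eq_one hl isOpen_Ioi hp1 (h.loc j m1)
    (h.per_p j m1).2 (h.tail_p j m1)) (j * n * T)
  have a2 := ae_comp_sub (weakDeriv_sub_ae_eq_of_eq_one hl isOpen_Iio hm1 (h.loc _ m2)
    (h.per_m _ m2).2 (h.tail_m _ m2)) ((j + 1 : ℕ) * n * T)
  have a3 := (h.per_p j m1).weakDeriv_sub_nat_mul (p := j * n) hl
  have a4 := (h.per_m _ m2).weakDeriv_sub_nat_mul (p := (j + 1) * n) hl
  have a6 : weakDeriv l univ (vp j) =ᵐ[volume] weakDeriv l univ (vm (j + 1)) := by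
    simpa using ((h.per_p j m1).2.isWeakDeriv hl).ae_eq isOpen_univ
      ((h.per_m _ m2).2.isWeakDeriv hl) (by simpa using h.matching j hj hjM)
  filter_upwards [a1, a2, a3, a4, a6] with x a1 a2 a3 a4 a6 h1 h2
  rw [← a1 h1, ← a2 h2]
  rw [Nat.cast_mul] at a3 a4
  rw [a3, a4, a6]
  abel

end IsFrontFamily

lemma exists_eq_of_inCell {M : ℕ} {h r q : ℝ} (hh : 0 < h) (hr : r + h / 2 + 1 < 2 * h)
    (hq1 : q ≤ h / 2 - 1) (hq2 : q ≤ h - r) {j₀ j : ℕ} (hj₀ : j₀ ∈ Finset.Icc 1 M)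
    (hj : j ∈ Finset.Icc 1 M) (hne : j ≠ j₀) {x : ℝ} (h0 : InCell M h r j₀ x)
    (h1 : InCell M h (h / 2 + 1) j x) :
    ∃ i, 1 ≤ i ∧ i < M ∧ ((j₀ = i ∧ j = i + 1) ∨ (j = i ∧ j₀ = i + 1)) ∧ q ≤ x - i * h ∧
      x - (i + 1 : ℕ) * h ≤ -q := by
  rw [Finset.mem_Icc] at hj₀ hj
  rcases lt_or_gt_of_ne hne with hlt | hlt
  · have b1 : j₀ * h - r ≤ x := h0.1.resolve_left (by omega)
    have b2 : x ≤ j * h + (h / 2 + 1) := h1.2.resolve_left (by omega)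
    have : j₀ = j + 1 := by
      by_contra hc
      have h2 : ((j + 2 : ℕ) : ℝ) ≤ j₀ := by exact_mod_cast (by omega : j + 2 ≤ j₀)
      push_cast at h2
      nlinarith
    subst this
    refine ⟨j, hj.1, by omega, Or.inr ⟨rfl, rfl⟩, ?_, ?_⟩ <;> push_cast at * <;> linarith
  · have b1 : j * h - (h / 2 + 1) ≤ x := h1.1.resolve_left (by omega)
    have b2 : x ≤ j₀ * h + r := h0.2.resolve_left (by omega)
    have : j = j₀ + 1 := by
      by_contra hc
      have h2 : ((j₀ + 2 : ℕ) : ℝ) ≤ j := by exact_mod_cast (by omega : j₀ + 2 ≤ j)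
      push_cast at h2
      nlinarith
    subst this
    refine ⟨j₀, hj₀.1, by omega, Or.inl ⟨rfl, rfl⟩, ?_, ?_⟩ <;> push_cast at * <;> linarith

/-- Where the `j₀`-th cell meets the support of `χ_{j,n}`, the `j`-th and the `j₀`-th front are
close to each other. -/
lemma IsFrontFamily.norm_sub_le [CompleteSpace E] {k M : ℕ} {T : ℝ} {χm χp : ℝ → ℝ}
    {Z vm vp : ℕ → ℝ → E} (h : IsFrontFamily k M T χm χp Z vm vp) (n : ℕ) {r q : ℝ}
    (hh : 0 < n * T) (hr : r + (n * T) / 2 + 1 < 2 * (n * T)) (hq : 1 < q)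
    (hq1 : q ≤ (n * T) / 2 - 1) (hq2 : q ≤ n * T - r) :
    ∀ᵐ x, ∀ j₀ ∈ Finset.Icc 1 M, ∀ j ∈ Finset.Icc 1 M, j ≠ j₀ → InCell M (n * T) r j₀ x →
      InCell M (n * T) ((n * T) / 2 + 1) j x →
      ∃ i, 1 ≤ i ∧ i < M ∧ q ≤ x - i * n * T ∧ x - (i + 1 : ℕ) * n * T ≤ -q ∧
        ∀ l ≤ k, ‖weakDeriv l univ (Z j) (x - j * n * T) -
            weakDeriv l univ (Z j₀) (x - j₀ * n * T)‖ ≤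
          ‖weakDeriv l univ (fun y => χp y • (Z i y - vp i y)) (x - i * n * T)‖ +
          ‖weakDeriv l univ (fun y => χm y • (Z (i + 1) y - vm (i + 1) y))
            (x - (i + 1 : ℕ) * n * T)‖ := by
  have key : ∀ i : ℕ, ∀ᵐ x, 1 ≤ i → i < M → ∀ l ≤ k, 1 < x - i * n * T →
      x - (i + 1 : ℕ) * n * T < -1 →
      weakDeriv l univ (Z i) (x - i * n * T) -
        weakDeriv l univ (Z (i + 1)) (x - (i + 1 : ℕ) * n * T) =
      weakDeriv l univ (fun y => χp y • (Z i y - vp i y)) (x - i * n * T) -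
        weakDeriv l univ (fun y => χm y • (Z (i + 1) y - vm (i + 1) y))
          (x - (i + 1 : ℕ) * n * T) := by
    intro i
    by_cases hi : 1 ≤ i ∧ i < M
    · filter_upwards [ae_all_le fun l hl => h.interface n hi.1 hi.2 hl] with x hx _ _ using hx
    · exact Eventually.of_forall fun x h1 h2 => absurd ⟨h1, h2⟩ hi
  filter_upwards [ae_all_iff.2 key] with x hx j₀ hj₀ j hj hne h0 h1
  obtain ⟨i, hi1, hiM, hcase, b1, b2⟩ := exists_eq_of_inCell hh hr hq1 hq2 hj₀ hj hne h0 h1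
  rw [← mul_assoc] at b1 b2
  refine ⟨i, hi1, hiM, b1, b2, fun l hl => ?_⟩
  have e := hx i hi1 hiM l hl (by linarith) (by linarith)
  rcases hcase with ⟨rfl, rfl⟩ | ⟨rfl, rfl⟩
  · rw [norm_sub_rev, e]
    exact _root_.norm_sub_le _ _
  · rw [e]
    exact _root_.norm_sub_le _ _

/-! ### Partitions of unity adapted to the interfaces -/

lemma isClosed_inCell (M : ℕ) (h r : ℝ) (j : ℕ) : IsClosed {x | InCell M h r j x} := by
  have h1 : IsClosed {x : ℝ | j = 1 ∨ j * h - r ≤ x} := by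
    by_cases hj : j = 1
    · simp [hj]
    · simp only [hj, false_or]; exact isClosed_le continuous_const continuous_id
  have h2 : IsClosed {x : ℝ | j = M ∨ x ≤ j * h + r} := by
    by_cases hj : j = M
    · simp [hj]
    · simp only [hj, false_or]; exact isClosed_le continuous_id continuous_const
  exact h1.inter h2

namespace IsInterfacePartition

variable {k M n : ℕ} {T K : ℝ} {χ : ℕ → ℝ → ℝ}

lemma inCell_of_iteratedDeriv_ne_zero (hχ : IsInterfacePartition k M T K n χ) (hM : 2 ≤ M)
    {j : ℕ} (hj : j ∈ Finset.Icc 1 M) {p : ℕ} {x : ℝ} (hx : iteratedDeriv p (χ j) x ≠ 0) :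
    InCell M (n * T) ((n * T) / 2 + 1) j x := by
  have hs : Function.support (χ j) ⊆ {x | InCell M (n * T) ((n * T) / 2 + 1) j x} := by
    intro y hy
    obtain ⟨h1, h2⟩ := Finset.mem_Icc.1 hj
    rcases Nat.eq_or_lt_of_le h1 with rfl | h1
    · refine ⟨Or.inl rfl, Or.inr ?_⟩
      have := hχ.support_first hy
      rw [mem_Iio] at this
      push_cast; linarith
    · rcases Nat.eq_or_lt_of_le h2 with rfl | h2
      · refine ⟨Or.inr ?_, Or.inl rfl⟩
        have := hχ.support_last hy
        rw [mem_Ioi] at this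
        linarith
      · have := hχ.support_mid j h1 h2 hy
        exact ⟨Or.inr (by linarith [this.1]), Or.inr (by linarith [this.2])⟩
  have h2 : x ∈ tsupport (χ j) := by
    by_contra hc
    exact hx (image_eq_zero_of_notMem_tsupport fun h =>
      hc (tsupport_iteratedDeriv_subset (χ j) p h))
  exact closure_minimal hs (isClosed_inCell _ _ _ _) h2

lemma sum_iteratedDeriv (hχ : IsInterfacePartition k M T K n χ) (p : ℕ) (x : ℝ) :
    ∑ j ∈ Finset.Icc 1 M, iteratedDeriv p (χ j) x = if p = 0 then 1 else 0 := by
  have h1 : (fun x => ∑ j ∈ Finset.Icc 1 M, χ j x) = fun _ => (1 : ℝ) := funext hχ.sum_eq_one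
  have h2 := iteratedDeriv_fun_sum (n := p) (x := x) (I := Finset.Icc 1 M) (f := χ) fun j hj =>
    ((hχ.smooth j hj).of_le (by exact_mod_cast le_top)).contDiffAt
  rw [← h2, h1, iteratedDeriv_const]

end IsInterfacePartition

omit [NormedSpace ℝ E] in
lemma sum_leibniz_sub {s : Finset ℕ} [Module ℝ E] {c : ℕ → ℕ → ℝ}
    (hc : ∀ p, ∑ j ∈ s, c j p = if p = 0 then 1 else 0) (a : ℕ → ℕ → E) (b : ℕ → E) (l : ℕ) :
    ∑ j ∈ s, ∑ r ∈ Finset.range (l + 1), l.choose r • c j (l - r) • a j r - b l =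
      ∑ j ∈ s, ∑ r ∈ Finset.range (l + 1), l.choose r • c j (l - r) • (a j r - b r) := by
  have h : ∑ j ∈ s, ∑ r ∈ Finset.range (l + 1), l.choose r • c j (l - r) • b r = b l := by
    rw [Finset.sum_comm]
    simp only [← Finset.smul_sum, ← Finset.sum_smul, hc]
    rw [Finset.sum_eq_single_of_mem l (by simp)]
    · simp
    · intro r hr hne
      have : l - r ≠ 0 := by have := Finset.mem_range.1 hr; omega
      simp [this]
  simp only [smul_sub, Finset.sum_sub_distrib]
  rw [h]

/-- The weak derivatives of a formal concatenation. -/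
lemma IsInterfacePartition.isWeakDeriv_concatenation [CompleteSpace E] {k M n : ℕ} {T K : ℝ}
    {χ : ℕ → ℝ → ℝ} (hχ : IsInterfacePartition k M T K n χ) {Z : ℕ → ℝ → E}
    (hZ : ∀ j ∈ Finset.Icc 1 M, MemHkLoc k (Z j)) {l : ℕ} (hl : l ≤ k) :
    IsWeakDeriv l univ (concatenation M T n χ Z) fun x => ∑ j ∈ Finset.Icc 1 M,
      ∑ r ∈ Finset.range (l + 1), l.choose r • iteratedDeriv (l - r) (χ j) x •
        weakDeriv r univ (Z j) (x - j * n * T) := by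
  have hz : ∀ j ∈ Finset.Icc 1 M, weakDeriv 0 univ (Z j) =ᵐ[volume] Z j := fun j hj =>
    weakDeriv_zero_ae_eq (isWeakDeriv_univ_iff.1 ((hZ j hj).isWeakDeriv (Nat.zero_le k))).1
  have h := IsWeakDeriv.sum (Finset.Icc 1 M) fun j hj => IsWeakDeriv.leibniz (k := k)
    (F := fun r x => weakDeriv r univ (Z j) (x - j * n * T)) (fun i hi =>
      (((hZ j hj).isWeakDeriv hi).congr_univ (hz j hj).symm EventuallyEq.rfl).comp_sub
        (j * n * T)) (hχ.smooth j hj) hl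
  refine h.congr_univ ?_ EventuallyEq.rfl
  have hz' : ∀ j, ∀ᵐ x, j ∈ Finset.Icc 1 M →
      weakDeriv 0 univ (Z j) (x - j * n * T) = Z j (x - j * n * T) := fun j => by
    by_cases hj : j ∈ Finset.Icc 1 M
    · filter_upwards [ae_comp_sub (hz j hj) (j * n * T)] with x hx _ using hx
    · exact Eventually.of_forall fun x h => absurd h hj
  filter_upwards [ae_all_iff.2 hz'] with x hx
  exact Finset.sum_congr rfl fun j hj => by rw [hx j hj]

end Fronts

/-! ### The residual of a concatenation -/

section Concatenation

variable {E : Type*} [NormedAddCommGroup E] [NormedSpace ℝ E] [CompleteSpace E]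

lemma InCell.mono {M : ℕ} {h r r' : ℝ} (hr : r ≤ r') {j : ℕ} {x : ℝ} (hx : InCell M h r j x) :
    InCell M h r' j x :=
  ⟨hx.1.imp id fun h => by linarith, hx.2.imp id fun h => by linarith⟩

lemma ae_all_mem {s : Finset ℕ} {p : ℕ → ℝ → Prop} (h : ∀ j ∈ s, ∀ᵐ x, p j x) :
    ∀ᵐ x, ∀ j ∈ s, p j x :=
  (Filter.eventually_all_finset s).2 h

lemma MemHkLoc.weakDeriv_zero_ae_eq {k : ℕ} {f : ℝ → E} (h : MemHkLoc k f) :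
    weakDeriv 0 univ f =ᵐ[volume] f :=
  _root_.weakDeriv_zero_ae_eq (isWeakDeriv_univ_iff.1 (h.isWeakDeriv (Nat.zero_le k))).1

lemma memLp_comp_sub_restrict {F : Type*} [NormedAddCommGroup F] {f : ℝ → F}
    (hf : ∀ R : ℝ, MemLp f 2 (volume.restrict (Icc (-R) R))) (s R : ℝ) :
    MemLp (fun x => f (x - s)) 2 (volume.restrict (Icc (-R) R)) := by
  have h1 := (measurePreserving_sub_right (volume : Measure ℝ) s).restrict_preimage
    (measurableSet_Icc (a := -(R + |s|)) (b := R + |s|))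
  refine ((hf (R + |s|)).comp_measurePreserving h1).mono_measure (Measure.restrict_mono ?_ le_rfl)
  intro x hx
  have := abs_le.1 (le_refl |s|)
  exact ⟨by linarith [hx.1], by linarith [hx.2]⟩

lemma IsInterfacePartition.memHkLoc_concatenation {k M n : ℕ} {T K : ℝ} {χ : ℕ → ℝ → ℝ}
    (hχ : IsInterfacePartition k M T K n χ) {Z : ℕ → ℝ → E}
    (hZ : ∀ j ∈ Finset.Icc 1 M, MemHkLoc k (Z j)) : MemHkLoc k (concatenation M T n χ Z) := by
  intro l hl
  refine ⟨_, hχ.isWeakDeriv_concatenation hZ hl, fun R => ?_⟩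
  refine memLp_finsetSum _ fun j hj => memLp_finsetSum _ fun r hr => ?_
  have hr' : r ≤ k := by have := Finset.mem_range.1 hr; omega
  have hloc : ∀ R : ℝ, MemLp (weakDeriv r univ (Z j)) 2 (volume.restrict (Icc (-R) R)) := by
    intro R
    obtain ⟨g, hg, hg2⟩ := hZ j hj r hr'
    exact (hg2 R).ae_eq (ae_restrict_of_ae (weakDeriv_univ_ae_eq hg).symm)
  have hm := memLp_comp_sub_restrict hloc (j * n * T) R
  refine hm.of_le_mul (c := 2 ^ k * K) ?_ (Eventually.of_forall fun x =>
    norm_choose_smul_le hl (hχ.deriv_bound j hj (l - r) (by omega) x) _)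
  have hc : Continuous (iteratedDeriv (l - r) (χ j)) :=
    (contDiff_iteratedDeriv (hχ.smooth j hj) _).continuous
  exact (hc.aestronglyMeasurable.smul hm.1).const_smul (l.choose r)

omit [CompleteSpace E] in
lemma IsInterfacePartition.concatenation_sub {k M n : ℕ} {T K : ℝ} {χ : ℕ → ℝ → ℝ}
    (hχ : IsInterfacePartition k M T K n χ) (Z : ℕ → ℝ → E) (x : ℝ) (z : E) :
    concatenation M T n χ Z x - z =
      ∑ j ∈ Finset.Icc 1 M, χ j x • (Z j (x - j * n * T) - z) := by
  simp only [smul_sub, Finset.sum_sub_distrib, ← Finset.sum_smul, hχ.sum_eq_one, one_smul]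
  rfl

omit [CompleteSpace E] in
/-- A concatenation is, at each point, a convex combination of the translated fronts. -/
lemma IsInterfacePartition.norm_concatenation_sub_le {k M n : ℕ} {T K : ℝ} {χ : ℕ → ℝ → ℝ}
    (hχ : IsInterfacePartition k M T K n χ) {Z : ℕ → ℝ → E} {x : ℝ} {z : E} {δ : ℝ}
    (h : ∀ j ∈ Finset.Icc 1 M, χ j x ≠ 0 → ‖Z j (x - j * n * T) - z‖ ≤ δ) :
    ‖concatenation M T n χ Z x - z‖ ≤ δ := by
  rw [hχ.concatenation_sub]
  calc ‖∑ j ∈ Finset.Icc 1 M, χ j x • (Z j (x - j * n * T) - z)‖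
      ≤ ∑ j ∈ Finset.Icc 1 M, χ j x * δ := by
        refine (norm_sum_le _ _).trans (Finset.sum_le_sum fun j hj => ?_)
        have h0 := (hχ.mem_Icc j hj x).1
        rw [norm_smul, Real.norm_of_nonneg h0]
        by_cases hc : χ j x = 0
        · simp [hc]
        · exact mul_le_mul_of_nonneg_left (h j hj hc) h0
    _ = δ := by rw [← Finset.sum_mul, hχ.sum_eq_one, one_mul]

omit [CompleteSpace E] in
lemma IsInterfacePartition.ae_norm_concatenation_le {k M n : ℕ} {T K : ℝ} {χ : ℕ → ℝ → ℝ}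
    (hχ : IsInterfacePartition k M T K n χ) {Z : ℕ → ℝ → E} {ρ : ℝ}
    (hZ : ∀ j ∈ Finset.Icc 1 M, ∀ᵐ x, ‖Z j x‖ ≤ ρ) :
    ∀ᵐ x, ‖concatenation M T n χ Z x‖ ≤ ρ := by
  filter_upwards [ae_all_mem fun j hj => ae_comp_sub (hZ j hj) (j * n * T)] with x hx
  have := hχ.norm_concatenation_sub_le (z := (0 : E)) (Z := Z) (x := x) (δ := ρ)
    fun j hj _ => by simpa using hx j hj
  simpa using this

/-- On the `j₀`-th cell a concatenation is uniformly close to the `j₀`-th front if the distance of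
the interfaces is large. -/
lemma IsFrontFamily.exists_norm_concatenation_sub_le {k M : ℕ} (hk : 1 ≤ k) (hM : 2 ≤ M) {T : ℝ}
    (hT : 0 < T) {χm χp : ℝ → ℝ} {Z vm vp : ℕ → ℝ → E}
    (h : IsFrontFamily k M T χm χp Z vm vp) {δ : ℝ} (hδ : 0 < δ) :
    ∃ N : ℕ, ∀ n ≥ N, ∀ (K : ℝ) (χ : ℕ → ℝ → ℝ), IsInterfacePartition k M T K n χ →
      ∀ᵐ x, ∀ j₀ ∈ Finset.Icc 1 M, InCell M (n * T) (3 / 4 * (n * T)) j₀ x →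
        ‖concatenation M T n χ Z x - Z j₀ (x - j₀ * n * T)‖ ≤ δ := by
  have htail : ∀ f : ℝ → E, MemHk k univ f →
      ∃ R : ℝ, ∀ᵐ y, R ≤ |y| → ‖weakDeriv 0 univ f y‖ ≤ δ / 2 := by
    intro f hf
    obtain ⟨R, hR⟩ := exists_forall_ae_norm_le_of_le_abs (hf.isWeakDeriv hk) hf.memLp
      (hf.memLp_weakDeriv hk) (half_pos hδ)
    refine ⟨R, ?_⟩
    filter_upwards [hR, hf.weakDeriv_zero_ae_eq] with y h1 h2
    rwa [h2]
  have hp := fun j hj => htail _ (h.tail_p j hj)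
  have hm := fun j hj => htail _ (h.tail_m j hj)
  choose! Rp hRp using hp
  choose! Rm hRm using hm
  obtain ⟨N, hN⟩ := exists_nat_gt
    ((8 + 4 * ∑ j ∈ Finset.Icc 1 M, (|Rp j| + |Rm j|)) / T)
  refine ⟨N, fun n hn K χ hχ => ?_⟩
  have hRsum : ∀ j ∈ Finset.Icc 1 M,
      |Rp j| + |Rm j| ≤ ∑ j ∈ Finset.Icc 1 M, (|Rp j| + |Rm j|) := fun j hj =>
    Finset.single_le_sum (f := fun j => |Rp j| + |Rm j|) (fun _ _ => by positivity) hj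
  have hpos : 0 ≤ ∑ j ∈ Finset.Icc 1 M, (|Rp j| + |Rm j|) :=
    Finset.sum_nonneg fun _ _ => by positivity
  have hnT : 8 + 4 * ∑ j ∈ Finset.Icc 1 M, (|Rp j| + |Rm j|) < n * T := by
    have : (N : ℝ) ≤ n := by exact_mod_cast hn
    rw [div_lt_iff₀ hT] at hN
    nlinarith
  have hz := ae_all_mem fun j hj => ae_comp_sub (h.loc j hj).weakDeriv_zero_ae_eq (j * n * T)
  have hclose := h.norm_sub_le n (r := 3 / 4 * (n * T)) (q := n * T / 4) (by linarith)
    (by linarith) (by linarith) (by linarith) (by linarith)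
  have tp := ae_all_mem fun j hj => ae_comp_sub (hRp j hj) (j * n * T)
  have tm := ae_all_mem fun j hj => ae_comp_sub (hRm j hj) (j * n * T)
  filter_upwards [hz, hclose, tp, tm] with x hz hclose tp tm j₀ hj₀ hcell
  refine hχ.norm_concatenation_sub_le fun j hj hne => ?_
  by_cases hjj : j = j₀
  · subst hjj; simpa using hδ.le
  have hcj := hχ.inCell_of_iteratedDeriv_ne_zero hM hj (p := 0) (x := x) (by simpa using hne)
  obtain ⟨i, hi1, hiM, b1, b2, b3⟩ := hclose j₀ hj₀ j hj hjj hcell hcj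
  have mi : i ∈ Finset.Icc 1 M := Finset.mem_Icc.2 ⟨hi1, hiM.le⟩
  have mi' : i + 1 ∈ Finset.Icc 1 M := Finset.mem_Icc.2 ⟨by omega, hiM⟩
  have b4 := b3 0 (Nat.zero_le k)
  rw [hz j hj, hz j₀ hj₀] at b4
  have c1 := tp i mi (by
    refine le_trans ?_ (le_abs_self _)
    linarith [le_abs_self (Rp i), abs_nonneg (Rm i), hRsum i mi])
  have c2 := tm (i + 1) mi' (by
    refine le_trans ?_ (neg_le_abs _)
    linarith [le_abs_self (Rm (i + 1)), abs_nonneg (Rp (i + 1)), hRsum (i + 1) mi'])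
  linarith

/-- The size at `y` of the tails of the `r`-th derivatives of the deviations of the `j`-th front
from its end states. -/
def tailSize (T : ℝ) (n : ℕ) (χm χp : ℝ → ℝ) (Z vm vp : ℕ → ℝ → E) (q : ℕ × ℕ) : ℝ → ℝ :=
  (tailSet T n).indicator fun y =>
    ‖weakDeriv q.2 univ (fun y => χp y • (Z q.1 y - vp q.1 y)) y‖ +
    ‖weakDeriv q.2 univ (fun y => χm y • (Z q.1 y - vm q.1 y)) y‖

lemma IsFrontFamily.tailSize_bound {k M : ℕ} {T : ℝ} {χm χp : ℝ → ℝ} {Z vm vp : ℕ → ℝ → E}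
    (h : IsFrontFamily k M T χm χp Z vm vp) (n : ℕ) {j r : ℕ} (hj : j ∈ Finset.Icc 1 M)
    (hr : r ≤ k) :
    MemLp (tailSize T n χm χp Z vm vp (j, r)) 2 volume ∧
    L2Norm univ (tailSize T n χm χp Z vm vp (j, r)) ≤
      HkNorm k (tailSet T n) (fun y => χm y • (Z j y - vm j y)) +
      HkNorm k (tailSet T n) (fun y => χp y • (Z j y - vp j y)) := by
  have hp := (h.tail_p j hj).memLp_weakDeriv hr
  have hm := (h.tail_m j hj).memLp_weakDeriv hr
  have hmeas := (isOpen_tailSet T n).measurableSet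
  refine ⟨(hp.norm.add hm.norm).indicator hmeas, ?_⟩
  rw [tailSize, L2Norm_indicator hmeas]
  have h1 := eLpNorm_add_le (μ := volume.restrict (tailSet T n)) (p := 2)
    (hp.norm.restrict (tailSet T n)).1 (hm.norm.restrict (tailSet T n)).1 (by norm_num)
  rw [eLpNorm_norm, eLpNorm_norm] at h1
  have hp' := (hp.restrict (tailSet T n)).eLpNorm_ne_top
  have hm' := (hm.restrict (tailSet T n)).eLpNorm_ne_top
  have h2 := ENNReal.toReal_mono (ENNReal.add_ne_top.2 ⟨hp', hm'⟩) h1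
  rw [ENNReal.toReal_add hp' hm'] at h2
  have h3 := L2Norm_weakDeriv_univ_le_HkNorm hr (isOpen_tailSet T n) (h.tail_p j hj)
  have h4 := L2Norm_weakDeriv_univ_le_HkNorm hr (isOpen_tailSet T n) (h.tail_m j hj)
  refine h2.trans ?_
  rw [add_comm]
  exact add_le_add h4 h3

/-- Near the support of `χ_{j₀,n}`, the derivatives of a concatenation differ from those of the
`j₀`-th front only by tails of the fronts. -/
lemma IsFrontFamily.ae_norm_weakDeriv_concatenation_sub_le {k M : ℕ} (hM : 2 ≤ M) {T : ℝ}
    {χm χp : ℝ → ℝ} {Z vm vp : ℕ → ℝ → E} (h : IsFrontFamily k M T χm χp Z vm vp) {n : ℕ}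
    (hn : 8 ≤ n * T) {K : ℝ} (hK : 0 ≤ K) {χ : ℕ → ℝ → ℝ}
    (hχ : IsInterfacePartition k M T K n χ) :
    ∀ᵐ x, ∀ j₀ ∈ Finset.Icc 1 M, χ j₀ x ≠ 0 → ∀ l ≤ k,
      ‖weakDeriv l univ (concatenation M T n χ Z) x -
        weakDeriv l univ (Z j₀) (x - j₀ * n * T)‖ ≤
      M * ((k + 1) * (2 ^ k * K)) * ∑ q ∈ Finset.Icc 1 M ×ˢ Finset.range (k + 1),
        ‖tailSize T n χm χp Z vm vp q (x - q.1 * n * T)‖ := by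
  have hclose := h.norm_sub_le n (r := n * T / 2 + 1) (q := n * T / 2 - 1) (by linarith)
    (by linarith) (by linarith) le_rfl (by linarith)
  have hw := ae_all_le fun l hl => weakDeriv_univ_ae_eq (hχ.isWeakDeriv_concatenation h.loc hl)
  -- the end points of the tails form a null set
  have hpt : ∀ a : ℝ, ∀ᵐ y : ℝ, y ≠ a := fun a => compl_mem_ae_iff.2 (measure_singleton a)
  have hnull : ∀ᵐ x, ∀ j : ℕ, x - j * n * T ≠ n * T / 2 - 1 ∧ x - j * n * T ≠ -(n * T / 2 - 1) :=
    ae_all_iff.2 fun j => ae_comp_sub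
      ((hpt (n * T / 2 - 1)).and (hpt (-(n * T / 2 - 1)))) (j * n * T)
  filter_upwards [hclose, hw, hnull] with x hclose hw hnull j₀ hj₀ hne l hl
  set τ := ∑ q ∈ Finset.Icc 1 M ×ˢ Finset.range (k + 1),
    ‖tailSize T n χm χp Z vm vp q (x - q.1 * n * T)‖ with hτ
  have hτ0 : 0 ≤ τ := Finset.sum_nonneg fun _ _ => norm_nonneg _
  rw [hw l hl, sum_leibniz_sub (fun p => hχ.sum_iteratedDeriv p x)
    (fun j r => weakDeriv r univ (Z j) (x - j * n * T))
    (fun r => weakDeriv r univ (Z j₀) (x - j₀ * n * T)) l]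
  have hterm : ∀ j ∈ Finset.Icc 1 M, ∀ r ∈ Finset.range (l + 1),
      ‖l.choose r • iteratedDeriv (l - r) (χ j) x • (weakDeriv r univ (Z j) (x - j * n * T) -
        weakDeriv r univ (Z j₀) (x - j₀ * n * T))‖ ≤ 2 ^ k * K * τ := by
    intro j hj r hr
    have hrk : r ≤ k := by have := Finset.mem_range.1 hr; omega
    have hpos : 0 ≤ 2 ^ k * K * τ := by positivity
    by_cases hjj : j = j₀
    · subst hjj; simpa using hpos
    by_cases hz : iteratedDeriv (l - r) (χ j) x = 0
    · rw [hz, zero_smul, smul_zero, norm_zero]; exact hpos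
    refine (norm_choose_smul_le hl (hχ.deriv_bound j hj (l - r) (by omega) x) _).trans
      (mul_le_mul_of_nonneg_left ?_ (by positivity))
    obtain ⟨i, hi1, hiM, b1, b2, b3⟩ := hclose j₀ hj₀ j hj hjj
      (hχ.inCell_of_iteratedDeriv_ne_zero hM hj₀ (p := 0) (by simpa using hne))
      (hχ.inCell_of_iteratedDeriv_ne_zero hM hj hz)
    refine (b3 r hrk).trans ?_
    have m1 : x - i * n * T ∈ tailSet T n := by
      rintro ⟨-, h2⟩
      exact (hnull i).1 (by linarith)
    have m2 : x - (i + 1 : ℕ) * n * T ∈ tailSet T n := by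
      rintro ⟨h1, -⟩
      exact (hnull (i + 1)).2 (by linarith)
    have t1 : ‖weakDeriv r univ (fun y => χp y • (Z i y - vp i y)) (x - i * n * T)‖ ≤
        ‖tailSize T n χm χp Z vm vp (i, r) (x - i * n * T)‖ := by
      rw [tailSize, indicator_of_mem m1, Real.norm_of_nonneg (by positivity)]
      exact le_add_of_nonneg_right (norm_nonneg _)
    have t2 : ‖weakDeriv r univ (fun y => χm y • (Z (i + 1) y - vm (i + 1) y))
        (x - (i + 1 : ℕ) * n * T)‖ ≤
        ‖tailSize T n χm χp Z vm vp (i + 1, r) (x - (i + 1 : ℕ) * n * T)‖ := by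
      rw [tailSize, indicator_of_mem m2, Real.norm_of_nonneg (by positivity)]
      exact le_add_of_nonneg_left (norm_nonneg _)
    refine (add_le_add t1 t2).trans ?_
    have hsub : ({(i, r), (i + 1, r)} : Finset (ℕ × ℕ)) ⊆
        Finset.Icc 1 M ×ˢ Finset.range (k + 1) := by
      intro q hq
      simp only [Finset.mem_insert, Finset.mem_singleton] at hq
      rcases hq with rfl | rfl <;> simp <;> omega
    have := Finset.sum_le_sum_of_subset_of_nonneg hsub
      (f := fun q => ‖tailSize T n χm χp Z vm vp q (x - q.1 * n * T)‖)
      fun _ _ _ => norm_nonneg _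
    rwa [Finset.sum_pair (by simp)] at this
  calc _ ≤ ∑ j ∈ Finset.Icc 1 M, ∑ r ∈ Finset.range (l + 1), 2 ^ k * K * τ :=
        (norm_sum_le _ _).trans (Finset.sum_le_sum fun j hj =>
          (norm_sum_le _ _).trans (Finset.sum_le_sum fun r hr => hterm j hj r hr))
    _ = M * ((l + 1) * (2 ^ k * K)) * τ := by
        simp only [Finset.sum_const, Nat.card_Icc, Finset.card_range, nsmul_eq_mul]
        push_cast
        ring
    _ ≤ _ := by
        have : (l : ℝ) ≤ k := by exact_mod_cast hl
        gcongr

end Concatenation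

namespace PeriodicSystem

variable {𝔽 : Type} [RCLike 𝔽] {k m : ℕ} {T : ℝ}

lemma aestronglyMeasurable_diffOp (S : PeriodicSystem 𝔽 k m T)
    {w : ℝ → EuclideanSpace 𝔽 (Fin m)} (hw : MemHkLoc k w) :
    AEStronglyMeasurable (S.diffOp w) volume := by
  have h : AEStronglyMeasurable (fun x => ∑ i ∈ Finset.Icc 1 k,
      S.coeffCLM i x (weakDeriv i univ w x)) volume := by
    refine Finset.aestronglyMeasurable_fun_sum _ fun i hi => ?_
    obtain ⟨h1, h2⟩ := Finset.mem_Icc.1 hi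
    have hB := (S.continuous_coeffCLM h1 h2).aestronglyMeasurable (μ := volume)
    have hu := (isWeakDeriv_univ_iff.1 (hw.isWeakDeriv h2)).2.1.aestronglyMeasurable
    exact (ContinuousLinearMap.id 𝔽 (EuclideanSpace 𝔽 (Fin m) →L[𝔽] EuclideanSpace 𝔽 (Fin m))
      ).aestronglyMeasurable_comp₂ hB hu
  exact h

/-- The residual of a concatenation is controlled by the tails of the fronts, since each translated
front solves the equation and at each point only two neighbouring fronts interact. -/
lemma residual_bound (S : PeriodicSystem 𝔽 k m T) {M : ℕ} (hM : 2 ≤ M) {ρ Λ : ℝ}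
    (hΛ : S.HasBound ρ Λ) {χm χp : ℝ → ℝ} {Z vm vp : ℕ → ℝ → EuclideanSpace 𝔽 (Fin m)}
    (h : IsFrontFamily k M T χm χp Z vm vp) (hsol : ∀ j ∈ Finset.Icc 1 M, S.IsSolution (Z j))
    (hZ : ∀ j ∈ Finset.Icc 1 M, ∀ᵐ x, ‖Z j x‖ ≤ ρ) {n : ℕ} (hn : 8 ≤ n * T) {K : ℝ} (hK : 0 ≤ K)
    {χ : ℕ → ℝ → ℝ} (hχ : IsInterfacePartition k M T K n χ) :
    MemLp (fun x => S.diffOp (concatenation M T n χ Z) x +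
      S.nl (concatenation M T n χ Z x) x) 2 volume ∧
    L2Norm univ (fun x => S.diffOp (concatenation M T n χ Z) x +
      S.nl (concatenation M T n χ Z x) x) ≤
      (k + 1) * Λ * (M * ((k + 1) * (2 ^ k * K))) * ((k + 1) *
        ∑ j ∈ Finset.Icc 1 M, (HkNorm k (tailSet T n) (fun y => χm y • (Z j y - vm j y)) +
          HkNorm k (tailSet T n) (fun y => χp y • (Z j y - vp j y)))) := by
  set w := concatenation M T n χ Z with hwdef
  have hw : MemHkLoc k w := hχ.memHkLoc_concatenation h.loc
  have hwm : AEStronglyMeasurable w volume :=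
    (isWeakDeriv_univ_iff.1 (hw.isWeakDeriv (Nat.zero_le k))).1.aestronglyMeasurable
  have hwρ : ∀ᵐ x, ‖w x‖ ≤ ρ := hχ.ae_norm_concatenation_le hZ
  have hΛ0 := hΛ.nonneg
  set b : ℝ := M * ((k + 1) * (2 ^ k * K)) with hb
  have hb0 : 0 ≤ b := by positivity
  have hmem : ∀ q ∈ Finset.Icc 1 M ×ˢ Finset.range (k + 1), q.1 ∈ Finset.Icc 1 M ∧ q.2 ≤ k :=
    fun q hq => ⟨(Finset.mem_product.1 hq).1,
      Nat.lt_succ_iff.1 (Finset.mem_range.1 (Finset.mem_product.1 hq).2)⟩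
  have hmain := memLp_and_L2Norm_le_of_ae_le_sum (Finset.Icc 1 M ×ˢ Finset.range (k + 1))
    (f := fun x => S.diffOp w x + S.nl (w x) x)
    (G := fun q x => tailSize T n χm χp Z vm vp q (x - q.1 * n * T)) (c := (k + 1) * Λ * b)
    (by positivity) ((S.aestronglyMeasurable_diffOp hw).add (S.aestronglyMeasurable_nl hwm))
    (fun q hq => memLp_comp_sub (h.tailSize_bound n (hmem q hq).1 (hmem q hq).2).1 _) ?_
  · refine ⟨hmain.1, hmain.2.trans (mul_le_mul_of_nonneg_left ?_ (by positivity))⟩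
    rw [Finset.sum_product, Finset.mul_sum]
    refine Finset.sum_le_sum fun j hj => ?_
    refine (Finset.sum_le_card_nsmul _ _ (HkNorm k (tailSet T n) (fun y => χm y • (Z j y - vm j y))
      + HkNorm k (tailSet T n) (fun y => χp y • (Z j y - vp j y))) fun r hr => ?_).trans_eq
      (by rw [Finset.card_range, nsmul_eq_mul]; push_cast; ring)
    have hr' : r ≤ k := Nat.lt_succ_iff.1 (Finset.mem_range.1 hr)
    obtain ⟨h1, h2⟩ := h.tailSize_bound n hj hr'
    exact (L2Norm_comp_sub h1 (j * n * T)).trans_le h2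
  filter_upwards [h.ae_norm_weakDeriv_concatenation_sub_le hM hn hK hχ,
    ae_all_mem fun j hj => ae_comp_sub (hsol j hj).2 (j * n * T),
    ae_all_mem fun j hj => ae_comp_sub (hZ j hj) (j * n * T),
    ae_all_mem fun j hj => ae_comp_sub (h.loc j hj).weakDeriv_zero_ae_eq (j * n * T),
    hw.weakDeriv_zero_ae_eq, hwρ] with x hD heq hZx hZ0 hw0 hwx
  set τ := ∑ q ∈ Finset.Icc 1 M ×ˢ Finset.range (k + 1),
    ‖tailSize T n χm χp Z vm vp q (x - q.1 * n * T)‖ with hτ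
  obtain ⟨j, hj, hne⟩ : ∃ j ∈ Finset.Icc 1 M, χ j x ≠ 0 := by
    by_contra hc
    push Not at hc
    have := hχ.sum_eq_one x
    rw [Finset.sum_eq_zero hc] at this
    exact zero_ne_one this
  have hDj := hD j hj hne
  have e0 : S.diffOp (Z j) (x - j * n * T) + S.nl (Z j (x - j * n * T)) (x - j * n * T) = 0 :=
    heq j hj
  have ecast : x - j * n * T = x - (j * n : ℕ) * T := by push_cast; ring
  have e1 : S.diffOp (Z j) (x - j * n * T) =
      ∑ i ∈ Finset.Icc 1 k, S.coeffCLM i x (weakDeriv i univ (Z j) (x - j * n * T)) := by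
    have : S.diffOp (Z j) (x - j * n * T) = ∑ i ∈ Finset.Icc 1 k,
      S.coeffCLM i (x - j * n * T) (weakDeriv i univ (Z j) (x - j * n * T)) := rfl
    rw [this]
    refine Finset.sum_congr rfl fun i hi => ?_
    congr 1
    rw [ecast, S.coeffCLM_sub_nat_mul (Finset.mem_Icc.1 hi).1 (Finset.mem_Icc.1 hi).2]
  have e2 : S.nl (Z j (x - j * n * T)) (x - j * n * T) = S.nl (Z j (x - j * n * T)) x := by
    conv_lhs => rw [ecast]
    rw [S.nl_sub_nat_mul, ← ecast]
  rw [e1, e2] at e0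
  have e3 : S.diffOp w x + S.nl (w x) x = ∑ i ∈ Finset.Icc 1 k, S.coeffCLM i x
      (weakDeriv i univ w x - weakDeriv i univ (Z j) (x - j * n * T)) +
      (S.nl (w x) x - S.nl (Z j (x - j * n * T)) x) := by
    simp only [map_sub, Finset.sum_sub_distrib]
    rw [← sub_zero (S.diffOp w x + S.nl (w x) x), ← e0, add_sub_add_comm]
    rfl
  rw [e3]
  have n1 : ‖∑ i ∈ Finset.Icc 1 k, S.coeffCLM i x
      (weakDeriv i univ w x - weakDeriv i univ (Z j) (x - j * n * T))‖ ≤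
      ∑ i ∈ Finset.Icc 1 k, Λ * (b * τ) := by
    refine (norm_sum_le _ _).trans (Finset.sum_le_sum fun i hi => ?_)
    obtain ⟨h1, h2⟩ := Finset.mem_Icc.1 hi
    exact (ContinuousLinearMap.le_opNorm _ _).trans
      (mul_le_mul (hΛ.coeff i h1 h2 x) (hDj i h2) (norm_nonneg _) hΛ0)
  have n2 : ‖S.nl (w x) x - S.nl (Z j (x - j * n * T)) x‖ ≤ Λ * (b * τ) := by
    refine (hΛ.lip _ _ x hwx (hZx j hj)).trans (mul_le_mul_of_nonneg_left ?_ hΛ0)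
    have := hDj 0 (Nat.zero_le k)
    rwa [hw0, hZ0 j hj] at this
  refine (norm_add_le _ _).trans ((add_le_add n1 n2).trans_eq ?_)
  rw [Finset.sum_const, Nat.card_Icc, Nat.add_sub_cancel, nsmul_eq_mul]
  ring

end PeriodicSystem

/-! ### Existence of multi-fronts -/

lemma tendsto_HkNorm_tailSet {E : Type*} [NormedAddCommGroup E] [NormedSpace ℝ E]
    [CompleteSpace E] {k : ℕ} {T : ℝ} (hT : 0 < T) {f : ℝ → E} (hf : MemHk k univ f) :
    Tendsto (fun n => HkNorm k (tailSet T n) f) atTop (𝓝 0) := by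
  have h1 : Tendsto (fun n => ((k : ℝ) + 1) * ∑ l ∈ Finset.range (k + 1),
      L2Norm (tailSet T n) (weakDeriv l univ f)) atTop (𝓝 0) := by
    have := tendsto_finsetSum (Finset.range (k + 1)) fun l hl =>
      tendsto_L2Norm_tailSet hT (hf.memLp_weakDeriv (Nat.lt_succ_iff.1 (Finset.mem_range.1 hl)))
    simpa using this.const_mul ((k : ℝ) + 1)
  refine squeeze_zero (fun n => HkNorm_nonneg _ _ _) (fun n => ?_) h1
  refine HkNorm_le_of_forall_le fun i hi => ?_
  rw [L2Norm_congr (weakDeriv_ae_eq (isOpen_tailSet T n)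
    ((hf.isWeakDeriv hi).mono (subset_univ _)))]
  exact Finset.single_le_sum (f := fun l => L2Norm (tailSet T n) (weakDeriv l univ f))
    (fun _ _ => L2Norm_nonneg _ _) (Finset.mem_range.2 (by omega))

lemma IsInterfacePartition.mono {k M n : ℕ} {T K K' : ℝ} {χ : ℕ → ℝ → ℝ}
    (h : IsInterfacePartition k M T K n χ) (hK : K ≤ K') : IsInterfacePartition k M T K' n χ :=
  { h with deriv_bound := fun j hj i hi x => (h.deriv_bound j hj i hi x).trans hK }

namespace PeriodicSystem

variable {𝔽 : Type} [RCLike 𝔽] {k m : ℕ} {T : ℝ}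

lemma IsParametrix.mono {S : PeriodicSystem 𝔽 k m T} {w : ℝ → EuclideanSpace 𝔽 (Fin m)}
    {χ : ℝ → ℝ} {P : Lp (EuclideanSpace 𝔽 (Fin m)) 2 (volume : Measure ℝ) →ₗ[ℝ]
      Lp (EuclideanSpace 𝔽 (Fin m)) 2 (volume : Measure ℝ)} {A κ κ' : ℝ}
    (h : S.IsParametrix w χ P A κ) (hκ : κ ≤ κ') : S.IsParametrix w χ P A κ' := fun g =>
  ⟨(h g).1, (h g).2.1, (h g).2.2.1,
    (h g).2.2.2.trans (mul_le_mul_of_nonneg_right hκ (norm_nonneg g))⟩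

/-- For well separated interfaces, the linearizations at all formal concatenations of nondegenerate
fronts have approximate right inverses that are bounded by one and the same constant. -/
lemma exists_parametrix_concatenation (S : PeriodicSystem 𝔽 k m T) (hk : 1 ≤ k) {M : ℕ}
    (hM : 2 ≤ M) (hT : 0 < T) {ρ Λ : ℝ} (hΛ : S.HasBound ρ Λ) {χm χp : ℝ → ℝ}
    {Z vm vp : ℕ → ℝ → EuclideanSpace 𝔽 (Fin m)} (h : IsFrontFamily k M T χm χp Z vm vp)
    (hZ : ∀ j ∈ Finset.Icc 1 M, MemLp (Z j) ⊤ volume)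
    (hZρ : ∀ j ∈ Finset.Icc 1 M, ∀ᵐ x, ‖Z j x‖ ≤ ρ)
    (hnd : ∀ j ∈ Finset.Icc 1 M, S.IsNondegenerate (Z j)) :
    ∃ A : ℝ, 0 ≤ A ∧ ∃ N : ℕ, ∀ n ≥ N, ∀ (K : ℝ) (χ : ℕ → ℝ → ℝ),
      IsInterfacePartition k M T K n χ →
      ∃ P, S.IsParametrix (concatenation M T n χ Z) (fun _ => 1) P A (1 / 4) := by
  have hinv := fun j hj => (hnd j hj).exists_inverse hT (hZ j hj)
  choose! R C' hC' hR' using hinv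
  set C := ∑ j ∈ Finset.Icc 1 M, C' j with hCdef
  have hC : 0 ≤ C := Finset.sum_nonneg hC'
  have hCj : ∀ j ∈ Finset.Icc 1 M, C' j ≤ C := fun j hj => Finset.single_le_sum hC' hj
  have hΛ0 := hΛ.nonneg
  obtain ⟨B, hB, hcut⟩ := exists_slow_cutoffs k M
  -- the size of the derivatives of the cutoff functions and the distance between `w` and the fronts
  -- that keep the sum of the `M` local errors below `1 / 4`
  set D : ℝ := M * (Λ * (k * 2 ^ k + 1) * ((k + 1) * C)) with hD
  have hD0 : 0 ≤ D := by positivity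
  set η : ℝ := 1 / (4 * (D + 1)) with hη
  have hη0 : 0 < η := by positivity
  have hη1 : η ≤ 1 := by
    rw [hη, div_le_one (by positivity)]; linarith
  have hDη : D * η ≤ 1 / 4 := by
    rw [hη, mul_one_div, div_le_div_iff₀ (by positivity) (by norm_num)]; linarith
  obtain ⟨N₁, hN₁⟩ := h.exists_norm_concatenation_sub_le hk hM hT hη0
  obtain ⟨N₂, hN₂⟩ := exists_nat_gt ((8 + B / η) / T)
  refine ⟨M * (2 ^ k * ((k + 1) * C)), by positivity, max N₁ N₂, fun n hn K χ hχ => ?_⟩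
  have hnT : 8 + B / η ≤ n * T := by
    have : (N₂ : ℝ) ≤ n := by exact_mod_cast (le_max_right _ _).trans hn
    rw [div_lt_iff₀ hT] at hN₂
    nlinarith
  have hBη : 0 ≤ B / η := by positivity
  have hBn : B / (n * T) ≤ η := by
    rw [div_le_iff₀ (by linarith)]
    have : B = η * (B / η) := by field_simp
    nlinarith
  have hwρ := hχ.ae_norm_concatenation_le hZρ
  have hwm : AEStronglyMeasurable (concatenation M T n χ Z) volume :=
    (isWeakDeriv_univ_iff.1 ((hχ.memHkLoc_concatenation h.loc).isWeakDeriv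
      (Nat.zero_le k))).1.aestronglyMeasurable
  have hw : MemLp (concatenation M T n χ Z) ⊤ volume := memLp_top_of_bound hwm ρ hwρ
  have hloc : ∀ j ∈ Finset.Icc 1 M, ∃ P, S.IsParametrix (concatenation M T n χ Z) (χ j) P
      (2 ^ k * ((k + 1) * C)) (Λ * (k * 2 ^ k * η + η) * ((k + 1) * C)) := by
    intro j hj
    obtain ⟨ψ, hψ, hψ1, hψd, hψone, hψsupp⟩ := hcut (n * T) (by linarith) j hj
    have hclose := hN₁ n ((le_max_left _ _).trans hn) K χ hχ
    refine S.exists_local_parametrix hT hΛ hw hwρ (hZρ j hj) hC (fun g =>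
      ⟨(hR' j hj g).1, (hR' j hj g).2.1, fun i hi => ((hR' j hj g).2.2 i hi).trans
        (mul_le_mul_of_nonneg_right (hCj j hj) (norm_nonneg g))⟩) (j * n) hψ hψ1 hη0.le hη1 hη0.le
      (fun q h1 h2 x => (hψd q h1 h2 x).trans hBn) (hχ.smooth j hj).continuous (fun x => ?_)
      (fun x => ?_) ?_
    · rw [abs_of_nonneg (hχ.mem_Icc j hj x).1]
      exact (hχ.mem_Icc j hj x).2
    · by_cases hx : χ j x = 0
      · rw [hx, mul_zero]
      · have hcell := hχ.inCell_of_iteratedDeriv_ne_zero hM hj (p := 0) (x := x) (by simpa using hx)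
        rw [hψone x (hcell.mono (by linarith)), one_mul]
    · filter_upwards [hclose] with x hx hne
      have := hx j hj (hψsupp x hne)
      rwa [Nat.cast_mul]
  obtain ⟨P, hP⟩ := S.exists_parametrix_of_sum_eq_one (Finset.Icc 1 M) hχ.sum_eq_one hloc
  rw [Nat.card_Icc, Nat.add_sub_cancel] at hP
  exact ⟨P, hP.mono (le_of_eq_of_le (by rw [hD]; ring) hDη)⟩

end PeriodicSystem

end

theorem theoremt {𝔽 : Type} [RCLike 𝔽] (k m M : ℕ) (hk : 1 ≤ k) (hM : 2 ≤ M)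
    (T : ℝ) (hT : 0 < T) (S : PeriodicSystem 𝔽 k m T)
    (χm χp : ℝ → ℝ) (hχ : IsCutoffPair χm χp)
    (Z vm vp : ℕ → ℝ → EuclideanSpace 𝔽 (Fin m))
    -- the fronts and their end states
    (hZ : ∀ j ∈ Finset.Icc 1 M, MemLp (Z j) ⊤ volume)
    (hvm : ∀ j ∈ Finset.Icc 1 M, MemHkPer k T (vm j))
    (hvp : ∀ j ∈ Finset.Icc 1 M, MemHkPer k T (vp j))
    (hZm : ∀ j ∈ Finset.Icc 1 M, MemHk k univ fun x => χm x • (Z j x - vm j x))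
    (hZp : ∀ j ∈ Finset.Icc 1 M, MemHk k univ fun x => χp x • (Z j x - vp j x))
    -- the matching condition
    (hmatch : ∀ j, 1 ≤ j → j < M → vp j =ᵐ[volume] vm (j + 1))
    -- the fronts are nondegenerate solutions
    (hsol : ∀ j ∈ Finset.Icc 1 M, S.IsSolution (Z j))
    (hnd : ∀ j ∈ Finset.Icc 1 M, S.IsNondegenerate (Z j))
    (K : ℝ) :
    ∃ C > (0 : ℝ), ∃ N : ℕ, ∀ χ : ℕ → ℕ → ℝ → ℝ,
      (∀ n : ℕ, 1 ≤ n → IsInterfacePartition k M T K n (χ n)) →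
      ∃ a : ℕ → ℝ → EuclideanSpace 𝔽 (Fin m),
        (∀ n : ℕ, N ≤ n →
          MemHk k univ (a n) ∧
          S.IsSolution (fun x => concatenation M T n (χ n) Z x + a n x) ∧
          HkNorm k univ (a n) ≤ C * ∑ j ∈ Finset.Icc 1 M,
            (HkNorm k (tailSet T n) (fun x => χm x • (Z j x - vm j x)) +
              HkNorm k (tailSet T n) (fun x => χp x • (Z j x - vp j x)))) ∧
        Tendsto (fun n => HkNorm k univ (a n)) atTop (𝓝 0) := by
  have hF : IsFrontFamily k M T χm χp Z vm vp :=
    ⟨hχ, fun j hj => (hsol j hj).1, hvm, hvp, hZm, hZp, hmatch⟩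
  obtain ⟨ρ, hρ⟩ : ∃ ρ : ℝ, ∀ j ∈ Finset.Icc 1 M, ∀ᵐ x, ‖Z j x‖ ≤ ρ := by
    choose! ρ hρ0 hρ using fun j hj => PeriodicSystem.ae_norm_le_of_memLp_top (hZ j hj)
    refine ⟨∑ j ∈ Finset.Icc 1 M, ρ j, fun j hj => ?_⟩
    filter_upwards [hρ j hj] with x hx
    exact hx.trans (Finset.single_le_sum hρ0 hj)
  have hρ' : ∀ j ∈ Finset.Icc 1 M, ∀ᵐ x, ‖Z j x‖ ≤ ρ + 1 := fun j hj =>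
    (hρ j hj).mono fun x hx => by linarith
  obtain ⟨Λ, hΛ⟩ := S.exists_hasBound hT (ρ + 1)
  have hΛ0 := hΛ.nonneg
  obtain ⟨A, hA, N₁, hN₁⟩ := S.exists_parametrix_concatenation hk hM hT hΛ hF hZ hρ' hnd
  obtain ⟨c, hc, hsob⟩ := exists_ae_norm_le_L2Norm (EuclideanSpace 𝔽 (Fin m))
  -- the radius of the ball in which the fixed point is sought
  set d : ℝ := c * (2 * A) * (1 + 4 * Λ * A) + 1 with hd
  have hd0 : 0 < d := by positivity
  have hr1 : c * (2 * A * (1 / d)) ≤ 1 := by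
    have e : c * (2 * A * (1 / d)) = c * (2 * A) / d := by ring
    rw [e, div_le_one hd0, hd]
    have : 0 ≤ c * (2 * A) * (4 * Λ * A) := by positivity
    linarith
  have hr2 : Λ * (c * (2 * A * (1 / d))) * A ≤ 1 / 4 := by
    have e : Λ * (c * (2 * A * (1 / d))) * A = Λ * c * (2 * A) * A / d := by ring
    rw [e, div_le_div_iff₀ hd0 (by norm_num), hd]
    have : 0 ≤ c * (2 * A) := by positivity
    linarith
  let tails : ℕ → ℝ := fun n => ∑ j ∈ Finset.Icc 1 M,
    (HkNorm k (tailSet T n) (fun x => χm x • (Z j x - vm j x)) +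
      HkNorm k (tailSet T n) (fun x => χp x • (Z j x - vp j x)))
  have htails0 : ∀ n, 0 ≤ tails n := fun n => Finset.sum_nonneg fun j _ =>
    add_nonneg (HkNorm_nonneg _ _ _) (HkNorm_nonneg _ _ _)
  have htails : Tendsto tails atTop (𝓝 0) := by
    have := tendsto_finsetSum (Finset.Icc 1 M) fun j hj =>
      (tendsto_HkNorm_tailSet hT (hZm j hj)).add (tendsto_HkNorm_tailSet hT (hZp j hj))
    simpa using this
  set B : ℝ := (k + 1) * Λ * (M * ((k + 1) * (2 ^ k * |K|))) * (k + 1) with hB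
  have hB0 : 0 ≤ B := by positivity
  obtain ⟨N₂, hN₂⟩ : ∃ N₂ : ℕ, ∀ n ≥ N₂, 2 * (B * tails n) ≤ 1 / d := by
    have h1 := (htails.const_mul B).const_mul 2
    rw [mul_zero, mul_zero] at h1
    obtain ⟨N₂, h2⟩ := eventually_atTop.1 (h1.eventually (gt_mem_nhds (by positivity : 0 < 1 / d)))
    exact ⟨N₂, fun n hn => (h2 n hn).le⟩
  obtain ⟨N₃, hN₃⟩ := exists_nat_gt (8 / T)
  have hCpos : 0 < (k + 1) * (2 * A * B) + 1 := by positivity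
  refine ⟨(k + 1) * (2 * A * B) + 1, hCpos, max 1 (max N₁ (max N₂ N₃)), fun χ hpart => ?_⟩
  have hex : ∀ n, max 1 (max N₁ (max N₂ N₃)) ≤ n → ∃ a : ℝ → EuclideanSpace 𝔽 (Fin m),
      MemHk k univ a ∧ S.IsSolution (fun x => concatenation M T n (χ n) Z x + a x) ∧
      HkNorm k univ a ≤ ((k + 1) * (2 * A * B) + 1) * tails n := by
    intro n hn
    simp only [max_le_iff] at hn
    obtain ⟨hn0, hn1, hn2, hn3⟩ := hn
    have hnT : 8 ≤ n * T := by
      have : (N₃ : ℝ) ≤ n := by exact_mod_cast hn3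
      rw [div_lt_iff₀ hT] at hN₃
      nlinarith
    have hp := (hpart n hn0).mono (le_abs_self K)
    obtain ⟨P, hP⟩ := hN₁ n hn1 |K| (χ n) hp
    obtain ⟨hres, hres2⟩ := S.residual_bound hM hΛ hF hsol hρ' hnT (abs_nonneg K) hp
    have hw := hp.memHkLoc_concatenation hF.loc
    have hres3 : L2Norm univ (fun x => S.diffOp (concatenation M T n (χ n) Z) x +
        S.nl (concatenation M T n (χ n) Z x) x) ≤ B * tails n := by
      rw [hB, mul_assoc _ ((k : ℝ) + 1)]
      exact hres2
    obtain ⟨a, ha, hsola, hbd⟩ := S.exists_solution_of_parametrix hk hΛ hw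
      (isWeakDeriv_univ_iff.1 (hw.isWeakDeriv (Nat.zero_le k))).1.aestronglyMeasurable
      (hp.ae_norm_concatenation_le hρ) hA hP hc hsob (r := 1 / d) (by positivity) hr1 hr2 hres
      (by linarith [hN₂ n hn2])
    refine ⟨a, ha, hsola, (HkNorm_le_of_forall_le fun i hi => (hbd i hi).trans
      (mul_le_mul_of_nonneg_left hres3 (by positivity))).trans ?_⟩
    nlinarith [htails0 n]
  choose! a ha using hex
  refine ⟨a, ha, ?_⟩
  have hlim := htails.const_mul ((k + 1) * (2 * A * B) + 1)
  rw [mul_zero] at hlim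
  refine squeeze_zero' (Eventually.of_forall fun n => HkNorm_nonneg _ _ _) ?_ hlim
  filter_upwards [eventually_ge_atTop (max 1 (max N₁ (max N₂ N₃)))] with n hn using (ha n hn).2.2
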